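/- Let $G=(V,E)$ be a locally finite simple undirected graph and let $Q$ be the transition matrix of the simple random walk (SRW) on $G$. A (non-trivial discrete) based loop is a sequence $(x_1,\dots,x_n)\in V^n$, $n\ge 2$, with $x_1\ne x_2,\dots,x_{n-1}\neq x_n,\ x_n\ne x_1$; a loop is an equivalence class of based loops under circular permutation. For $\kappa>-1$ give the based loop $(x_1,\dots,x_n)$ the weight $$\frac1n\Big(\frac1{1+\kappa}\Big)^n Q^{x_1}_{x_2}\cdots Q^{x_{n-1}}_{x_n}Q^{x_n}_{x_1},$$ and let $\mu_\kappa$ be the push-forward of this measure to the space of loops. For $\alpha\ge 0$ let $\mathcal L_{\alpha,\kappa}$ be the Poisson ensemble of loops with intensity $\alpha\mu_\kappa$. An edge of $G$ is open if it is traversed by at least one loop of $\mathcal L_{\alpha,\kappa}$; the open cluster $\mathcal C_{\alpha,\kappa}(x)$ is the set of vertices connected to $x$ by open edges. On $\mathbb Z^d$ (with nearest-neighbour edges) put $\theta(\alpha,\kappa)=\mathbb P[\#\mathcal C_{\alpha,\kappa}(0)=\infty]$ and $$\alpha_c(\kappa)=\inf\{\alpha\ge 0:\theta(\alpha,\kappa)>0\},\qquad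 \kappa_c(\alpha)=\inf\{\kappa>-1:\theta(\alpha,\kappa)=0\}.$$ **Theorem.** For SRW loop percolation on $\mathbb Z^d$ with $d\ge 3$: 1. $\alpha_c(0)>0$; 2. $\kappa_c(\alpha)\ge 0$ for every $\alpha>0$. In contrast, for every connected, locally finite, recurrent graph $G$ (that is, the SRW on $G$ is recurrent), $\kappa=0$ and every $\alpha>0$, almost surely all the vertices of $G$ lie in the same open cluster. -/

import Mathlib

open MeasureTheory ProbabilityTheory
open scoped ENNReal NNReal

namespace LoopPercolation

noncomputable section

/-! ### Simple random walk on a locally finite graph -/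

section Walk

variable {V : Type*} (G : SimpleGraph V) [G.LocallyFinite]

/-- One step of the simple random walk from `x`: a uniformly chosen neighbour of `x`.
At an isolated vertex the walk stays put; in a connected graph this only
concerns the graph with a single vertex. -/
def stepPMF (x : V) : PMF V :=
  open Classical in
  if h : (G.neighborFinset x).Nonempty then PMF.uniformOfFinset (G.neighborFinset x) h
  else PMF.pure x

/-- The transition kernel `Q` of the simple random walk. -/
def stepKernel [MeasurableSpace V] [DiscreteMeasurableSpace V] : Kernel V V where
  toFun x := (stepPMF G x).toMeasure
  measurable' := Measurable.of_discrete

instance [MeasurableSpace V] [DiscreteMeasurableSpace V] : IsMarkovKernel (stepKernel G) :=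
  ⟨fun x => PMF.toMeasure.isProbabilityMeasure (stepPMF G x)⟩

/-- The conditional law of the position at time `n + 1` given the positions up to time `n`. -/
def historyKernel [MeasurableSpace V] [DiscreteMeasurableSpace V] (n : ℕ) :
    Kernel (Finset.Iic n → V) V :=
  (stepKernel G).comap (fun w => w ⟨n, Finset.mem_Iic.2 le_rfl⟩) (measurable_pi_apply _)

instance [MeasurableSpace V] [DiscreteMeasurableSpace V] (n : ℕ) :
    IsMarkovKernel (historyKernel G n) := by
  unfold historyKernel
  infer_instance

/-- The law, on the space of trajectories `ℕ → V`, of the simple random walk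
on `G` started from `x`. -/
def srwLaw [MeasurableSpace V] [DiscreteMeasurableSpace V] (x : V) : Measure (ℕ → V) :=
  Kernel.traj (X := fun _ => V) (historyKernel G) 0 (fun _ => x)

/-- `G` is recurrent: from each starting vertex, the simple random walk almost surely
returns to it. -/
def IsRecurrent : Prop :=
  letI : MeasurableSpace V := ⊤
  ∀ x : V, ∀ᵐ w ∂(srwLaw G x), ∃ n : ℕ, 1 ≤ n ∧ w n = x

end Walk

/-! ### Loops -/

section Loops

variable (V : Type*)

/-- Non-trivial discrete based loops: finite sequences `(x₁, …, xₙ)` with `n ≥ 2` such that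
`x₁ ≠ x₂, …, xₙ₋₁ ≠ xₙ, xₙ ≠ x₁`. -/
def BasedLoop : Type _ :=
  {l : List V // 2 ≤ l.length ∧ (l : Cycle V).Chain (· ≠ ·)}

/-- Non-trivial discrete loops: based loops up to circular permutation
(`Cycle V` is the type of lists up to rotation). -/
def DiscreteLoop : Type _ :=
  {c : Cycle V // 2 ≤ c.length ∧ c.Chain (· ≠ ·)}

instance : MeasurableSpace (BasedLoop V) := ⊤

instance : MeasurableSpace (DiscreteLoop V) := ⊤

variable {V}

/-- The equivalence class of a based loop. -/
def BasedLoop.toLoop (l : BasedLoop V) : DiscreteLoop V :=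
  ⟨(l.1 : Cycle V), l.2⟩

/-- The loop `ℓ` traverses the undirected edge `{x, y}`: some based loop in the class `ℓ`
starts with `x, y` or with `y, x`. -/
def DiscreteLoop.Traverses (ℓ : DiscreteLoop V) (x y : V) : Prop :=
  ∃ t : List V, ℓ.1 = ((x :: y :: t : List V) : Cycle V) ∨ ℓ.1 = ((y :: x :: t : List V) : Cycle V)

variable (G : SimpleGraph V) [G.LocallyFinite]

/-- The weight `(1 / n) * (1 / (1 + κ)) ^ n * Q(x₁, x₂) ⋯ Q(xₙ₋₁, xₙ) * Q(xₙ, x₁)` of the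
based loop `(x₁, …, xₙ)`, where `Q` is the transition matrix of the simple random walk. -/
def basedWeight (κ : ℝ) (l : BasedLoop V) : ℝ≥0∞ :=
  ENNReal.ofReal (1 / (l.1.length : ℝ) * (1 / (1 + κ)) ^ l.1.length) *
    (List.zipWith (fun x y => stepPMF G x y) l.1 (l.1.rotate 1)).prod

/-- The measure on based loops giving mass `basedWeight G κ l` to each based loop `l`. -/
def basedLoopMeasure (κ : ℝ) : Measure (BasedLoop V) :=
  Measure.sum fun l => basedWeight G κ l • Measure.dirac l

/-- The loop measure `μ_κ`: the image of the measure on based loops on the space of loops. -/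
def loopMeasure (κ : ℝ) : Measure (DiscreteLoop V) :=
  (basedLoopMeasure G κ).map BasedLoop.toLoop

/-- The law of the Poisson loop ensemble of intensity `α μ_κ` (for `κ > -1`).
A configuration `N : DiscreteLoop V → ℕ` records the multiplicity `N ℓ` of each loop `ℓ`, i.e. it
is the point measure `∑ ℓ, N ℓ • δ_ℓ`. Since loops form a discrete space, each loop
having finite mass, the Poisson random measure of intensity `α μ_κ` is the one
whose multiplicities are independent, `N ℓ` being Poisson with parameter `α μ_κ({ℓ})`. -/
def loopEnsemble (α : ℝ≥0) (κ : ℝ) : Measure (DiscreteLoop V → ℕ) :=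
  Measure.infinitePi fun ℓ => poissonMeasure (α * (loopMeasure G κ {ℓ}).toNNReal)

end Loops

/-! ### Loop percolation -/

section Percolation

variable {V : Type*} (G : SimpleGraph V)

/-- The graph of open edges of a configuration `N`: the edges of `G` that are traversed by at
least one loop of the configuration. -/
def openGraph (N : DiscreteLoop V → ℕ) : SimpleGraph V where
  Adj x y := G.Adj x y ∧ ∃ ℓ : DiscreteLoop V, 0 < N ℓ ∧ ℓ.Traverses x y
  symm := ⟨fun _ _ h => ⟨h.1.symm, h.2.imp fun _ hℓ => ⟨hℓ.1, hℓ.2.imp fun _ => Or.symm⟩⟩⟩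
  loopless := ⟨fun _ h => G.irrefl h.1⟩

/-- The open cluster of the vertex `x`. -/
def openCluster (N : DiscreteLoop V → ℕ) (x : V) : Set V :=
  {y | (openGraph G N).Reachable x y}

variable [G.LocallyFinite]

/-- The percolation probability `θ(α, κ)`, seen from the vertex `o`. -/
def percolationProb (o : V) (α : ℝ≥0) (κ : ℝ) : ℝ≥0∞ :=
  loopEnsemble G α κ {N | (openCluster G N o).Infinite}

/-- The critical intensity `α_c(κ) = inf {α ≥ 0 : θ(α, κ) > 0}`, as an element of `[0, ∞]`. -/
def criticalAlpha (o : V) (κ : ℝ) : ℝ≥0∞ :=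
  ⨅ (α : ℝ≥0) (_ : 0 < percolationProb G o α κ), (α : ℝ≥0∞)

/-- The critical killing parameter `κ_c(α) = inf {κ > -1 : θ(α, κ) = 0}`, as an extended real
(the infimum of the empty set being `+∞`). The model is only defined for `κ > -1`. -/
def criticalKappa (o : V) (α : ℝ≥0) : EReal :=
  ⨅ (κ : ℝ) (_ : -1 < κ ∧ percolationProb G o α κ = 0), (κ : EReal)

end Percolation

/-! ### The integer lattice -/

/-- The nearest-neighbour graph on `ℤ^d`: `x` and `y` are adjacent when their `ℓ¹`-distance
is `1`. -/
def latticeGraph (d : ℕ) : SimpleGraph (Fin d → ℤ) where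
  Adj x y := ∑ i, |x i - y i| = 1
  symm := ⟨fun x y h => by simpa only [abs_sub_comm] using h⟩
  loopless := ⟨fun x h => by simp at h⟩

instance (d : ℕ) : (latticeGraph d).LocallyFinite := fun x =>
  Set.Finite.fintype <| (Set.finite_Icc (x - 1) (x + 1)).subset fun y hy => by
    have h : ∑ i, |x i - y i| = 1 := hy
    have hi : ∀ i, |x i - y i| ≤ 1 := fun i =>
      h ▸ Finset.single_le_sum (f := fun i => |x i - y i|) (fun j _ => abs_nonneg _)
        (Finset.mem_univ i)
    refine ⟨fun i => ?_, fun i => ?_⟩ <;>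
    · have := abs_le.1 (hi i)
      simp only [Pi.sub_apply, Pi.add_apply, Pi.one_apply]
      omega

end

end LoopPercolation

/-! Where the walk returns enough, loops are abundant. Rooting a loop at `x` turns the weight `1/n`
into one over the number of visits to `x` (`tsum_cycle_eq`), and cutting at these visits turns the
mass of the loops through an edge `xy` into a series comparable from below to `∑ F ^ k / (k + 2)`,
with `F` the total weight of the excursions from `x` to `x`. If `F ≥ 1` this diverges like the
harmonic series (`loopMeasure_traverses_eq_top`), so a Poisson ensemble almost surely contains such
a loop and every edge is open. Recurrence gives `F ≥ 1` at `κ = 0` (`one_le_hitWeight`). On `ℤ^d`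
with `-1 < κ < 0` it holds too, because the polynomial decay of return probabilities loses against
the exponential factor `(1 + κ)⁻ⁿ` (`one_le_hitWeight_of_neg`). Hence percolation occurs for all
negative `κ`, which is the bound on `κ_c`.

For `α_c(0) > 0` the argument is a renormalization. The key estimate,
`exists_loopMeasure_bigLoops_le`, says that for `d ≥ 3` the mass of the loops that meet a ball of
radius `M` and are either long (length at least `M²`) or reach distance `9M` is bounded uniformly in
`M`. It rests on the heat kernel bound `n^(-d/2)` and on exponential hitting estimates, applied to
the two halves of a closed path. Outside an event of probability `O(α)`, a connection across an
annulus at scale `L` uses only loops in a ball of radius `18L`. A connection at scale `40L` produces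
two at scale `L` in far apart places, hence independent once localized. With `p_n` a bound at scale
`d * 40ⁿ` and `K` the size of a net, `p_{n+1} ≤ K C α + K² p_n²`, so `p_n` stays at most `1/2` for
small `α` (`exists_farConnected_le`). An infinite cluster then has probability at most `1/2`, hence
zero by the zero-one law. -/

namespace LoopPercolation

noncomputable section

/-! ### Weights of paths and cycles, and their decomposition at visits to a point. -/

section PathWeight

variable {V : Type*}

/-- The product of the weights `q` along the path `v :: s`. -/
def pathWeight (q : V → V → ℝ≥0∞) : V → List V → ℝ≥0∞
  | _, [] => 1
  | v, a :: s => q v a * pathWeight q a s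

/-- The product of the weights `q` along the closed path `l`. -/
def cycleWeight (q : V → V → ℝ≥0∞) (l : List V) : ℝ≥0∞ :=
  (List.zipWith q l (l.rotate 1)).prod

lemma zipWith_prod_eq_pathWeight (q : V → V → ℝ≥0∞) (v z : V) (t : List V) :
    (List.zipWith q (v :: t) (t ++ [z])).prod = pathWeight q v (t ++ [z]) := by
  induction t generalizing v with
  | nil => simp [pathWeight]
  | cons a t ih => simpa [pathWeight] using congrArg (q v a * ·) (ih a)

lemma cycleWeight_cons (q : V → V → ℝ≥0∞) (x : V) (t : List V) :
    cycleWeight q (x :: t) = pathWeight q x (t ++ [x]) := by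
  rw [cycleWeight, List.rotate_cons_succ, List.rotate_zero, zipWith_prod_eq_pathWeight]

lemma cycleWeight_rotate (q : V → V → ℝ≥0∞) (l : List V) (j : ℕ) :
    cycleWeight q (l.rotate j) = cycleWeight q l := by
  rw [cycleWeight, cycleWeight, List.rotate_rotate, Nat.add_comm, ← List.rotate_rotate,
    ← List.zipWith_rotate_distrib _ _ _ _ (by simp)]
  exact (List.rotate_perm _ _).prod_eq

lemma pathWeight_append (q : V → V → ℝ≥0∞) (v x : V) (t s : List V) :
    pathWeight q v (t ++ x :: s) = pathWeight q v (t ++ [x]) * pathWeight q x s := by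
  induction t generalizing v with
  | nil => simp [pathWeight]
  | cons a t ih => simp [pathWeight, ih, mul_assoc]

lemma pathWeight_smul (c : ℝ≥0∞) (q : V → V → ℝ≥0∞) (v : V) (s : List V) :
    pathWeight (fun x y => c * q x y) v s = c ^ s.length * pathWeight q v s := by
  induction s generalizing v with
  | nil => simp [pathWeight]
  | cons a s ih => simp only [pathWeight, ih, List.length_cons, pow_succ]; ring

lemma isChain_of_pathWeight_ne_zero {q : V → V → ℝ≥0∞} {r : V → V → Prop}
    (h : ∀ x y, q x y ≠ 0 → r x y) {v : V} {s : List V} (hs : pathWeight q v s ≠ 0) :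
    List.IsChain r (v :: s) := by
  induction s generalizing v with
  | nil => simp
  | cons a s ih =>
    rw [pathWeight, mul_ne_zero_iff] at hs
    exact List.isChain_cons_cons.2 ⟨h _ _ hs.1, ih hs.2⟩

lemma pathWeight_ne_top {q : V → V → ℝ≥0∞} (h : ∀ x y, q x y ≠ ∞) (v : V) (s : List V) :
    pathWeight q v s ≠ ∞ := by
  induction s generalizing v with
  | nil => simp [pathWeight]
  | cons a s ih => exact ENNReal.mul_ne_top (h _ _) (ih a)

lemma sum_getElem?_eq_count [DecidableEq V] (x : V) (l : List V) :
    ∑ j ∈ Finset.range l.length, (if l[j]? = some x then (1 : ℝ≥0∞) else 0) = l.count x := by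
  induction l with
  | nil => simp
  | cons a l ih =>
    rw [List.length_cons, Finset.sum_range_succ']
    simp only [List.getElem?_cons_succ, ih, List.getElem?_cons_zero, Option.some.injEq,
      List.count_cons, beq_iff_eq]
    split_ifs <;> simp

lemma rotate_bijective (j : ℕ) : Function.Bijective (fun l : List V => l.rotate j) := by
  refine ⟨List.rotate_injective j, fun l => ⟨l.rotate (l.length - j % l.length), ?_⟩⟩
  have h : l.length - j % l.length + j = l.length * (1 + j / l.length) ∨ l = [] := by
    rcases l with _ | ⟨a, l⟩
    · exact Or.inr rfl
    · left
      have h1 := Nat.mod_lt j (show 0 < (a :: l).length by simp)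
      have h2 := Nat.div_add_mod j (a :: l).length
      rw [mul_add, mul_one]
      omega
  rcases h with h | rfl
  · simp only [List.rotate_rotate]
    rw [h, List.rotate_length_mul]
  · simp

/-- Double counting: summing a rotation invariant weight, divided by the length, over all lists
is the same as summing over lists starting at `x` and dividing by the number of visits of `x`. -/
lemma tsum_cycle_eq [DecidableEq V] (x : V) (g : List V → ℝ≥0∞) (hg : ∀ l j, g (l.rotate j) = g l)
    (hx : ∀ l, g l ≠ 0 → x ∈ l) :
    ∑' l : List V, (l.length : ℝ≥0∞)⁻¹ * g l =
      ∑' t : List V, ((x :: t).count x : ℝ≥0∞)⁻¹ * g (x :: t) := by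
  -- `φ` keeps only the lists rooted at `x`. Among the rotations of `l`, exactly `l.count x` are
  -- rooted there, so summing `φ` over the rotations recovers `g l`; each rotation is then undone as
  -- a bijection of all lists.
  set φ : List V → ℝ≥0∞ := fun l =>
    if l.head? = some x then (l.count x : ℝ≥0∞)⁻¹ * g l else 0 with hφ
  have h1 : ∀ l : List V, (l.length : ℝ≥0∞)⁻¹ * g l =
      ∑' j : ℕ, if j < l.length then (l.length : ℝ≥0∞)⁻¹ * φ (l.rotate j) else 0 := by
    intro l
    have e : ∑' j : ℕ, (if j < l.length then (l.length : ℝ≥0∞)⁻¹ * φ (l.rotate j) else 0) =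
        ∑ j ∈ Finset.range l.length, (l.length : ℝ≥0∞)⁻¹ * φ (l.rotate j) := by
      rw [tsum_eq_sum (s := Finset.range l.length)]
      · exact Finset.sum_congr rfl fun j hj => if_pos (Finset.mem_range.1 hj)
      · intro j hj
        exact if_neg fun h => hj (Finset.mem_range.2 h)
    rw [e, ← Finset.mul_sum]
    congr 1
    have e2 : ∀ j ∈ Finset.range l.length, φ (l.rotate j) =
        (if l[j]? = some x then (1 : ℝ≥0∞) else 0) * ((l.count x : ℝ≥0∞)⁻¹ * g l) := by
      intro j hj
      simp only [hφ, List.head?_rotate (Finset.mem_range.1 hj), hg, (List.rotate_perm l j).count_eq]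
      split_ifs <;> simp
    rw [Finset.sum_congr rfl e2, ← Finset.sum_mul, sum_getElem?_eq_count]
    by_cases h0 : g l = 0
    · simp [h0]
    · have : 0 < l.count x := List.count_pos_iff.2 (hx l h0)
      rw [← mul_assoc, ENNReal.mul_inv_cancel (by exact_mod_cast this.ne') (by simp), one_mul]
  simp_rw [h1]
  rw [ENNReal.tsum_comm]
  have h2 : ∀ j : ℕ, ∑' l : List V,
      (if j < l.length then (l.length : ℝ≥0∞)⁻¹ * φ (l.rotate j) else 0) =
      ∑' l : List V, (if j < l.length then (l.length : ℝ≥0∞)⁻¹ * φ l else 0) := by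
    intro j
    rw [← (Equiv.ofBijective _ (rotate_bijective (V := V) j)).tsum_eq
      fun l : List V => if j < l.length then (l.length : ℝ≥0∞)⁻¹ * φ l else 0]
    simp
  simp_rw [h2]
  rw [ENNReal.tsum_comm]
  have h3 : ∀ l : List V, ∑' j : ℕ, (if j < l.length then (l.length : ℝ≥0∞)⁻¹ * φ l else 0) =
      φ l := by
    intro l
    rw [tsum_eq_sum (s := Finset.range l.length)]
    · rw [Finset.sum_congr rfl fun j hj => if_pos (Finset.mem_range.1 hj), Finset.sum_const,
        nsmul_eq_mul, ← mul_assoc, Finset.card_range]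
      rcases l with _ | ⟨a, l⟩
      · simp [hφ]
      · rw [ENNReal.mul_inv_cancel (by simp) (by simp), one_mul]
    · intro j hj
      exact if_neg fun h => hj (Finset.mem_range.2 h)
  simp_rw [h3]
  rw [← (List.cons_injective (a := x)).tsum_eq]
  · simp [hφ]
  · intro l hl
    rcases l with _ | ⟨a, l⟩
    · simp [hφ] at hl
    · have : a = x := by
        by_contra h
        simp [hφ, h] at hl
      exact ⟨l, by rw [this]⟩

lemma append_cons_inj_of_notMem_left {x : V} {a b c e : List V} (ha : x ∉ a) (hc : x ∉ c)
    (h : a ++ x :: b = c ++ x :: e) : a = c ∧ b = e := by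
  induction a generalizing c with
  | nil =>
    rcases c with _ | ⟨y, c⟩
    · simpa using h
    · simp only [List.nil_append, List.cons_append, List.cons.injEq] at h
      simp [h.1] at hc
  | cons y a ih =>
    rcases c with _ | ⟨z, c⟩
    · simp only [List.nil_append, List.cons_append, List.cons.injEq] at h
      simp [h.1] at ha
    · simp only [List.cons_append, List.cons.injEq] at h
      simp only [List.mem_cons, not_or] at ha hc
      obtain ⟨h1, h2⟩ := ih ha.2 hc.2 h.2
      exact ⟨by rw [h.1, h1], h2⟩

/-- Splitting a list at the first visit to `x`. -/
lemma tsum_count_succ [DecidableEq V] (x : V) (k : ℕ) (φ : List V → ℝ≥0∞) :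
    ∑' t : List V, (if t.count x = k + 1 then φ t else 0) =
      ∑' t₁ : List V, if x ∈ t₁ then 0 else
        ∑' t₂ : List V, if t₂.count x = k then φ (t₁ ++ x :: t₂) else 0 := by
  have h1 : ∑' t₁ : List V, (if x ∈ t₁ then 0 else
        ∑' t₂ : List V, if t₂.count x = k then φ (t₁ ++ x :: t₂) else 0) =
      ∑' t₁ : {t : List V // x ∉ t}, ∑' t₂ : List V,
        if t₂.count x = k then φ (t₁.1 ++ x :: t₂) else 0 := by
    refine Eq.trans ?_ (tsum_subtype {t : List V | x ∉ t}
      (fun t₁ => ∑' t₂ : List V, if t₂.count x = k then φ (t₁ ++ x :: t₂) else 0)).symm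
    refine tsum_congr fun t => ?_
    by_cases h : x ∈ t <;> simp [h]
  rw [h1, ← ENNReal.tsum_prod]
  let g : {t : List V // x ∉ t} × List V → List V := fun p => p.1.1 ++ x :: p.2
  have hg : Function.Injective g := by
    rintro ⟨⟨a, ha⟩, b⟩ ⟨⟨c, hc⟩, e⟩ h
    obtain ⟨h1, h2⟩ := append_cons_inj_of_notMem_left ha hc h
    subst h1; subst h2; rfl
  rw [← hg.tsum_eq]
  · refine tsum_congr fun p => ?_
    have : (g p).count x = p.2.count x + 1 := by
      simp [g, List.count_eq_zero_of_not_mem p.1.2]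
    simp [this, g]
  · intro t ht
    have h : x ∈ t := by
      by_contra h
      simp [List.count_eq_zero_of_not_mem h] at ht
    obtain ⟨a, b, rfl, h2⟩ := List.eq_append_cons_of_mem h
    exact ⟨⟨⟨a, h2⟩, b⟩, rfl⟩

/-- The total weight of the paths from `v` to `x` that visit `x` only at the end. -/
def hitWeight (q : V → V → ℝ≥0∞) (x v : V) : ℝ≥0∞ :=
  open Classical in ∑' t : List V, if x ∈ t then 0 else pathWeight q v (t ++ [x])

/-- Strong Markov property in combinatorial form: the path is a first passage from `v` to `x`
followed by `k` independent excursions from `x`. -/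
lemma tsum_pathWeight_count [DecidableEq V] (q : V → V → ℝ≥0∞) (x v : V) (k : ℕ) :
    ∑' t : List V, (if t.count x = k then pathWeight q v (t ++ [x]) else 0) =
      hitWeight q x v * hitWeight q x x ^ k := by
  induction k generalizing v with
  | zero =>
    simp only [List.count_eq_zero, pow_zero, mul_one, hitWeight]
    refine tsum_congr fun t => ?_
    by_cases h : x ∈ t <;> simp [h]
  | succ k ih =>
    rw [tsum_count_succ]
    have : ∀ t₁ : List V, (if x ∈ t₁ then 0 else ∑' t₂ : List V,
        if t₂.count x = k then pathWeight q v (t₁ ++ x :: t₂ ++ [x]) else 0) =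
        (if x ∈ t₁ then 0 else pathWeight q v (t₁ ++ [x])) *
          (hitWeight q x x * hitWeight q x x ^ k) := by
      intro t₁
      rw [← ih x]
      by_cases h : x ∈ t₁
      · simp [h]
      · simp only [h, if_false, List.append_assoc, List.cons_append]
        rw [← ENNReal.tsum_mul_left]
        refine tsum_congr fun t₂ => ?_
        rw [pathWeight_append]
        split_ifs <;> simp
    rw [tsum_congr this, ENNReal.tsum_mul_right, pow_succ']
    congr 1
    rw [hitWeight]
    refine tsum_congr fun t => ?_
    congr

lemma tsum_pathWeight_eq (q : V → V → ℝ≥0∞) (x v : V) :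
    ∑' t : List V, pathWeight q v (t ++ [x]) =
      ∑' k : ℕ, hitWeight q x v * hitWeight q x x ^ k := by
  classical
  simp_rw [← tsum_pathWeight_count]
  rw [ENNReal.tsum_comm]
  refine tsum_congr fun t => ?_
  rw [tsum_eq_single (t.count x)] <;> simp +contextual [eq_comm]

end PathWeight

/-! ### The loop measure as a sum over lists, and loops through an edge. -/

section LoopMeasure

variable {V : Type*} (G : SimpleGraph V) [G.LocallyFinite]

/-- The transition weights `Q(x, y) / (1 + κ)`. -/
def killedStep (κ : ℝ) (x y : V) : ℝ≥0∞ := ENNReal.ofReal (1 / (1 + κ)) * stepPMF G x y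

variable {G}

lemma killedStep_ne_top (κ : ℝ) (x y : V) : killedStep G κ x y ≠ ∞ :=
  ENNReal.mul_ne_top ENNReal.ofReal_ne_top (PMF.apply_ne_top _ _)

lemma zipWith_killedStep_prod (κ : ℝ) (l m : List V) (h : l.length = m.length) :
    (List.zipWith (killedStep G κ) l m).prod =
      ENNReal.ofReal (1 / (1 + κ)) ^ l.length *
        (List.zipWith (fun x y => stepPMF G x y) l m).prod := by
  induction l generalizing m with
  | nil => simp
  | cons a l ih =>
    rcases m with _ | ⟨b, m⟩
    · simp at h
    · simp only [List.zipWith_cons_cons, List.prod_cons, List.length_cons, killedStep]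
      rw [ih m (by simpa using h)]
      ring

lemma basedWeight_eq {κ : ℝ} (hκ : -1 < κ) (l : BasedLoop V) :
    basedWeight G κ l = (l.1.length : ℝ≥0∞)⁻¹ * cycleWeight (killedStep G κ) l.1 := by
  have h2 := l.2.1
  have h3 : 0 ≤ 1 / (1 + κ) := by
    have : 0 < 1 + κ := by linarith
    positivity
  rw [basedWeight, cycleWeight, zipWith_killedStep_prod _ _ _ (by simp),
    ENNReal.ofReal_mul (by positivity), ENNReal.ofReal_pow h3, one_div,
    ENNReal.ofReal_inv_of_pos (by positivity), ENNReal.ofReal_natCast, mul_assoc]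

lemma measurableSet_discreteLoop (S : Set (DiscreteLoop V)) : MeasurableSet S :=
  MeasurableSpace.measurableSet_top

lemma loopMeasure_apply (κ : ℝ) (S : Set (DiscreteLoop V)) :
    loopMeasure G κ S = ∑' l : BasedLoop V,
      S.indicator 1 l.toLoop * basedWeight G κ l := by
  rw [loopMeasure, Measure.map_apply measurable_from_top (measurableSet_discreteLoop S),
    basedLoopMeasure, Measure.sum_apply _ MeasurableSpace.measurableSet_top]
  refine tsum_congr fun l => ?_
  rw [Measure.smul_apply, Measure.dirac_apply' _ MeasurableSpace.measurableSet_top, smul_eq_mul,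
    mul_comm]
  rfl

/-- The lists representing the loops of `S`. -/
def loopLists (S : Set (DiscreteLoop V)) : Set (List V) :=
  {l | ∃ h : 2 ≤ l.length ∧ (l : Cycle V).Chain (· ≠ ·), (⟨(l : Cycle V), h⟩ : DiscreteLoop V) ∈ S}

open Classical in
/-- The mass of a set of loops as a sum over all lists. -/
lemma loopMeasure_eq_tsum_list {κ : ℝ} (hκ : -1 < κ) (S : Set (DiscreteLoop V)) :
    loopMeasure G κ S = ∑' l : List V, (l.length : ℝ≥0∞)⁻¹ *
      (if l ∈ loopLists S then cycleWeight (killedStep G κ) l else 0) := by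
  rw [loopMeasure_apply]
  refine Eq.trans ?_ (Eq.trans (tsum_subtype {l : List V | 2 ≤ l.length ∧
    (l : Cycle V).Chain (· ≠ ·)} (fun l : List V => (l.length : ℝ≥0∞)⁻¹ *
      (if l ∈ loopLists S then cycleWeight (killedStep G κ) l else 0))) ?_)
  · refine tsum_congr fun l => ?_
    rw [basedWeight_eq hκ]
    by_cases h : l.toLoop ∈ S
    · have : l.1 ∈ loopLists S := ⟨l.2, h⟩
      rw [if_pos this, Set.indicator_of_mem h, Pi.one_apply, one_mul]
    · have : l.1 ∉ loopLists S := fun ⟨_, h'⟩ => h h'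
      rw [if_neg this, Set.indicator_of_notMem h, zero_mul, mul_zero]
  · refine tsum_congr fun l => ?_
    rw [Set.indicator_apply]
    split_ifs with h h'
    · rfl
    · rfl
    · rename_i h'
      obtain ⟨h'', -⟩ := h'
      exact absurd h'' h
    · rw [mul_zero]

lemma mem_loopLists_of_isRotated {S : Set (DiscreteLoop V)} {l m : List V}
    (h : (l : Cycle V) = m) (hl : l ∈ loopLists S) : m ∈ loopLists S := by
  obtain ⟨⟨h1, h2⟩, h3⟩ := hl
  have h4 : l.length = m.length := congrArg Cycle.length h
  have h5 : (m : Cycle V).Chain (· ≠ ·) := h ▸ h2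
  refine ⟨⟨h4 ▸ h1, h5⟩, ?_⟩
  convert h3 using 1
  exact Subtype.ext h.symm

lemma cycleWeight_ne_top (κ : ℝ) (l : List V) : cycleWeight (killedStep G κ) l ≠ ∞ := by
  rcases l with _ | ⟨x, t⟩
  · simp [cycleWeight]
  · rw [cycleWeight_cons]
    exact pathWeight_ne_top (killedStep_ne_top κ) _ _

/-- A loop has finitely many based representatives. This matters because the Poisson parameters are
defined through `toNNReal`, which would send an infinite mass to zero. -/
lemma loopMeasure_singleton_ne_top {κ : ℝ} (hκ : -1 < κ) (ℓ : DiscreteLoop V) :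
    loopMeasure G κ {ℓ} ≠ ∞ := by
  classical
  obtain ⟨⟨l⟩, hl⟩ := ℓ
  rw [loopMeasure_eq_tsum_list hκ, tsum_eq_sum (s := l.cyclicPermutations.toFinset)]
  · refine ENNReal.sum_ne_top.2 fun m _ => ?_
    split_ifs with h
    · refine ENNReal.mul_ne_top (ENNReal.inv_ne_top.2 ?_) (cycleWeight_ne_top κ m)
      have := h.1.1
      exact_mod_cast (by omega : m.length ≠ 0)
    · simp
  · intro m hm
    rw [if_neg, mul_zero]
    rintro ⟨h, h'⟩
    refine hm (List.mem_toFinset.2 (List.mem_cyclicPermutations_iff.2 ?_))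
    exact Quotient.exact (congrArg Subtype.val h')

lemma stepPMF_ne_zero {x y : V} (h : (G.neighborFinset x).Nonempty) :
    stepPMF G x y ≠ 0 ↔ G.Adj x y := by
  rw [stepPMF, dif_pos h, ← PMF.mem_support_iff, PMF.mem_support_uniformOfFinset_iff,
    SimpleGraph.mem_neighborFinset]

/-- If the return weight to `x` is at least one, the loops through any edge at `x` have infinite
mass. -/
lemma loopMeasure_traverses_eq_top {κ : ℝ} (hκ : -1 < κ)
    (hne : ∀ v, (G.neighborFinset v).Nonempty) {x y : V} (hxy : G.Adj x y)
    (hF : 1 ≤ hitWeight (killedStep G κ) x x) :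
    loopMeasure G κ {ℓ : DiscreteLoop V | ℓ.Traverses x y} = ∞ := by
  classical
  set q := killedStep G κ with hq
  have hpos : ENNReal.ofReal (1 / (1 + κ)) ≠ 0 := by
    have : 0 < 1 + κ := by linarith
    simpa using this
  have hq0 : ∀ a b, q a b ≠ 0 ↔ G.Adj a b := fun a b => by
    rw [hq, killedStep, mul_ne_zero_iff, stepPMF_ne_zero (hne a)]
    exact and_iff_right hpos
  have hyx : hitWeight q x y ≠ 0 := by
    refine ne_of_gt (lt_of_lt_of_le ?_ (ENNReal.le_tsum []))
    simpa [pathWeight, pos_iff_ne_zero] using (hq0 y x).2 hxy.symm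
  rw [loopMeasure_eq_tsum_list hκ, tsum_cycle_eq x]
  · refine top_le_iff.1 ?_
    -- Only representatives beginning with `x, y` are counted. Grouping them by the number `k` of
    -- later visits to `x` leaves, since `F ^ k ≥ 1`, at least a constant times `1 / (k + 2)`.
    have h1 : ∀ t : List V, ∑' k : ℕ, q x y * (((k + 2 : ℕ) : ℝ≥0∞)⁻¹ *
        (if t.count x = k then pathWeight q y (t ++ [x]) else 0)) ≤
        (((x :: y :: t).count x : ℕ) : ℝ≥0∞)⁻¹ *
        (if x :: y :: t ∈ loopLists {ℓ : DiscreteLoop V | ℓ.Traverses x y} then cycleWeight q (x :: y :: t) else 0) := by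
      intro t
      rw [tsum_eq_single (t.count x) (by simp +contextual [eq_comm]), if_pos rfl]
      by_cases h0 : q x y * pathWeight q y (t ++ [x]) = 0
      · rw [mul_left_comm, h0]; simp
      have h2 : pathWeight q x ((y :: t) ++ [x]) ≠ 0 := h0
      have h3 : ((x :: y :: t : List V) : Cycle V).Chain (· ≠ ·) := by
        rw [Cycle.chain_coe_cons]
        exact isChain_of_pathWeight_ne_zero (fun a b h => ((hq0 a b).1 h).ne) h2
      rw [if_pos ⟨⟨by simp, h3⟩, t, Or.inl rfl⟩, cycleWeight_cons, mul_left_comm]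
      refine mul_le_mul' ?_ le_rfl
      rw [ENNReal.inv_le_inv]
      have : (x :: y :: t).count x ≤ t.count x + 2 := by
        rw [List.count_cons_self, List.count_cons]
        split_ifs <;> omega
      exact_mod_cast this
    calc (∞ : ℝ≥0∞) = q x y * (hitWeight q x y * ∑' k : ℕ, ((k + 2 : ℕ) : ℝ≥0∞)⁻¹) := by
          have : ∑' k : ℕ, ((k + 2 : ℕ) : ℝ≥0∞)⁻¹ = ∞ := by
            by_contra h
            have h' := ENNReal.summable_toReal h
            have := (summable_nat_add_iff (f := fun n : ℕ => ((n : ℝ))⁻¹) 2).1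
              (by
                refine h'.congr fun k => ?_
                rw [ENNReal.toReal_inv, ENNReal.toReal_natCast])
            exact Real.not_summable_natCast_inv this
          rw [this, ENNReal.mul_top hyx, ENNReal.mul_top ((hq0 x y).2 hxy)]
      _ ≤ ∑' k : ℕ, q x y * (((k + 2 : ℕ) : ℝ≥0∞)⁻¹ *
          ∑' t : List V, (if t.count x = k then pathWeight q y (t ++ [x]) else 0)) := by
          rw [← ENNReal.tsum_mul_left, ← ENNReal.tsum_mul_left]
          refine ENNReal.tsum_le_tsum fun k => mul_le_mul' le_rfl ?_
          rw [tsum_pathWeight_count, mul_comm]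
          refine mul_le_mul' le_rfl ?_
          exact le_mul_of_one_le_right' (one_le_pow₀ hF)
      _ = ∑' t : List V, ∑' k : ℕ, q x y * (((k + 2 : ℕ) : ℝ≥0∞)⁻¹ *
          (if t.count x = k then pathWeight q y (t ++ [x]) else 0)) := by
          simp_rw [← ENNReal.tsum_mul_left]
          rw [ENNReal.tsum_comm]
      _ ≤ _ := ENNReal.tsum_le_tsum h1
      _ ≤ _ := ENNReal.tsum_comp_le_tsum_of_injective (List.cons_injective (a := y)) _
  · intro l j
    have e : (l : Cycle V) = (l.rotate j : List V) := Quotient.sound ⟨j, rfl⟩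
    have e2 : l.rotate j ∈ loopLists {ℓ : DiscreteLoop V | ℓ.Traverses x y} ↔
        l ∈ loopLists {ℓ : DiscreteLoop V | ℓ.Traverses x y} :=
      ⟨mem_loopLists_of_isRotated e.symm, mem_loopLists_of_isRotated e⟩
    simp only [e2, cycleWeight_rotate]
  · intro l hl
    obtain ⟨h, t, ht⟩ : l ∈ loopLists {ℓ : DiscreteLoop V | ℓ.Traverses x y} := by
      by_contra h
      exact hl (if_neg h)
    have : x ∈ (l : Cycle V) := by
      rcases ht with ht | ht
      · rw [show (l : Cycle V) = _ from ht]; simp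
      · rw [show (l : Cycle V) = _ from ht]; simp
    simpa using this

end LoopMeasure

/-! ### Finite-time expectations and `n`-step transition weights. -/

section PathSum

variable {V : Type*}

/-- The sum of `pathWeight q v s * F s` over the lists `s` of length `n`: when `q` is
a stochastic matrix, the expectation of `F` of the first `n` steps of the chain started at `v`. -/
def pathSum (q : V → V → ℝ≥0∞) : ℕ → V → (List V → ℝ≥0∞) → ℝ≥0∞
  | 0, _, F => F []
  | n + 1, v, F => ∑' a, q v a * pathSum q n a (fun s => F (a :: s))

lemma tsum_list_eq (g : List V → ℝ≥0∞) :
    ∑' s : List V, g s = g [] + ∑' a : V, ∑' t : List V, g (a :: t) := by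
  classical
  rw [ENNReal.tsum_eq_add_tsum_ite []]
  congr 1
  rw [← ENNReal.tsum_prod]
  have hinj : Function.Injective (fun p : V × List V => p.1 :: p.2) := by
    rintro ⟨a, s⟩ ⟨b, t⟩ h
    simpa using h
  rw [← hinj.tsum_eq]
  · simp
  · intro s hs
    rcases s with _ | ⟨a, t⟩
    · simp at hs
    · exact ⟨(a, t), rfl⟩

/-- The recursion is suited to Markov-type inductions; this closed form is suited to linearity and
to exchanging sums. -/
lemma pathSum_eq_tsum (q : V → V → ℝ≥0∞) (n : ℕ) (v : V) (F : List V → ℝ≥0∞) :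
    pathSum q n v F = ∑' s : List V, if s.length = n then pathWeight q v s * F s else 0 := by
  induction n generalizing v F with
  | zero => rw [tsum_list_eq]; simp [pathSum, pathWeight]
  | succ n ih =>
    rw [tsum_list_eq]
    simp only [pathSum, ih, List.length_nil, List.length_cons, Nat.add_right_cancel_iff, pathWeight,
      ← ENNReal.tsum_mul_left, (Nat.add_one_ne_zero n).symm, if_false, zero_add]
    refine tsum_congr fun a => tsum_congr fun t => ?_
    split_ifs
    · rw [mul_assoc]
    · rw [mul_zero]

lemma tsum_pathWeight_mul (q : V → V → ℝ≥0∞) (v : V) (F : List V → ℝ≥0∞) :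
    ∑' s : List V, pathWeight q v s * F s = ∑' n : ℕ, pathSum q n v F := by
  simp_rw [pathSum_eq_tsum]
  rw [ENNReal.tsum_comm]
  refine tsum_congr fun s => ?_
  rw [tsum_eq_single s.length] <;> simp +contextual [eq_comm]

variable {q : V → V → ℝ≥0∞}

lemma pathSum_mono (n : ℕ) (v : V) {F H : List V → ℝ≥0∞} (h : ∀ s, F s ≤ H s) :
    pathSum q n v F ≤ pathSum q n v H := by
  induction n generalizing v F H with
  | zero => exact h []
  | succ n ih => exact ENNReal.tsum_le_tsum fun a => mul_le_mul' le_rfl (ih a fun s => h _)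

lemma pathSum_mul_right (n : ℕ) (v : V) (F : List V → ℝ≥0∞) (c : ℝ≥0∞) :
    pathSum q n v (fun s => F s * c) = pathSum q n v F * c := by
  simp_rw [pathSum_eq_tsum]
  rw [← ENNReal.tsum_mul_right]
  refine tsum_congr fun s => ?_
  split_ifs
  · rw [mul_assoc]
  · rw [zero_mul]

lemma pathSum_tsum {ι : Type*} (n : ℕ) (v : V) (F : ι → List V → ℝ≥0∞) :
    pathSum q n v (fun s => ∑' i, F i s) = ∑' i, pathSum q n v (F i) := by
  simp_rw [pathSum_eq_tsum]
  rw [ENNReal.tsum_comm]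
  refine tsum_congr fun s => ?_
  split_ifs
  · rw [ENNReal.tsum_mul_left]
  · simp

lemma pathSum_add_le (n : ℕ) (v : V) {F H K : List V → ℝ≥0∞} (h : ∀ s, F s ≤ H s + K s) :
    pathSum q n v F ≤ pathSum q n v H + pathSum q n v K := by
  refine (pathSum_mono n v h).trans_eq ?_
  simp_rw [pathSum_eq_tsum]
  rw [← ENNReal.tsum_add]
  refine tsum_congr fun s => ?_
  split_ifs
  · rw [mul_add]
  · simp

/-- Markov property at time `a`; `s.getLastD v` is the position after the path `v :: s`. -/
lemma pathSum_append (a b : ℕ) (v : V) (F : List V → ℝ≥0∞) :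
    pathSum q (a + b) v F =
      pathSum q a v (fun s => pathSum q b (s.getLastD v) (fun t => F (s ++ t))) := by
  induction a generalizing v F with
  | zero => simp [pathSum]
  | succ a ih =>
    rw [Nat.succ_add_eq_add_succ, Nat.add_succ]
    simp only [pathSum, ih, List.getLastD_cons, List.cons_append]

lemma pathSum_smul (c : ℝ≥0∞) (n : ℕ) (v : V) (F : List V → ℝ≥0∞) :
    pathSum (fun x y => c * q x y) n v F = c ^ n * pathSum q n v F := by
  simp_rw [pathSum_eq_tsum]
  rw [← ENNReal.tsum_mul_left]
  refine tsum_congr fun s => ?_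
  split_ifs with h
  · rw [pathWeight_smul, h, mul_assoc]
  · rw [mul_zero]

lemma pathSum_const (hq : ∀ v, ∑' a, q v a = 1) (n : ℕ) (v : V) (c : ℝ≥0∞) :
    pathSum q n v (fun _ => c) = c := by
  induction n generalizing v with
  | zero => rfl
  | succ n ih => simp only [pathSum, ih, ENNReal.tsum_mul_right, hq, one_mul]

lemma getLastD_append (s t : List V) (v : V) :
    (s ++ t).getLastD v = t.getLastD (s.getLastD v) := by
  induction s generalizing v with
  | nil => simp
  | cons a s ih => rw [List.cons_append, List.getLastD_cons, ih, List.getLastD_cons]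

open Classical in
/-- The `n`-step transition weights. -/
def heat (q : V → V → ℝ≥0∞) (n : ℕ) (x y : V) : ℝ≥0∞ :=
  pathSum q n x (fun s => if s.getLastD x = y then 1 else 0)

lemma pathSum_getLastD (n : ℕ) (x : V) (g : V → ℝ≥0∞) :
    pathSum q n x (fun s => g (s.getLastD x)) = ∑' m, heat q n x m * g m := by
  classical
  simp_rw [heat, ← pathSum_mul_right]
  rw [← pathSum_tsum]
  congr 1
  funext s
  rw [tsum_eq_single (s.getLastD x)] <;> simp +contextual [eq_comm]

lemma heat_zero [DecidableEq V] (x y : V) : heat q 0 x y = if x = y then 1 else 0 := by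
  simp only [heat, pathSum, List.getLastD_nil]
  congr

lemma heat_succ (n : ℕ) (x y : V) : heat q (n + 1) x y = ∑' a, q x a * heat q n a y := by
  classical
  rw [heat, pathSum]
  refine tsum_congr fun a => ?_
  rw [heat]
  congr 2
  funext s
  exact if_congr (by rw [List.getLastD_cons]) rfl rfl

lemma heat_add (a b : ℕ) (x y : V) :
    heat q (a + b) x y = ∑' m, heat q a x m * heat q b m y := by
  classical
  rw [← pathSum_getLastD a x (fun m => heat q b m y), heat, pathSum_append]
  congr 1
  funext s
  rw [heat]
  congr 1
  funext t
  exact if_congr (by rw [getLastD_append]) rfl rfl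

lemma heat_one (x y : V) : heat q 1 x y = q x y := by
  classical
  rw [heat_succ, tsum_eq_single y] <;> simp +contextual [heat_zero]

lemma heat_comm (hs : ∀ x y, q x y = q y x) (n : ℕ) (x y : V) :
    heat q n x y = heat q n y x := by
  classical
  induction n generalizing x y with
  | zero => simp [heat_zero, eq_comm]
  | succ n ih =>
    rw [heat_succ, heat_add]
    refine tsum_congr fun a => ?_
    rw [heat_one, ih a y, hs x a, mul_comm]

lemma tsum_heat (hq : ∀ v, ∑' a, q v a = 1) (n : ℕ) (x : V) : ∑' y, heat q n x y = 1 := by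
  have := pathSum_getLastD (q := q) n x (fun _ => 1)
  simp only [mul_one] at this
  rw [← this, pathSum_const hq]

lemma tsum_heat_left (hq : ∀ v, ∑' a, q v a = 1) (hs : ∀ x y, q x y = q y x) (n : ℕ) (y : V) :
    ∑' x, heat q n x y = 1 := by
  simp_rw [heat_comm hs n _ y]
  exact tsum_heat hq n y

lemma pathSum_snoc (n : ℕ) (x y : V) :
    ∑' t : List V, (if t.length = n then pathWeight q x (t ++ [y]) else 0) = heat q (n + 1) x y := by
  induction n generalizing x with
  | zero => rw [tsum_list_eq]; simp [heat_one, pathWeight]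
  | succ n ih =>
    rw [tsum_list_eq, heat_succ]
    simp only [← ih, List.length_nil, List.length_cons, Nat.add_right_cancel_iff, pathWeight,
      ← ENNReal.tsum_mul_left, (Nat.add_one_ne_zero n).symm, if_false, zero_add, List.cons_append]
    refine tsum_congr fun a => tsum_congr fun t => ?_
    split_ifs
    · rfl
    · rw [mul_zero]

/-- Sorting paths by length identifies their total weight with the Green function, the time-zero
term excluded. -/
lemma tsum_pathWeight_closed (x y : V) :
    ∑' t : List V, pathWeight q x (t ++ [y]) = ∑' n : ℕ, heat q (n + 1) x y := by
  simp_rw [← pathSum_snoc]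
  rw [ENNReal.tsum_comm]
  refine tsum_congr fun s => ?_
  rw [tsum_eq_single s.length] <;> simp +contextual [eq_comm]

end PathSum

/-! ### The Poisson ensemble: sets of infinite mass are almost surely charged. -/

section Ensemble

variable {V : Type*} {G : SimpleGraph V} [G.LocallyFinite]

instance [Countable V] : Countable (DiscreteLoop V) :=
  have : Countable (Cycle V) := inferInstanceAs (Countable (Quotient (List.IsRotated.setoid V)))
  inferInstanceAs (Countable {c : Cycle V // 2 ≤ c.length ∧ c.Chain (· ≠ ·)})

instance (α : ℝ≥0) (κ : ℝ) : IsProbabilityMeasure (loopEnsemble G α κ) :=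
  inferInstanceAs (IsProbabilityMeasure (Measure.infinitePi _))

lemma loopMeasure_eq_tsum_singleton [Countable V] (κ : ℝ) (S : Set (DiscreteLoop V)) :
    loopMeasure G κ S = ∑' ℓ : S, loopMeasure G κ {ℓ.1} := by
  have : MeasurableSingletonClass (DiscreteLoop V) := ⟨fun _ => measurableSet_discreteLoop _⟩
  rw [← Measure.tsum_indicator_apply_singleton _ S (measurableSet_discreteLoop S)]
  exact (tsum_subtype S fun ℓ => loopMeasure G κ {ℓ}).symm

/-- If the loops of `S` have infinite mass, almost surely some loop of `S` is present. -/
lemma ae_exists_loop [Countable V] {κ : ℝ} (hκ : -1 < κ) {α : ℝ≥0} (hα : 0 < α)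
    {S : Set (DiscreteLoop V)} (hS : loopMeasure G κ S = ∞) :
    ∀ᵐ N ∂(loopEnsemble G α κ), ∃ ℓ ∈ S, 0 < N ℓ := by
  rw [ae_iff]
  -- Void probabilities of finite subsets suffice: the mass of `F` can be made arbitrarily large,
  -- driving the exponential to zero.
  have key : ∀ F : Finset S, loopEnsemble G α κ {N | ¬ ∃ ℓ ∈ S, 0 < N ℓ} ≤
      ENNReal.ofReal (Real.exp (-(α * (∑ ℓ ∈ F, loopMeasure G κ {ℓ.1}).toReal))) := by
    intro F
    calc loopEnsemble G α κ {N | ¬ ∃ ℓ ∈ S, 0 < N ℓ}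
        ≤ loopEnsemble G α κ
          (Set.pi ((F.map (Function.Embedding.subtype _) : Finset (DiscreteLoop V)) :
            Set (DiscreteLoop V)) (fun _ => {0})) := by
          refine measure_mono fun N hN ℓ hℓ => ?_
          simp only [Finset.coe_map, Function.Embedding.subtype_apply, Set.mem_image,
            Finset.mem_coe] at hℓ
          obtain ⟨ℓ', -, rfl⟩ := hℓ
          by_contra h
          exact hN ⟨ℓ'.1, ℓ'.2, Nat.pos_of_ne_zero h⟩
      _ = _ := by
          rw [loopEnsemble, Measure.infinitePi_pi _ (fun _ _ => measurableSet_singleton _)]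
          simp only [poissonMeasure_singleton, pow_zero, mul_one, Nat.factorial_zero, Nat.cast_one,
            div_one, Finset.prod_map, Function.Embedding.subtype_apply]
          rw [← ENNReal.ofReal_prod_of_nonneg (fun _ _ => (Real.exp_pos _).le), ← Real.exp_sum,
            ENNReal.toReal_sum (fun ℓ _ => loopMeasure_singleton_ne_top hκ ℓ.1), Finset.mul_sum,
            ← Finset.sum_neg_distrib]
          rfl
  refine le_antisymm (ENNReal.le_of_forall_pos_le_add fun ε hε _ => ?_) bot_le
  rw [loopMeasure_eq_tsum_singleton] at hS
  obtain ⟨c, hc⟩ : ∃ c : ℝ, Real.exp (-(α * c)) ≤ ε := by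
    refine ⟨- Real.log ε / α, ?_⟩
    rw [mul_div_cancel₀ _ (by exact_mod_cast hα.ne'), neg_neg, Real.exp_log (by exact_mod_cast hε)]
  obtain ⟨F, hF⟩ : ∃ F : Finset S, ENNReal.ofReal c < ∑ ℓ ∈ F, loopMeasure G κ {ℓ.1} := by
    rw [ENNReal.tsum_eq_iSup_sum] at hS
    exact lt_iSup_iff.1 (hS ▸ ENNReal.ofReal_lt_top)
  refine (key F).trans ?_
  rw [zero_add, ENNReal.ofReal_le_iff_le_toReal ENNReal.coe_ne_top]
  refine (Real.exp_le_exp.2 ?_).trans hc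
  rw [neg_le_neg_iff]
  refine mul_le_mul_of_nonneg_left ?_ α.2
  exact (ENNReal.ofReal_le_iff_le_toReal (ENNReal.sum_ne_top.2 fun ℓ _ =>
    loopMeasure_singleton_ne_top hκ ℓ.1)).1 hF.le

/-- If every edge is traversed by loops of infinite total mass, almost surely all the edges are
open. -/
lemma ae_forall_mem_openCluster [Countable V] (hG : G.Connected) {κ : ℝ} (hκ : -1 < κ) {α : ℝ≥0}
    (hα : 0 < α)
    (h : ∀ x y, G.Adj x y → loopMeasure G κ {ℓ : DiscreteLoop V | ℓ.Traverses x y} = ∞) :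
    ∀ᵐ N ∂(loopEnsemble G α κ), ∀ x y : V, y ∈ openCluster G N x := by
  have h1 : ∀ᵐ N ∂(loopEnsemble G α κ), ∀ x y : V, G.Adj x y → (openGraph G N).Adj x y := by
    rw [ae_all_iff]; intro x
    rw [ae_all_iff]; intro y
    by_cases hxy : G.Adj x y
    · filter_upwards [ae_exists_loop hκ hα (h x y hxy)] with N ⟨ℓ, h1, h2⟩ _
      exact ⟨hxy, ℓ, h2, h1⟩
    · exact ae_of_all _ fun N h => absurd h hxy
  filter_upwards [h1] with N hN x y
  exact (hG x y).mono fun a b hab => hN a b hab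

/-- By local finiteness, the endpoints of walks of a given length from a fixed vertex form a
countable set; connectedness exhausts `V` by these. -/
lemma countable_of_connected (hG : G.Connected) : Countable V := by
  obtain ⟨x⟩ := hG.nonempty
  have h : ∀ n : ℕ, {y | ∃ p : G.Walk x y, p.length = n}.Countable := by
    intro n
    induction n with
    | zero =>
      refine (Set.countable_singleton x).mono ?_
      rintro y ⟨p, hp⟩
      exact (SimpleGraph.Walk.eq_of_length_eq_zero hp).symm
    | succ n ih =>
      refine (ih.biUnion (t := fun v _ => G.neighborSet v)
        fun v _ => (Set.toFinite (G.neighborSet v)).countable).mono ?_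
      rintro y ⟨p, hp⟩
      have hp' : p.reverse.length = n + 1 := by simpa using hp
      cases hr : p.reverse with
      | nil => simp [hr] at hp'
      | cons hadj r =>
        rw [hr, SimpleGraph.Walk.length_cons, Nat.add_right_cancel_iff] at hp'
        exact Set.mem_biUnion ⟨r.reverse, by simpa using hp'⟩ hadj.symm
  rw [← Set.countable_univ_iff]
  refine (Set.countable_iUnion h).mono fun y _ => ?_
  obtain ⟨p⟩ := hG x y
  exact Set.mem_iUnion.2 ⟨p.length, p, rfl⟩

end Ensemble

/-! ### From the trajectory law of the walk to path weights. -/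

section Recurrent

lemma pathWeight_concat {V : Type*} (q : V → V → ℝ≥0∞) (v a : V) (s : List V) :
    pathWeight q v (s ++ [a]) = pathWeight q v s * q (s.getLastD v) a := by
  induction s generalizing v with
  | nil => simp [pathWeight]
  | cons b s ih => rw [List.cons_append, pathWeight, ih, pathWeight, List.getLastD_cons, mul_assoc]

variable {V : Type*} {G : SimpleGraph V} [G.LocallyFinite] [MeasurableSpace V]
  [DiscreteMeasurableSpace V]

instance (x : V) : IsProbabilityMeasure (srwLaw G x) := by
  unfold srwLaw; infer_instance

lemma srwLaw_zero [MeasurableSingletonClass V] (x : V) : srwLaw G x {w | w 0 ≠ x} = 0 := by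
  have h : (srwLaw G x).map (Preorder.frestrictLe 0) =
      Kernel.partialTraj (X := fun _ => V) (historyKernel G) 0 0 (fun _ => x) :=
    Kernel.traj_map_frestrictLe_apply 0 0 _
  rw [Kernel.partialTraj_self, Kernel.id_apply] at h
  have hm : MeasurableSet {u : Finset.Iic 0 → V | u ⟨0, by simp⟩ ≠ x} :=
    measurableSet_preimage (f := fun u : Finset.Iic 0 → V => u ⟨0, by simp⟩)
      (measurable_pi_apply _) (MeasurableSet.singleton x).compl
  have := congrArg (fun μ => μ {u : Finset.Iic 0 → V | u ⟨0, by simp⟩ ≠ x}) h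
  rw [Measure.map_apply (Preorder.measurable_frestrictLe 0) hm, Measure.dirac_apply' _ hm] at this
  simpa using this

lemma srwLaw_step (x : V) (n : ℕ) :
    ((srwLaw G x).map (Preorder.frestrictLe n)) ⊗ₘ historyKernel G n =
      (srwLaw G x).map (fun w => (Preorder.frestrictLe n w, w (n + 1))) := by
  rw [srwLaw, Kernel.traj_map_frestrictLe_apply]
  exact Kernel.partialTraj_compProd_eq_map_traj zero_le

/-- One inequality is enough for the return estimate, and it spares any comparison of `v` with the
starting point `x`: the empty path only needs that probabilities are at most one. -/
lemma srwLaw_cylinder_le [Countable V] (x v : V) (s : List V) :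
    srwLaw G x {w | (List.range (s.length + 1)).map w = v :: s} ≤
      pathWeight (fun a b => stepPMF G a b) v s := by
  induction s using List.reverseRecOn with
  | nil => exact prob_le_one
  | append_singleton s a ih =>
    rw [pathWeight_concat]
    set n := s.length with hn
    have hlast : ∀ w : ℕ → V, (List.range (n + 1)).map w = v :: s → w n = s.getLastD v := by
      intro w hw
      have := congrArg (fun l => l.getLastD v) hw
      simp only [List.range_succ, List.map_append, List.map_singleton, getLastD_append,
        List.getLastD_cons] at this
      exact this
    have hlen : (s ++ [a]).length + 1 = n + 1 + 1 := by simp [hn]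
    let A : Set (Finset.Iic n → V) := Preorder.frestrictLe n ''
      {w : ℕ → V | (List.range (n + 1)).map w = v :: s}
    have hA : MeasurableSet A := A.to_countable.measurableSet
    have hAiff : ∀ w : ℕ → V, Preorder.frestrictLe n w ∈ A ↔
        (List.range (n + 1)).map w = v :: s := by
      intro w
      refine ⟨?_, fun h => ⟨w, h, rfl⟩⟩
      rintro ⟨w', h1, h2⟩
      rw [← h1]
      refine List.map_congr_left fun i hi => ?_
      have hi' : i ∈ Finset.Iic n := by simpa [Nat.lt_succ_iff] using hi
      exact (congrFun h2 ⟨i, hi'⟩).symm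
    have hset : {w : ℕ → V | (List.range ((s ++ [a]).length + 1)).map w = v :: (s ++ [a])} =
        (fun w => (Preorder.frestrictLe n w, w (n + 1))) ⁻¹' (A ×ˢ {a}) := by
      ext w
      rw [Set.mem_ofPred_eq, hlen, List.range_succ, List.map_append, ← List.cons_append,
        Set.mem_preimage, Set.mem_prod, hAiff, Set.mem_singleton_iff]
      refine ⟨fun h => ?_, fun h => ?_⟩
      · have := List.append_inj' h (by simp)
        exact ⟨this.1, by simpa using this.2⟩
      · rw [h.1, List.map_singleton, show w (n + 1) = a from h.2]
    rw [hset, ← Measure.map_apply (by fun_prop) (hA.prod (measurableSet_singleton a)),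
      ← srwLaw_step, Measure.compProd_apply_prod hA (measurableSet_singleton a)]
    have hker : ∀ u ∈ A, historyKernel G n u {a} = stepPMF G (s.getLastD v) a := by
      rintro u ⟨w, hw, rfl⟩
      rw [historyKernel, Kernel.comap_apply]
      change (stepPMF G (w n)).toMeasure {a} = _
      rw [PMF.toMeasure_apply_singleton _ _ (measurableSet_singleton a), hlast w hw]
    rw [setLIntegral_congr_fun hA hker, setLIntegral_const, mul_comm,
      Measure.map_apply (by fun_prop) hA]
    refine mul_le_mul' ?_ le_rfl
    refine le_trans (measure_mono fun w hw => ?_) ih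
    exact (hAiff w).1 hw

/-- The return weight of a recurrent walk is at least one. -/
lemma one_le_hitWeight [Countable V] {x : V}
    (h : ∀ᵐ w ∂(srwLaw G x), ∃ n : ℕ, 1 ≤ n ∧ w n = x) :
    1 ≤ hitWeight (fun a b => stepPMF G a b) x x := by
  classical
  have h2 : ∀ᵐ w ∂(srwLaw G x), w 0 = x := srwLaw_zero x
  -- `C t` is the event that the first return to `x` happens along `t`; these events match the
  -- summands of `hitWeight` and, by recurrence, cover almost every trajectory.
  let C : List V → Set (ℕ → V) := fun t => if x ∈ t then ∅ else
    {w | (List.range ((t ++ [x]).length + 1)).map w = x :: (t ++ [x])}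
  have h3 : ∀ᵐ w ∂(srwLaw G x), w ∈ ⋃ t, C t := by
    filter_upwards [h, h2] with w hw h0
    obtain ⟨hn, hx⟩ := Nat.find_spec hw
    set n := Nat.find hw with hn'
    obtain ⟨m, hm⟩ : ∃ m, n = m + 1 := ⟨n - 1, by omega⟩
    refine Set.mem_iUnion.2 ⟨(List.range m).map fun i => w (i + 1), ?_⟩
    have hnot : x ∉ (List.range m).map fun i => w (i + 1) := by
      intro hmem
      obtain ⟨i, hi, hi'⟩ := List.mem_map.1 hmem
      exact Nat.find_min hw (m := i + 1) (by rw [List.mem_range] at hi; omega) ⟨by omega, hi'⟩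
    simp only [C, if_neg hnot, Set.mem_ofPred_eq, List.length_append, List.length_map,
      List.length_range, List.length_singleton]
    rw [List.range_succ_eq_map, List.range_succ]
    simp [h0, ← hx, hm, Function.comp_def]
  calc (1 : ℝ≥0∞) = srwLaw G x Set.univ := measure_univ.symm
    _ ≤ srwLaw G x (⋃ t, C t) := measure_mono_ae (by filter_upwards [h3] with w hw _ using hw)
    _ ≤ ∑' t, srwLaw G x (C t) := measure_iUnion_le _
    _ ≤ _ := ?_
  · rw [hitWeight]
    refine ENNReal.tsum_le_tsum fun t => ?_
    by_cases ht : x ∈ t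
    · simp [C, ht]
    · simpa only [C, ht, if_false] using srwLaw_cylinder_le x x (t ++ [x])

end Recurrent

/-! ### Percolation on recurrent graphs. -/

section RecurrentGraphs

variable {V : Type*} {G : SimpleGraph V} [G.LocallyFinite]

/-- Excludes the default branch of `stepPMF` at isolated vertices, so that positive transition
weight means adjacency. -/
lemma neighborFinset_nonempty_of_connected (hG : G.Connected) {x y : V} (hxy : G.Adj x y) (v : V) :
    (G.neighborFinset v).Nonempty := by
  obtain ⟨w, hw⟩ : ∃ w, v ≠ w := by
    by_cases h : v = x
    · exact ⟨y, h ▸ hxy.ne⟩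
    · exact ⟨x, h⟩
  obtain ⟨p⟩ := hG v w
  cases p with
  | nil => exact absurd rfl hw
  | cons h _ => exact ⟨_, (G.mem_neighborFinset _ _).2 h⟩

/-- On a connected recurrent graph, without killing, almost surely all the vertices are in the
same open cluster. -/
theorem ae_forall_mem_openCluster_of_isRecurrent (hG : G.Connected) (hrec : IsRecurrent G)
    {α : ℝ≥0} (hα : 0 < α) :
    ∀ᵐ N ∂(loopEnsemble G α 0), ∀ x y : V, y ∈ openCluster G N x := by
  have : Countable V := countable_of_connected hG
  let _ : MeasurableSpace V := ⊤
  have : DiscreteMeasurableSpace V := ⟨fun _ => MeasurableSpace.measurableSet_top⟩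
  refine ae_forall_mem_openCluster hG (by norm_num) hα fun x y hxy => ?_
  refine loopMeasure_traverses_eq_top (by norm_num)
    (neighborFinset_nonempty_of_connected hG hxy) hxy ?_
  have h1 : killedStep G 0 = fun a b => stepPMF G a b := by
    funext a b
    simp [killedStep]
  rw [h1]
  exact one_le_hitWeight (hrec x)

end RecurrentGraphs

/-! ### The walk on `ℤ^d`, and percolation under negative killing. -/

section Lattice

variable {d : ℕ}

/-- The `2d` unit vectors of `ℤ^d`. -/
def unitVec (p : Fin d × Bool) : Fin d → ℤ := Pi.single p.1 (if p.2 then 1 else -1)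

lemma unitVec_injective : Function.Injective (unitVec (d := d)) := by
  rintro ⟨i, b⟩ ⟨j, c⟩ h
  have hne : ∀ b : Bool, (if b then 1 else -1 : ℤ) ≠ 0 := by decide
  have hij : i = j := by
    by_contra hij
    have := congrFun h i
    simp only [unitVec, Pi.single_eq_same, Pi.single_eq_of_ne hij] at this
    exact hne b this
  subst hij
  have := congrFun h i
  simp only [unitVec, Pi.single_eq_same] at this
  rw [Prod.mk.injEq]
  refine ⟨rfl, ?_⟩
  cases b <;> cases c <;> simp_all

lemma latticeGraph_adj_iff {x y : Fin d → ℤ} :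
    (latticeGraph d).Adj x y ↔ ∃ p, y = x + unitVec p := by
  constructor
  · intro h
    have h : ∑ i, |x i - y i| = 1 := h
    obtain ⟨i, hi⟩ : ∃ i, |x i - y i| ≠ 0 := by
      by_contra! h0
      simp [h0] at h
    have hi1 : 1 ≤ |x i - y i| := by
      have := abs_nonneg (x i - y i)
      omega
    have hsum := Finset.add_sum_erase Finset.univ (fun i => |x i - y i|) (Finset.mem_univ i)
    have hnn : 0 ≤ ∑ j ∈ Finset.univ.erase i, |x j - y j| :=
      Finset.sum_nonneg fun _ _ => abs_nonneg _
    simp only [h] at hsum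
    have h0 : ∑ j ∈ Finset.univ.erase i, |x j - y j| = 0 := by omega
    have h00 : ∀ j, j ≠ i → x j = y j := by
      intro j hj
      have := (Finset.sum_eq_zero_iff_of_nonneg fun _ _ => abs_nonneg _).1 h0 j
        (Finset.mem_erase.2 ⟨hj, Finset.mem_univ j⟩)
      rw [abs_eq_zero] at this
      omega
    have h2 : x i - y i = 1 ∨ x i - y i = -1 := by
      rcases abs_choice (x i - y i) with h | h <;> omega
    rcases h2 with h2 | h2
    · refine ⟨(i, false), funext fun j => ?_⟩
      by_cases hj : j = i
      · subst hj; simp [unitVec]; omega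
      · simp [unitVec, hj, h00 j hj]
    · refine ⟨(i, true), funext fun j => ?_⟩
      by_cases hj : j = i
      · subst hj; simp [unitVec]; omega
      · simp [unitVec, hj, h00 j hj]
  · rintro ⟨⟨i, b⟩, rfl⟩
    change ∑ j, |x j - (x + unitVec (i, b)) j| = 1
    rw [Finset.sum_eq_single i]
    · cases b <;> simp [unitVec]
    · intro j _ hj
      simp [unitVec, hj]
    · simp

lemma neighborFinset_latticeGraph (x : Fin d → ℤ) :
    (latticeGraph d).neighborFinset x =
      Finset.univ.map ⟨fun p => x + unitVec p, (add_right_injective x).comp unitVec_injective⟩ := by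
  ext y
  simp [latticeGraph_adj_iff, eq_comm]

lemma neighborFinset_latticeGraph_nonempty (hd : 0 < d) (x : Fin d → ℤ) :
    ((latticeGraph d).neighborFinset x).Nonempty := by
  rw [neighborFinset_latticeGraph, Finset.map_nonempty]
  exact ⟨(⟨0, hd⟩, true), Finset.mem_univ _⟩

/-- The transition matrix of the simple random walk on `ℤ^d`. -/
def latticeStep (d : ℕ) (x y : Fin d → ℤ) : ℝ≥0∞ := stepPMF (latticeGraph d) x y

open Classical in
lemma latticeStep_eq (hd : 0 < d) (x y : Fin d → ℤ) :
    latticeStep d x y = if (latticeGraph d).Adj x y then ((2 * d : ℕ) : ℝ≥0∞)⁻¹ else 0 := by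
  rw [latticeStep, stepPMF, dif_pos (neighborFinset_latticeGraph_nonempty hd x),
    PMF.uniformOfFinset_apply]
  simp only [SimpleGraph.mem_neighborFinset]
  rw [neighborFinset_latticeGraph, Finset.card_map, Finset.card_univ, Fintype.card_prod,
    Fintype.card_fin, Fintype.card_bool, mul_comm d]

lemma latticeStep_comm (hd : 0 < d) (x y : Fin d → ℤ) : latticeStep d x y = latticeStep d y x := by
  classical
  rw [latticeStep_eq hd, latticeStep_eq hd]
  exact if_congr (SimpleGraph.adj_comm _ _ _) rfl rfl

lemma tsum_latticeStep (x : Fin d → ℤ) : ∑' y, latticeStep d x y = 1 :=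
  (stepPMF (latticeGraph d) x).tsum_coe

lemma tsum_latticeStep_mul (hd : 0 < d) (x : Fin d → ℤ) (f : (Fin d → ℤ) → ℝ≥0∞) :
    ∑' y, latticeStep d x y * f y = ((2 * d : ℕ) : ℝ≥0∞)⁻¹ * ∑ p, f (x + unitVec p) := by
  classical
  have h : ∀ y, y ∉ (latticeGraph d).neighborFinset x → latticeStep d x y * f y = 0 := by
    intro y hy
    rw [latticeStep_eq hd, if_neg (by simpa using hy), zero_mul]
  rw [tsum_eq_sum (fun y hy => h y hy), neighborFinset_latticeGraph, Finset.sum_map, Finset.mul_sum]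
  refine Finset.sum_congr rfl fun p _ => ?_
  simp only [Function.Embedding.coeFn_mk]
  rw [latticeStep_eq hd, if_pos (latticeGraph_adj_iff.2 ⟨p, rfl⟩)]

lemma abs_unitVec_le (p : Fin d × Bool) (i : Fin d) : |unitVec p i| ≤ 1 := by
  rcases p with ⟨j, b⟩
  by_cases h : i = j
  · subst h; cases b <;> simp [unitVec]
  · simp [unitVec, h]

lemma heat_eq_zero (hd : 0 < d) (n : ℕ) {x y : Fin d → ℤ} (h : y ∉ Finset.Icc (x - n) (x + n)) :
    heat (latticeStep d) n x y = 0 := by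
  induction n generalizing x with
  | zero =>
    rw [heat_zero, if_neg]
    rintro rfl
    simp at h
  | succ n ih =>
    rw [heat_succ, tsum_latticeStep_mul hd, Finset.sum_eq_zero, mul_zero]
    intro p _
    refine ih fun hy => h ?_
    rw [Finset.mem_Icc] at hy ⊢
    refine ⟨fun i => ?_, fun i => ?_⟩
    · have := hy.1 i
      have h2 := abs_le.1 (abs_unitVec_le p i)
      simp only [Pi.sub_apply, Pi.add_apply, Pi.natCast_apply] at this ⊢
      push_cast
      omega
    · have := hy.2 i
      have h2 := abs_le.1 (abs_unitVec_le p i)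
      simp only [Pi.add_apply, Pi.natCast_apply] at this ⊢
      push_cast
      omega

lemma heat_le_one (n : ℕ) (x y : Fin d → ℤ) : heat (latticeStep d) n x y ≤ 1 := by
  rw [← tsum_heat (tsum_latticeStep (d := d)) n x]
  exact ENNReal.le_tsum y

/-- Polynomial lower bound on return probabilities. -/
lemma le_heat_two_mul (hd : 0 < d) (n : ℕ) (x : Fin d → ℤ) :
    (((2 * n + 1) ^ d : ℕ) : ℝ≥0∞)⁻¹ ≤ heat (latticeStep d) (n + n) x x := by
  set B := Finset.Icc (x - n) (x + n) with hB
  have hcard : B.card = (2 * n + 1) ^ d := by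
    rw [hB, Pi.card_Icc]
    have : ∀ i : Fin d, (Finset.Icc ((x - (n : Fin d → ℤ)) i) ((x + (n : Fin d → ℤ)) i)).card =
        2 * n + 1 := by
      intro i
      simp only [Int.card_Icc, Pi.add_apply, Pi.sub_apply, Pi.natCast_apply]
      omega
    rw [Finset.prod_congr rfl fun i _ => this i, Finset.prod_const, Finset.card_univ,
      Fintype.card_fin]
  have hsum : ∑ y ∈ B, heat (latticeStep d) n x y = 1 := by
    rw [← tsum_heat (tsum_latticeStep (d := d)) n x, tsum_eq_sum fun y hy => heat_eq_zero hd n hy]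
  have hfin : ∀ y, heat (latticeStep d) n x y ≠ ∞ := fun y =>
    ((heat_le_one n x y).trans_lt ENNReal.one_lt_top).ne
  have hsum' : ∑ y ∈ B, (heat (latticeStep d) n x y).toReal = 1 := by
    rw [← ENNReal.toReal_sum fun y _ => hfin y, hsum, ENNReal.toReal_one]
  -- By symmetry the return probability at time `2n` is the sum of the squares of the time-`n`
  -- probabilities. These total one on a box of `(2n+1)^d` points, so Cauchy–Schwarz applies.
  have hcs := sq_sum_le_card_mul_sum_sq (s := B)
    (f := fun y => (heat (latticeStep d) n x y).toReal)
  rw [hsum', one_pow, hcard] at hcs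
  rw [heat_add]
  simp_rw [heat_comm (latticeStep_comm hd) n _ x]
  refine le_trans ?_ (ENNReal.sum_le_tsum B)
  have h1 : ∑ y ∈ B, heat (latticeStep d) n x y * heat (latticeStep d) n x y =
      ENNReal.ofReal (∑ y ∈ B, (heat (latticeStep d) n x y).toReal ^ 2) := by
    rw [ENNReal.ofReal_sum_of_nonneg fun _ _ => sq_nonneg _]
    refine Finset.sum_congr rfl fun y _ => ?_
    rw [sq, ENNReal.ofReal_mul ENNReal.toReal_nonneg, ENNReal.ofReal_toReal (hfin y)]
  have hpos : (0 : ℝ) < ((2 * n + 1) ^ d : ℕ) := by positivity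
  rw [h1, ← ENNReal.ofReal_natCast, ← ENNReal.ofReal_inv_of_pos hpos]
  refine ENNReal.ofReal_le_ofReal ?_
  rw [inv_le_iff_one_le_mul₀ hpos, mul_comm]
  exact hcs

/-- If `F < 1`, the Green function is the convergent geometric sum `F / (1 - F)`. But its terms at
even times are at least `(1 + κ)⁻²ⁿ / (2n+1)^d`, which does not tend to zero. -/
lemma one_le_hitWeight_of_neg (hd : 0 < d) {κ : ℝ} (hκ : -1 < κ) (hκ0 : κ < 0) (x : Fin d → ℤ) :
    1 ≤ hitWeight (killedStep (latticeGraph d) κ) x x := by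
  by_contra! hF
  set r : ℝ := 1 / (1 + κ) with hr
  have hr1 : 1 < r := by
    rw [hr, lt_div_iff₀ (by linarith)]; linarith
  have hfin : ∑' t : List (Fin d → ℤ), pathWeight (killedStep (latticeGraph d) κ) x (t ++ [x]) ≠ ∞ := by
    rw [tsum_pathWeight_eq, ENNReal.tsum_mul_left, ENNReal.tsum_geometric]
    exact ENNReal.mul_ne_top hF.ne_top (ENNReal.inv_ne_top.2 (tsub_pos_of_lt hF).ne')
  rw [tsum_pathWeight_closed] at hfin
  have hterm : ∀ n, heat (killedStep (latticeGraph d) κ) n x x =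
      ENNReal.ofReal r ^ n * heat (latticeStep d) n x x := fun n => pathSum_smul _ _ _ _
  have hbound : ∀ n : ℕ, ENNReal.ofReal (r ^ (2 * n) / (2 * n + 1) ^ d) ≤
      heat (killedStep (latticeGraph d) κ) (n + n) x x := by
    intro n
    rw [hterm, div_eq_mul_inv, ENNReal.ofReal_mul (by positivity), two_mul,
      ENNReal.ofReal_pow (by positivity), ENNReal.ofReal_inv_of_pos (by positivity)]
    refine mul_le_mul' le_rfl ?_
    refine le_trans (le_of_eq ?_) (le_heat_two_mul hd n x)
    rw [← ENNReal.ofReal_natCast]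
    push_cast
    rfl
  have htend : Filter.Tendsto (fun n : ℕ => heat (killedStep (latticeGraph d) κ) (n + 1) x x)
      Filter.atTop (nhds 0) := ENNReal.tendsto_atTop_zero_of_tsum_ne_top hfin
  have h1 : ∀ᶠ n : ℕ in Filter.atTop, heat (killedStep (latticeGraph d) κ) (n + 1) x x < 1 :=
    htend.eventually (gt_mem_nhds one_pos)
  have h2 : ∀ᶠ n : ℕ in Filter.atTop, (n : ℝ) ^ d / r ^ n < r⁻¹ :=
    (tendsto_pow_const_div_const_pow_of_one_lt d hr1).eventually (gt_mem_nhds (by positivity))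
  obtain ⟨K, hK⟩ := Filter.eventually_atTop.1 (h1.and h2)
  -- At time `2K + 2` the two facts read `r ^ (2K+2) < (2K+3) ^ d` and `(2K+3) ^ d < r ^ (2K+2)`;
  -- evaluating the second limit at exponent `2K + 3` is what the margin `r⁻¹` compensates.
  have h3 := (hbound (K + 1)).trans_lt
    (show K + 1 + (K + 1) = (2 * K + 1) + 1 by ring ▸ (hK (2 * K + 1) (by omega)).1)
  have h4 := (hK (2 * (K + 1) + 1) (by omega)).2
  rw [ENNReal.ofReal_lt_one, div_lt_one (by positivity)] at h3
  rw [div_lt_iff₀ (by positivity), pow_succ, mul_comm (r ^ _) r, ← mul_assoc,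
    inv_mul_cancel₀ (by positivity), one_mul] at h4
  push_cast at h3 h4
  linarith

/-- With negative killing, almost surely all the vertices of `ℤ^d` are in the same open cluster. -/
lemma percolationProb_of_neg (hd : 0 < d) (hconn : (latticeGraph d).Connected) {κ : ℝ}
    (hκ : -1 < κ) (hκ0 : κ < 0) {α : ℝ≥0} (hα : 0 < α) (o : Fin d → ℤ) :
    percolationProb (latticeGraph d) o α κ = 1 := by
  have h := ae_forall_mem_openCluster hconn hκ hα fun x y hxy =>
    loopMeasure_traverses_eq_top hκ (neighborFinset_latticeGraph_nonempty hd) hxy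
      (one_le_hitWeight_of_neg hd hκ hκ0 x)
  have : Nonempty (Fin d) := ⟨⟨0, hd⟩⟩
  refine le_antisymm prob_le_one ?_
  rw [percolationProb, ← measure_univ (μ := loopEnsemble (latticeGraph d) α κ)]
  refine measure_mono_ae ?_
  filter_upwards [h] with N hN _
  have : openCluster (latticeGraph d) N o = Set.univ := Set.eq_univ_of_forall (hN o)
  change (openCluster (latticeGraph d) N o).Infinite
  rw [this]
  exact Set.infinite_univ

lemma latticeGraph_connected : (latticeGraph d).Connected := by
  have h1 : ∀ (x : Fin d → ℤ) (i : Fin d) (n : ℕ),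
      (latticeGraph d).Reachable x (x + Pi.single i (n : ℤ)) := by
    intro x i n
    induction n with
    | zero => simp
    | succ n ih =>
      refine ih.trans (SimpleGraph.Adj.reachable (latticeGraph_adj_iff.2 ⟨(i, true), ?_⟩))
      simp [unitVec, add_assoc, ← Pi.single_add]
  have h2 : ∀ (x : Fin d → ℤ) (i : Fin d) (n : ℤ),
      (latticeGraph d).Reachable x (x + Pi.single i n) := by
    intro x i n
    obtain ⟨m, rfl | rfl⟩ := n.eq_nat_or_neg
    · exact h1 x i m
    · have := (h1 (x + Pi.single i (-(m : ℤ))) i m).symm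
      simpa [add_assoc, ← Pi.single_add] using this
  have h3 : ∀ (x v : Fin d → ℤ) (s : Finset (Fin d)),
      (latticeGraph d).Reachable x (x + ∑ i ∈ s, Pi.single i (v i)) := by
    intro x v s
    induction s using Finset.induction_on with
    | empty => simp
    | insert i s hi ih =>
      rw [Finset.sum_insert hi, add_comm (Pi.single i _ : Fin d → ℤ), ← add_assoc]
      exact ih.trans (h2 _ _ _)
  refine ⟨fun x y => ?_⟩
  have := h3 x (y - x) Finset.univ
  rwa [Finset.univ_sum_single, add_sub_cancel] at this

end Lattice

/-! ### The heat kernel upper bound by Fourier inversion. -/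

section HeatKernel

variable {d : ℕ}

/-- Bounding by `sin t ^ 2` handles both points where `|cos|` equals one. Both are needed: the walk
is bipartite, so its characteristic function has modulus one at `(π, …, π)` as well as at the
origin. -/
lemma abs_cos_le (t : ℝ) : |Real.cos t| ≤ 1 - Real.sin t ^ 2 / 2 := by
  have h := Real.sin_sq_add_cos_sq t
  refine abs_le_of_sq_le_sq ?_ (by nlinarith [sq_nonneg (Real.cos t)])
  nlinarith [sq_nonneg (Real.sin t ^ 2)]

/-- The characteristic function of a step of the simple random walk. -/
def stepChar (θ : Fin d → ℝ) : ℝ := (d : ℝ)⁻¹ * ∑ i, Real.cos (θ i)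

/-- The inequality `1 + u ≤ exp u` turns the average over coordinates into a product, so that the
torus integral factorizes. -/
lemma abs_stepChar_pow_le (hd : 0 < d) (n : ℕ) (θ : Fin d → ℝ) :
    |stepChar θ| ^ n ≤ ∏ i, Real.exp (-(n / (2 * d)) * Real.sin (θ i) ^ 2) := by
  have hd' : (0 : ℝ) < d := by exact_mod_cast hd
  have h1 : |stepChar θ| ≤ Real.exp (∑ i, -(1 / (2 * d)) * Real.sin (θ i) ^ 2) := by
    rw [stepChar, abs_mul, abs_of_pos (inv_pos.2 hd')]
    calc (d : ℝ)⁻¹ * |∑ i, Real.cos (θ i)|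
        ≤ (d : ℝ)⁻¹ * ∑ i, (1 - Real.sin (θ i) ^ 2 / 2) := by
          gcongr
          exact (Finset.abs_sum_le_sum_abs _ _).trans (Finset.sum_le_sum fun i _ => abs_cos_le _)
      _ = (∑ i, -(1 / (2 * d)) * Real.sin (θ i) ^ 2) + 1 := by
          rw [Finset.sum_sub_distrib, ← Finset.mul_sum, ← Finset.sum_div]
          simp only [Finset.sum_const, Finset.card_univ, Fintype.card_fin, nsmul_eq_mul, mul_one]
          field_simp
          ring
      _ ≤ _ := Real.add_one_le_exp _
  refine (pow_le_pow_left₀ (abs_nonneg _) h1 n).trans_eq ?_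
  rw [← Real.exp_nat_mul, ← Real.exp_sum, Finset.mul_sum]
  congr 1
  refine Finset.sum_congr rfl fun i _ => ?_
  ring

/-- By `π`-periodicity the integral is twice the one over `(-π/2, π/2)`, where `|sin t| ≥ 2|t|/π`
gives a Gaussian majorant. -/
lemma integral_exp_sin_sq_le {b : ℝ} (hb : 0 < b) :
    ∫ t in (-Real.pi)..Real.pi, Real.exp (-b * Real.sin t ^ 2) ≤
      2 * √(Real.pi ^ 3 / (4 * b)) := by
  have hπ := Real.pi_pos
  set f : ℝ → ℝ := fun t => Real.exp (-b * Real.sin t ^ 2) with hf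
  have hcont : Continuous f := by fun_prop
  have hper : Function.Periodic f Real.pi := by
    intro t
    simp [hf, Real.sin_add_pi]
  have hI : ∀ a c : ℝ, IntervalIntegrable f volume a c := fun a c => hcont.intervalIntegrable a c
  have e1 : ∫ t in (-Real.pi)..0, f t = ∫ t in (-(Real.pi / 2))..(Real.pi / 2), f t := by
    have := hper.intervalIntegral_add_eq (-Real.pi) (-(Real.pi / 2))
    rw [neg_add_cancel] at this
    rw [this]; congr 1; ring
  have e2 : ∫ t in (0)..Real.pi, f t = ∫ t in (-(Real.pi / 2))..(Real.pi / 2), f t := by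
    have := hper.intervalIntegral_add_eq 0 (-(Real.pi / 2))
    rw [zero_add] at this
    rw [this]; congr 1; ring
  rw [← intervalIntegral.integral_add_adjacent_intervals (hI (-Real.pi) 0) (hI 0 Real.pi), e1, e2,
    ← two_mul]
  have hb' : 0 < b * (4 / Real.pi ^ 2) := by positivity
  have hg := integrable_exp_neg_mul_sq hb'
  have key : ∫ t in (-(Real.pi / 2))..(Real.pi / 2), f t ≤ √(Real.pi ^ 3 / (4 * b)) := by
    calc ∫ t in (-(Real.pi / 2))..(Real.pi / 2), f t
        ≤ ∫ t in (-(Real.pi / 2))..(Real.pi / 2), Real.exp (-(b * (4 / Real.pi ^ 2)) * t ^ 2) := by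
          refine intervalIntegral.integral_mono_on (by linarith) (hI _ _)
            hg.intervalIntegrable fun t ht => ?_
          refine Real.exp_le_exp.2 ?_
          have h1 : (2 / Real.pi * |t|) ^ 2 ≤ Real.sin t ^ 2 := by
            rw [← sq_abs (Real.sin t)]
            refine pow_le_pow_left₀ (by positivity) ?_ 2
            exact Real.mul_abs_le_abs_sin (abs_le.2 ht)
          rw [mul_pow, sq_abs, div_pow] at h1
          nlinarith
      _ ≤ ∫ t, Real.exp (-(b * (4 / Real.pi ^ 2)) * t ^ 2) := by
          rw [intervalIntegral.integral_of_le (by linarith)]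
          exact setIntegral_le_integral hg (ae_of_all _ fun t => (Real.exp_pos _).le)
      _ = _ := by
          rw [integral_gaussian]
          congr 1
          field_simp
  linarith

/-- Lebesgue measure on the torus `(-π, π]^d`. -/
def torusMeasure (d : ℕ) : Measure (Fin d → ℝ) :=
  Measure.pi fun _ => volume.restrict (Set.Ioc (-Real.pi) Real.pi)

instance : IsFiniteMeasure (torusMeasure d) := by
  unfold torusMeasure; infer_instance

lemma integral_cexp_int (m : ℤ) :
    ∫ t in Set.Ioc (-Real.pi) Real.pi, Complex.exp ((m : ℂ) * t * Complex.I) =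
      if m = 0 then (2 * Real.pi : ℂ) else 0 := by
  have hπ := Real.pi_pos
  rw [← intervalIntegral.integral_of_le (by linarith)]
  split_ifs with h
  · subst h
    simp
    ring
  · have hc : (m : ℂ) * Complex.I ≠ 0 := by simp [h]
    have e : ∀ t : ℝ, Complex.exp ((m : ℂ) * t * Complex.I) =
        Complex.exp ((m : ℂ) * Complex.I * t) := fun t => by ring_nf
    simp_rw [e]
    rw [integral_exp_mul_complex hc]
    have : Complex.exp ((m : ℂ) * Complex.I * (Real.pi : ℝ)) =
        Complex.exp ((m : ℂ) * Complex.I * ((-Real.pi : ℝ) : ℝ)) := by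
      rw [Complex.exp_eq_exp_iff_exists_int]
      exact ⟨m, by push_cast; ring⟩
    rw [this, sub_self, zero_div]

lemma integral_cos_torus (z : Fin d → ℤ) :
    ∫ θ, Real.cos (∑ i, θ i * z i) ∂(torusMeasure d) =
      if z = 0 then (2 * Real.pi) ^ d else 0 := by
  have h1 : ∫ θ, Complex.exp ((∑ i, θ i * z i : ℝ) * Complex.I) ∂(torusMeasure d) =
      if z = 0 then ((2 * Real.pi) ^ d : ℂ) else 0 := by
    have : ∀ θ : Fin d → ℝ, Complex.exp ((∑ i, θ i * z i : ℝ) * Complex.I) =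
        ∏ i, Complex.exp ((z i : ℂ) * θ i * Complex.I) := by
      intro θ
      rw [← Complex.exp_sum]
      congr 1
      push_cast
      rw [Finset.sum_mul]
      refine Finset.sum_congr rfl fun i _ => by ring
    simp_rw [this]
    rw [torusMeasure, integral_fintype_prod_eq_prod (𝕜 := ℂ)
      (f := fun i (t : ℝ) => Complex.exp ((z i : ℂ) * t * Complex.I))]
    simp_rw [integral_cexp_int]
    split_ifs with h
    · subst h; simp
    · obtain ⟨i, hi⟩ := Function.ne_iff.1 h
      exact Finset.prod_eq_zero (Finset.mem_univ i) (if_neg hi)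
  have h2 : ∀ θ : Fin d → ℝ, Real.cos (∑ i, θ i * z i) =
      RCLike.re (Complex.exp ((∑ i, θ i * z i : ℝ) * Complex.I)) := by
    intro θ
    exact (Complex.exp_ofReal_mul_I_re _).symm
  simp_rw [h2]
  rw [integral_re, h1]
  · split_ifs
    · rw [← Complex.ofReal_ofNat, ← Complex.ofReal_mul, ← Complex.ofReal_pow]; rfl
    · simp
  · refine Integrable.of_bound (Continuous.aestronglyMeasurable (by fun_prop)) 1 (ae_of_all _ fun θ => ?_)
    rw [Complex.norm_exp_ofReal_mul_I]

lemma continuous_stepChar : Continuous (stepChar (d := d)) := by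
  unfold stepChar; fun_prop

lemma heat_ne_top (n : ℕ) (x y : Fin d → ℤ) : heat (latticeStep d) n x y ≠ ∞ :=
  ((heat_le_one n x y).trans_lt ENNReal.one_lt_top).ne

lemma abs_stepChar_le_one (hd : 0 < d) (θ : Fin d → ℝ) : |stepChar θ| ≤ 1 := by
  have := abs_stepChar_pow_le hd 1 θ
  rw [pow_one] at this
  refine this.trans (Finset.prod_le_one (fun _ _ => (Real.exp_pos _).le) fun i _ => ?_)
  rw [Real.exp_le_one_iff]
  have : 0 ≤ ((1 : ℕ) : ℝ) / (2 * d) * Real.sin (θ i) ^ 2 := by positivity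
  linarith

lemma integrable_stepChar_mul (hd : 0 < d) (n : ℕ) (g : (Fin d → ℝ) → ℝ) (hg : Continuous g)
    (hg1 : ∀ θ, |g θ| ≤ 1) : Integrable (fun θ => stepChar θ ^ n * g θ) (torusMeasure d) := by
  refine Integrable.of_bound
    ((continuous_stepChar.pow n).mul hg).aestronglyMeasurable 1 (ae_of_all _ fun θ => ?_)
  rw [norm_mul, norm_pow, Real.norm_eq_abs, Real.norm_eq_abs]
  exact mul_le_one₀ (pow_le_one₀ (abs_nonneg _) (abs_stepChar_le_one hd θ)) (abs_nonneg _) (hg1 θ)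

lemma sum_cos_unitVec (hd : 0 < d) (θ : Fin d → ℝ) (z : Fin d → ℤ) :
    ∑ p, Real.cos (∑ i, θ i * ((z + unitVec p : Fin d → ℤ) i : ℝ)) =
      2 * d * stepChar θ * Real.cos (∑ i, θ i * z i) := by
  have hd' : (d : ℝ) ≠ 0 := by exact_mod_cast hd.ne'
  have h : ∀ (i : Fin d) (b : Bool), ∑ j, θ j * ((z + unitVec (i, b) : Fin d → ℤ) j : ℝ) =
      ∑ j, θ j * z j + (if b then 1 else -1) * θ i := by
    intro i b
    simp only [Pi.add_apply, Int.cast_add, mul_add, Finset.sum_add_distrib]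
    congr 1
    rw [Finset.sum_eq_single i]
    · cases b <;> simp [unitVec]
    · intro j _ hj
      simp [unitVec, hj]
    · simp
  rw [Fintype.sum_prod_type]
  simp only [h, Fintype.sum_bool, if_true, Bool.false_eq_true, if_false, Real.cos_add, one_mul,
    neg_mul, Real.cos_neg, Real.sin_neg, stepChar]
  have : (2 * d * ((d : ℝ)⁻¹ * ∑ i, Real.cos (θ i)) * Real.cos (∑ i, θ i * z i)) =
      ∑ i, 2 * Real.cos (θ i) * Real.cos (∑ i, θ i * z i) := by
    rw [← Finset.sum_mul, ← Finset.mul_sum]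
    field_simp
  rw [this]
  refine Finset.sum_congr rfl fun i _ => by ring

/-- Fourier inversion for the transition probabilities. -/
lemma heat_fourier (hd : 0 < d) (n : ℕ) (x y : Fin d → ℤ) :
    (heat (latticeStep d) n x y).toReal * (2 * Real.pi) ^ d =
      ∫ θ, stepChar θ ^ n * Real.cos (∑ i, θ i * ((x - y : Fin d → ℤ) i : ℝ)) ∂(torusMeasure d) := by
  induction n generalizing x with
  | zero =>
    simp only [pow_zero, one_mul]
    rw [integral_cos_torus, heat_zero]
    simp only [sub_eq_zero]
    split_ifs <;> simp
  | succ n ih =>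
    have hd' : (d : ℝ) ≠ 0 := by exact_mod_cast hd.ne'
    rw [heat_succ, tsum_latticeStep_mul hd, ENNReal.toReal_mul,
      ENNReal.toReal_sum fun p _ => heat_ne_top _ _ _, mul_assoc, Finset.sum_mul]
    simp_rw [ih]
    rw [← integral_finsetSum _ fun p _ => integrable_stepChar_mul hd n _ (by fun_prop)
      fun θ => Real.abs_cos_le_one _, ← integral_const_mul]
    congr 1
    funext θ
    have hz : ∀ p, x + unitVec p - y = (x - y) + unitVec p := fun p => by abel
    simp_rw [hz]
    rw [← Finset.mul_sum, sum_cos_unitVec hd]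
    simp only [ENNReal.toReal_inv, ENNReal.toReal_natCast]
    push_cast
    field_simp
    ring

/-- The on-diagonal upper bound for the transition probabilities of the simple random walk. -/
lemma exists_heat_le (hd : 0 < d) : ∃ C : ℝ, 0 < C ∧ ∀ n : ℕ, 1 ≤ n → ∀ x y : Fin d → ℤ,
    heat (latticeStep d) n x y ≤ ENNReal.ofReal ((C / √n) ^ d) := by
  have hπ := Real.pi_pos
  have hd' : (0 : ℝ) < d := by exact_mod_cast hd
  refine ⟨√(Real.pi ^ 3 * d / 2), by positivity, fun n hn x y => ?_⟩
  have hn' : (0 : ℝ) < n := by exact_mod_cast hn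
  have hb : (0 : ℝ) < n / (2 * d) := by positivity
  have h1 : (heat (latticeStep d) n x y).toReal * (2 * Real.pi) ^ d ≤
      (2 * √(Real.pi ^ 3 / (4 * (n / (2 * d))))) ^ d := by
    rw [heat_fourier hd]
    calc ∫ θ, stepChar θ ^ n * Real.cos (∑ i, θ i * ((x - y : Fin d → ℤ) i : ℝ)) ∂(torusMeasure d)
        ≤ ∫ θ : Fin d → ℝ, ∏ i, Real.exp (-(n / (2 * d)) * Real.sin (θ i) ^ 2)
            ∂(torusMeasure d) := by
          refine integral_mono (integrable_stepChar_mul hd n _ (by fun_prop)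
            fun θ => Real.abs_cos_le_one _) ?_ fun θ => ?_
          · refine Integrable.of_bound (Continuous.aestronglyMeasurable (by fun_prop)) 1 (ae_of_all _ fun θ => ?_)
            rw [Real.norm_eq_abs, abs_of_nonneg (Finset.prod_nonneg fun _ _ => (Real.exp_pos _).le)]
            refine Finset.prod_le_one (fun _ _ => (Real.exp_pos _).le) fun i _ => ?_
            rw [Real.exp_le_one_iff]
            have : 0 ≤ (n : ℝ) / (2 * d) * Real.sin (θ i) ^ 2 := by positivity
            linarith
          · refine (le_abs_self _).trans ?_
            rw [abs_mul, abs_pow]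
            exact (mul_le_of_le_one_right (by positivity) (Real.abs_cos_le_one _)).trans
              (abs_stepChar_pow_le hd n θ)
      _ = (∫ t in (-Real.pi)..Real.pi, Real.exp (-(n / (2 * d)) * Real.sin t ^ 2)) ^ d := by
          rw [torusMeasure, integral_fintype_prod_eq_prod (𝕜 := ℝ)
            (f := fun _ (t : ℝ) => Real.exp (-(n / (2 * d)) * Real.sin t ^ 2)), Finset.prod_const,
            Finset.card_univ, Fintype.card_fin, intervalIntegral.integral_of_le (by linarith)]
      _ ≤ _ := by
          refine pow_le_pow_left₀ ?_ (integral_exp_sin_sq_le hb) d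
          exact intervalIntegral.integral_nonneg (by linarith) fun t _ => (Real.exp_pos _).le
  rw [← ENNReal.ofReal_toReal (heat_ne_top n x y)]
  refine ENNReal.ofReal_le_ofReal ?_
  have h2 : 2 * √(Real.pi ^ 3 / (4 * (n / (2 * d)))) = 2 * (√(Real.pi ^ 3 * d / 2) / √n) := by
    rw [← Real.sqrt_div' _ hn'.le]
    congr 2
    field_simp
    norm_num
  rw [h2, mul_pow, mul_pow] at h1
  have hp : 1 ≤ Real.pi ^ d := one_le_pow₀ (by linarith [Real.pi_gt_three])
  have h0 : 0 ≤ (heat (latticeStep d) n x y).toReal := ENNReal.toReal_nonneg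
  have h2d : (0 : ℝ) < 2 ^ d := by positivity
  have h3 : (heat (latticeStep d) n x y).toReal * Real.pi ^ d ≤ (√(Real.pi ^ 3 * d / 2) / √n) ^ d := by
    refine le_of_mul_le_mul_left ?_ h2d
    linarith
  exact (le_mul_of_one_le_right h0 hp).trans h3

end HeatKernel

/-! ### Hitting probabilities for symmetric chains, and halving of closed paths. -/

section PathProb

variable {V : Type*} {q : V → V → ℝ≥0∞}

/-- The probability that the path of the first `n` steps of the chain started at `v` is in `E`. -/
def pathProb (q : V → V → ℝ≥0∞) (n : ℕ) (v : V) (E : Set (List V)) : ℝ≥0∞ :=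
  pathSum q n v (fun s => E.indicator 1 (v :: s))

lemma indicator_one_le (E : Set (List V)) (l : List V) : E.indicator (1 : List V → ℝ≥0∞) l ≤ 1 :=
  Set.indicator_le_self' (by simp) l

lemma pathProb_mono (n : ℕ) (v : V) {E F : Set (List V)} (h : E ⊆ F) :
    pathProb q n v E ≤ pathProb q n v F :=
  pathSum_mono n v fun _ => Set.indicator_le_indicator_of_subset h (by simp) _

lemma pathProb_le_one (hq : ∀ v, ∑' a, q v a = 1) (n : ℕ) (v : V) (E : Set (List V)) :
    pathProb q n v E ≤ 1 :=
  (pathSum_mono n v fun _ => indicator_one_le E _).trans_eq (pathSum_const hq n v 1)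

lemma pathProb_union_le (n : ℕ) (v : V) (E F : Set (List V)) :
    pathProb q n v (E ∪ F) ≤ pathProb q n v E + pathProb q n v F :=
  pathSum_add_le n v fun s => by
    by_cases h : v :: s ∈ E
    · rw [Set.indicator_of_mem h]
      exact (indicator_one_le _ _).trans le_self_add
    by_cases h' : v :: s ∈ F
    · rw [Set.indicator_of_mem h']
      exact (indicator_one_le _ _).trans le_add_self
    · rw [Set.indicator_of_notMem fun h'' => h''.elim h h']
      exact zero_le

/-- The lists that visit `A`. -/
def visits (A : Set V) : Set (List V) := {l | ∃ w ∈ l, w ∈ A}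

/-- Supermartingale bound: `ρ⁻ⁿ u` decreases on average along the chain and `u ≥ 1` on `A`. The
induction stops at the first visit, where the trivial bound one is available. -/
lemma pathProb_visits_le (hq : ∀ v, ∑' a, q v a = 1) {A : Set V} {u : V → ℝ≥0∞} {ρ : ℝ≥0∞}
    (hρ : 1 ≤ ρ) (hA : ∀ v ∈ A, 1 ≤ u v) (hu : ∀ v, ∑' a, q v a * u a ≤ ρ * u v) (n : ℕ) (v : V) :
    pathProb q n v (visits A) ≤ ρ ^ n * u v := by
  induction n generalizing v with
  | zero =>
    by_cases h : v ∈ A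
    · exact (pathProb_le_one hq 0 v _).trans (by simpa using hA v h)
    · have : [v] ∉ visits A := by simp [visits, h]
      simp [pathProb, pathSum, this]
  | succ n ih =>
    by_cases h : v ∈ A
    · exact (pathProb_le_one hq _ v _).trans
        ((hA v h).trans (le_mul_of_one_le_left' (one_le_pow₀ hρ)))
    · calc pathProb q (n + 1) v (visits A) ≤ ∑' a, q v a * pathProb q n a (visits A) := by
            refine ENNReal.tsum_le_tsum fun a => mul_le_mul' le_rfl (pathSum_mono n a fun s => ?_)
            refine le_of_eq ?_
            beta_reduce
            have : v :: a :: s ∈ visits A ↔ a :: s ∈ visits A := by simp [visits, h]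
            by_cases h' : a :: s ∈ visits A
            · rw [Set.indicator_of_mem h', Set.indicator_of_mem (this.2 h'), Pi.one_apply,
                Pi.one_apply]
            · rw [Set.indicator_of_notMem h', Set.indicator_of_notMem (fun h => h' (this.1 h))]
        _ ≤ ∑' a, q v a * (ρ ^ n * u a) :=
            ENNReal.tsum_le_tsum fun a => mul_le_mul' le_rfl (ih a)
        _ = ρ ^ n * ∑' a, q v a * u a := by
            rw [← ENNReal.tsum_mul_left]
            refine tsum_congr fun a => by ring
        _ ≤ ρ ^ n * (ρ * u v) := mul_le_mul' le_rfl (hu v)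
        _ = ρ ^ (n + 1) * u v := by ring

/-- A visit occurs in the first `a` steps or in the last `b`. By symmetry counting measure is
invariant, so when summed over starting points the second part forgets the first `a` steps. -/
lemma tsum_pathProb_visits_add_le (hq : ∀ v, ∑' a, q v a = 1) (hs : ∀ x y, q x y = q y x)
    (A : Set V) (a b : ℕ) :
    ∑' v, pathProb q (a + b) v (visits A) ≤
      ∑' v, pathProb q a v (visits A) + ∑' v, pathProb q b v (visits A) := by
  have h1 : ∀ v, pathProb q (a + b) v (visits A) ≤ pathProb q a v (visits A) +
      ∑' m, heat q a v m * pathProb q b m (visits A) := by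
    intro v
    rw [← pathSum_getLastD a v fun m => pathProb q b m (visits A), pathProb, pathSum_append]
    refine pathSum_add_le a v fun s => ?_
    by_cases h : v :: s ∈ visits A
    · rw [Set.indicator_of_mem h, Pi.one_apply]
      exact ((pathSum_mono _ _ fun _ => indicator_one_le _ _).trans_eq
        (pathSum_const hq _ _ _)).trans le_self_add
    · rw [Set.indicator_of_notMem h, zero_add]
      refine pathSum_mono _ _ fun t => ?_
      by_cases h' : v :: (s ++ t) ∈ visits A
      · have : s.getLastD v :: t ∈ visits A := by
          obtain ⟨w, hw, hwA⟩ := h'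
          refine ⟨w, ?_, hwA⟩
          rw [← List.cons_append, List.mem_append] at hw
          rcases hw with hw | hw
          · exact absurd ⟨w, hw, hwA⟩ h
          · exact List.mem_cons_of_mem _ hw
        rw [Set.indicator_of_mem this]
        exact indicator_one_le _ _
      · rw [Set.indicator_of_notMem h']
        exact zero_le
  refine (ENNReal.tsum_le_tsum h1).trans ?_
  rw [ENNReal.tsum_add, ENNReal.tsum_comm]
  simp_rw [ENNReal.tsum_mul_right, tsum_heat_left hq hs, one_mul]
  exact le_rfl

/-- The total weight of the closed paths of length `n` which are in `E`. -/
def closedSum (q : V → V → ℝ≥0∞) (n : ℕ) (E : Set (List V)) : ℝ≥0∞ :=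
  ∑' v, pathSum q n v (fun s => {l : List V | l.getLastD v = v}.indicator 1 s *
    E.indicator 1 (v :: s))

/-- Cutting closed paths into two halves, one of which must realize the event `F`. -/
lemma closedSum_le {E F : Set (List V)}
    (hEF : ∀ (v : V) (s t : List V), (s ++ t).getLastD v = v → v :: (s ++ t) ∈ E →
      v :: s ∈ F ∨ s.getLastD v :: t ∈ F)
    {a b : ℕ} {c : ℝ≥0∞} (ha : ∀ x y, heat q a x y ≤ c) (hb : ∀ x y, heat q b x y ≤ c) :
    closedSum q (a + b) E ≤
      c * (∑' v, pathProb q a v F + ∑' v, pathProb q b v F) := by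
  classical
  let L : V → List V → ℝ≥0∞ := fun v => {l : List V | l.getLastD v = v}.indicator 1
  have hL : ∀ n x y, pathSum q n x (fun t => if t.getLastD x = y then 1 else 0) ≤ heat q n x y := by
    intro n x y
    rw [heat]
  -- If the first half realizes `F`, the second only has to end at `v`, which costs at most `c`. If
  -- the second half does, its endpoints `m` and `v` are kept; the first half is later bounded by
  -- `c`, and `v` summed out.
  have h1 : ∀ v, pathSum q (a + b) v (fun s => L v s * E.indicator 1 (v :: s)) ≤
      pathProb q a v F * c +
      ∑' m, heat q a v m * pathSum q b m (fun t => (if t.getLastD m = v then 1 else 0) *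
        F.indicator 1 (m :: t)) := by
    intro v
    rw [← pathSum_getLastD a v fun m => pathSum q b m (fun t =>
      (if t.getLastD m = v then 1 else 0) * F.indicator 1 (m :: t)), pathProb,
      ← pathSum_mul_right, pathSum_append]
    refine pathSum_add_le a v fun s => ?_
    refine (pathSum_add_le (H := fun t => (if t.getLastD (s.getLastD v) = v then 1 else 0) *
        F.indicator 1 (v :: s))
      (K := fun t => (if t.getLastD (s.getLastD v) = v then 1 else 0) *
        F.indicator 1 (s.getLastD v :: t)) _ _ fun t => ?_).trans ?_
    · by_cases h : (s ++ t).getLastD v = v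
      · have h' : t.getLastD (s.getLastD v) = v := by rw [← getLastD_append, h]
        have hLs : L v (s ++ t) = 1 := Set.indicator_of_mem (s := {l : List V | _}) h _
        rw [hLs, if_pos h', one_mul, one_mul, one_mul]
        by_cases hE : v :: (s ++ t) ∈ E
        · rcases hEF v s t h hE with hF | hF
          · rw [Set.indicator_of_mem hF]
            exact (indicator_one_le _ _).trans le_self_add
          · rw [Set.indicator_of_mem hF]
            exact (indicator_one_le _ _).trans le_add_self
        · rw [Set.indicator_of_notMem hE]
          exact zero_le
      · have hLs : L v (s ++ t) = 0 := Set.indicator_of_notMem (s := {l : List V | _}) h _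
        rw [hLs, zero_mul]
        exact zero_le
    · refine add_le_add ?_ le_rfl
      rw [pathSum_mul_right, mul_comm]
      exact mul_le_mul' le_rfl ((hL _ _ _).trans (hb _ _))
  refine (ENNReal.tsum_le_tsum h1).trans ?_
  rw [ENNReal.tsum_add, ENNReal.tsum_mul_right, mul_comm, mul_add]
  refine add_le_add le_rfl ?_
  calc ∑' v, ∑' m, heat q a v m * pathSum q b m (fun t => (if t.getLastD m = v then 1 else 0) *
        F.indicator 1 (m :: t))
      ≤ ∑' v, ∑' m, c * pathSum q b m (fun t => (if t.getLastD m = v then 1 else 0) *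
        F.indicator 1 (m :: t)) :=
        ENNReal.tsum_le_tsum fun v => ENNReal.tsum_le_tsum fun m => mul_le_mul' (ha _ _) le_rfl
    _ = c * ∑' v, pathProb q b v F := by
        simp_rw [ENNReal.tsum_mul_left]
        rw [ENNReal.tsum_comm]
        congr 1
        refine tsum_congr fun m => ?_
        rw [← pathSum_tsum, pathProb]
        congr 1
        funext t
        rw [tsum_eq_single (t.getLastD m)]
        · simp
        · intro v hv
          rw [if_neg (Ne.symm hv), zero_mul]

end PathProb

/-! ### Exponential test functions and hitting estimates on `ℤ^d`. -/

section Lattice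

variable {d : ℕ}

/-- The `ℓ¹` norm on `ℤ^d`. -/
def normOne (v : Fin d → ℤ) : ℤ := ∑ i, |v i|

lemma normOne_nonneg (v : Fin d → ℤ) : 0 ≤ normOne v := Finset.sum_nonneg fun _ _ => abs_nonneg _

lemma normOne_add_le (v w : Fin d → ℤ) : normOne (v + w) ≤ normOne v + normOne w := by
  rw [normOne, normOne, normOne, ← Finset.sum_add_distrib]
  exact Finset.sum_le_sum fun i _ => abs_add_le _ _

lemma normOne_neg (v : Fin d → ℤ) : normOne (-v) = normOne v := by simp [normOne]

lemma normOne_sub_comm (v w : Fin d → ℤ) : normOne (v - w) = normOne (w - v) := by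
  rw [← normOne_neg, neg_sub]

lemma normOne_sub_le (u v w : Fin d → ℤ) : normOne (u - w) ≤ normOne (u - v) + normOne (v - w) := by
  have := normOne_add_le (u - v) (v - w)
  rwa [sub_add_sub_cancel] at this

lemma tsum_prod_pi (g : ℤ → ℝ≥0∞) (d : ℕ) :
    ∑' v : Fin d → ℤ, ∏ i, g (v i) = (∑' j, g j) ^ d := by
  induction d with
  | zero => simp
  | succ d ih =>
    rw [← (Fin.consEquiv fun _ : Fin (d + 1) => ℤ).tsum_eq, pow_succ', ← ih]
    have h : ∀ p : ℤ × (Fin d → ℤ), ∏ i, g ((Fin.consEquiv fun _ : Fin (d + 1) => ℤ) p i) =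
        g p.1 * ∏ i, g (p.2 i) := by
      intro p
      rw [Fin.prod_univ_succ]
      simp [Fin.consEquiv]
    simp_rw [h]
    rw [ENNReal.tsum_prod (f := fun (a : ℤ) (b : Fin d → ℤ) => g a * ∏ i, g (b i))]
    simp_rw [ENNReal.tsum_mul_left, ENNReal.tsum_mul_right]

lemma tsum_exp_abs_le {t : ℝ} (ht : 0 < t) (ht1 : t ≤ 1) :
    ∑' j : ℤ, ENNReal.ofReal (Real.exp (-t * |(j : ℝ)|)) ≤ ENNReal.ofReal (4 / t) := by
  have hgeo : ∑' n : ℕ, ENNReal.ofReal (Real.exp (-t * n)) ≤ ENNReal.ofReal (2 / t) := by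
    have h1 : ∀ n : ℕ, ENNReal.ofReal (Real.exp (-t * n)) = ENNReal.ofReal (Real.exp (-t)) ^ n := by
      intro n
      rw [← ENNReal.ofReal_pow (Real.exp_pos _).le, ← Real.exp_nat_mul, mul_comm]
    simp_rw [h1]
    rw [ENNReal.tsum_geometric, ← ENNReal.ofReal_one, ← ENNReal.ofReal_sub _ (Real.exp_pos _).le]
    have h2 : Real.exp (-t) * (1 + t) ≤ 1 := by
      have := Real.add_one_le_exp t
      calc Real.exp (-t) * (1 + t) ≤ Real.exp (-t) * Real.exp t := by
            gcongr; linarith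
        _ = 1 := by rw [← Real.exp_add]; simp
    have h3 : t / 2 ≤ 1 - Real.exp (-t) := by nlinarith
    rw [← ENNReal.ofReal_inv_of_pos (by linarith)]
    refine ENNReal.ofReal_le_ofReal ?_
    rw [← inv_div t 2]
    exact inv_anti₀ (by positivity) h3
  have hsplit := (HasSum.of_nat_of_neg_add_one
    (f := fun j : ℤ => ENNReal.ofReal (Real.exp (-t * |(j : ℝ)|)))
    ENNReal.summable.hasSum ENNReal.summable.hasSum).tsum_eq
  rw [hsplit, show (4 : ℝ) / t = 2 / t + 2 / t by ring, ENNReal.ofReal_add (by positivity)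
    (by positivity)]
  refine add_le_add ?_ ?_
  · simpa using hgeo
  · refine le_trans (ENNReal.tsum_le_tsum fun n => ENNReal.ofReal_le_ofReal
      (Real.exp_le_exp.2 ?_)) hgeo
    have : |((-((n : ℤ) + 1) : ℤ) : ℝ)| = n + 1 := by
      push_cast
      rw [abs_neg, abs_of_nonneg (by positivity)]
    rw [this]
    nlinarith

lemma tsum_exp_normOne_le (y : Fin d → ℤ) {t : ℝ} (ht : 0 < t) (ht1 : t ≤ 1) :
    ∑' v : Fin d → ℤ, ENNReal.ofReal (Real.exp (-t * normOne (v - y))) ≤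
      ENNReal.ofReal ((4 / t) ^ d) := by
  refine ((Equiv.subRight y).tsum_eq
    (fun v : Fin d → ℤ => ENNReal.ofReal (Real.exp (-t * normOne v)))).trans_le ?_
  have h : ∀ v : Fin d → ℤ, ENNReal.ofReal (Real.exp (-t * normOne v)) =
      ∏ i, ENNReal.ofReal (Real.exp (-t * |(v i : ℝ)|)) := by
    intro v
    rw [← ENNReal.ofReal_prod_of_nonneg fun _ _ => (Real.exp_pos _).le, ← Real.exp_sum,
      ← Finset.mul_sum]
    simp [normOne]
  simp_rw [h]
  rw [tsum_prod_pi (fun j : ℤ => ENNReal.ofReal (Real.exp (-t * |(j : ℝ)|))), ENNReal.ofReal_pow (by positivity)]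
  gcongr
  exact tsum_exp_abs_le ht ht1

/-- Pairing the steps `±eᵢ` reduces the supersolution condition to one inequality per axis. -/
lemma tsum_latticeStep_ofReal_le (hd : 0 < d) {f : (Fin d → ℤ) → ℝ} (hf : ∀ v, 0 ≤ f v) {c : ℝ}
    (hc : 0 ≤ c) (x : Fin d → ℤ)
    (h : ∀ i, f (x + unitVec (i, true)) + f (x + unitVec (i, false)) ≤ 2 * c * f x) :
    ∑' a, latticeStep d x a * ENNReal.ofReal (f a) ≤ ENNReal.ofReal c * ENNReal.ofReal (f x) := by
  have hd' : (0 : ℝ) < d := by exact_mod_cast hd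
  rw [tsum_latticeStep_mul hd, ← ENNReal.ofReal_natCast, ← ENNReal.ofReal_inv_of_pos
    (by positivity), ← ENNReal.ofReal_sum_of_nonneg fun _ _ => hf _,
    ← ENNReal.ofReal_mul (by positivity), ← ENNReal.ofReal_mul hc]
  refine ENNReal.ofReal_le_ofReal ?_
  rw [inv_mul_le_iff₀ (by positivity), Fintype.sum_prod_type]
  simp only [Fintype.sum_bool]
  refine (Finset.sum_le_sum fun i _ => h i).trans_eq ?_
  rw [Finset.sum_const, Finset.card_univ, Fintype.card_fin, nsmul_eq_mul]
  push_cast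
  ring

lemma normOne_add_unitVec (x : Fin d → ℤ) (p : Fin d × Bool) :
    normOne (x + unitVec p) = normOne x + (|x p.1 + (if p.2 then 1 else -1)| - |x p.1|) := by
  rw [normOne, normOne, ← Finset.add_sum_erase _ _ (Finset.mem_univ p.1),
    ← Finset.add_sum_erase Finset.univ (fun i => |x i|) (Finset.mem_univ p.1)]
  have : ∀ j ∈ Finset.univ.erase p.1, |(x + unitVec p) j| = |x j| := by
    intro j hj
    simp [unitVec, (Finset.mem_erase.1 hj).1]
  rw [Finset.sum_congr rfl this]
  simp [unitVec]
  ring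

/-- Off the hyperplane `x i = 0` this is an equality; on it both steps increase the norm, and `exp
(-t) ≤ cosh t`. -/
lemma exp_neg_normOne_step {t : ℝ} (ht : 0 ≤ t) (x : Fin d → ℤ) (i : Fin d) :
    Real.exp (-t * normOne (x + unitVec (i, true))) +
      Real.exp (-t * normOne (x + unitVec (i, false))) ≤
      2 * Real.cosh t * Real.exp (-t * normOne x) := by
  have key : ∀ e : ℤ, ∀ n : ℤ, Real.exp (-t * ((n + e : ℤ) : ℝ)) =
      Real.exp (-t * e) * Real.exp (-t * n) := by
    intro e n
    rw [← Real.exp_add]; congr 1; push_cast; ring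
  rw [normOne_add_unitVec, normOne_add_unitVec, key, key, ← add_mul]
  refine mul_le_mul_of_nonneg_right ?_ (Real.exp_pos _).le
  simp only [if_true, Bool.false_eq_true, if_false]
  have hmono : Real.exp (-t) ≤ Real.exp t := Real.exp_le_exp.2 (by linarith)
  rw [Real.cosh_eq]
  rcases lt_trichotomy (x i) 0 with h | h | h
  · rw [abs_of_neg h, abs_of_nonpos (by omega : x i + 1 ≤ 0), abs_of_nonpos (by omega : x i + -1 ≤ 0)]
    rw [show -(x i + 1) - -x i = -1 by ring, show -(x i + -1) - -x i = 1 by ring]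
    norm_num
    linarith
  · rw [h]
    norm_num
    linarith
  · rw [abs_of_pos h, abs_of_nonneg (by omega : 0 ≤ x i + 1), abs_of_nonneg (by omega : 0 ≤ x i + -1)]
    rw [show x i + 1 - x i = 1 by ring, show x i + -1 - x i = -1 by ring]
    norm_num
    linarith

/-- For exits, `exp (t * normOne)` fails to be a supersolution with factor `cosh t` on the
coordinate hyperplanes. This product of `cosh` is an exact eigenfunction and is comparable to it up
to `2 ^ d`. -/
lemma prod_cosh_step (t : ℝ) (x : Fin d → ℤ) (i : Fin d) :
    ∏ j, Real.cosh (t * (x + unitVec (i, true)) j) +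
      ∏ j, Real.cosh (t * (x + unitVec (i, false)) j) =
      2 * Real.cosh t * ∏ j, Real.cosh (t * x j) := by
  have h : ∀ b : Bool, ∏ j, Real.cosh (t * (x + unitVec (i, b)) j) =
      Real.cosh (t * x i + (if b then t else -t)) * ∏ j ∈ Finset.univ.erase i, Real.cosh (t * x j) := by
    intro b
    rw [← Finset.mul_prod_erase _ _ (Finset.mem_univ i)]
    congr 1
    · cases b <;> simp [unitVec] <;> ring_nf
    · refine Finset.prod_congr rfl fun j hj => ?_
      simp [unitVec, (Finset.mem_erase.1 hj).1]
  rw [h, h, ← Finset.mul_prod_erase Finset.univ (fun j => Real.cosh (t * x j)) (Finset.mem_univ i)]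
  simp only [if_true, Bool.false_eq_true, if_false, Real.cosh_add, Real.cosh_neg, Real.sinh_neg]
  ring

lemma exp_le_two_mul_cosh (t : ℝ) (j : ℤ) : Real.exp (t * |(j : ℝ)|) ≤ 2 * Real.cosh (t * j) := by
  rw [Real.cosh_eq]
  rcases abs_choice (j : ℝ) with h | h
  · rw [h]; linarith [Real.exp_pos (-(t * j))]
  · rw [h, show t * -(j : ℝ) = -(t * j) by ring]; linarith [Real.exp_pos (t * j)]

lemma cosh_le_exp_abs {t : ℝ} (ht : 0 ≤ t) (j : ℤ) : Real.cosh (t * j) ≤ Real.exp (t * |(j : ℝ)|) := by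
  rw [← Real.cosh_abs, abs_mul, abs_of_nonneg ht]
  rw [Real.cosh_eq]
  have : Real.exp (-(t * |(j : ℝ)|)) ≤ Real.exp (t * |(j : ℝ)|) :=
    Real.exp_le_exp.2 (by have : 0 ≤ t * |(j : ℝ)| := by positivity
                          linarith)
  linarith

lemma exp_mul_normOne (t : ℝ) (v : Fin d → ℤ) :
    Real.exp (t * normOne v) = ∏ i, Real.exp (t * |(v i : ℝ)|) := by
  rw [← Real.exp_sum, ← Finset.mul_sum]
  simp [normOne]

lemma one_le_cosh_pow_le (t : ℝ) (n : ℕ) :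
    ENNReal.ofReal (Real.cosh t) ^ n ≤ ENNReal.ofReal (Real.exp (n * t ^ 2 / 2)) := by
  rw [← ENNReal.ofReal_pow (Real.cosh_pos t).le]
  refine ENNReal.ofReal_le_ofReal ?_
  refine (pow_le_pow_left₀ (Real.cosh_pos t).le (Real.cosh_le_exp_half_sq t) n).trans_eq ?_
  rw [← Real.exp_nat_mul]
  congr 1
  ring

/-- Probability of hitting the ball of radius `s` around `y` within `n` steps. -/
lemma pathProb_visits_ball_le (hd : 0 < d) {t : ℝ} (ht : 0 ≤ t) (s : ℝ) (y v : Fin d → ℤ) (n : ℕ) :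
    pathProb (latticeStep d) n v (visits {w | (normOne (w - y) : ℝ) ≤ s}) ≤
      ENNReal.ofReal (Real.exp (n * t ^ 2 / 2) * Real.exp (t * (s - normOne (v - y)))) := by
  set u : (Fin d → ℤ) → ℝ := fun w => Real.exp (t * (s - normOne (w - y))) with hu
  have hu' : ∀ w, u w = Real.exp (t * s) * Real.exp (-t * normOne (w - y)) := by
    intro w
    change Real.exp (t * (s - normOne (w - y))) = _
    rw [← Real.exp_add]
    congr 1
    ring
  refine (pathProb_visits_le (tsum_latticeStep) (u := fun w => ENNReal.ofReal (u w))
    (ρ := ENNReal.ofReal (Real.cosh t)) ?_ ?_ ?_ n v).trans ?_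
  · rw [ENNReal.one_le_ofReal]; exact Real.one_le_cosh t
  · intro w hw
    rw [ENNReal.one_le_ofReal, hu, Real.one_le_exp_iff]
    exact mul_nonneg ht (sub_nonneg.2 hw)
  · intro w
    refine tsum_latticeStep_ofReal_le hd (fun _ => (Real.exp_pos _).le) (Real.cosh_pos t).le w
      fun i => ?_
    change u _ + u _ ≤ _ * u _
    rw [hu', hu', hu']
    rw [add_sub_right_comm, add_sub_right_comm, ← mul_add, mul_left_comm]
    exact mul_le_mul_of_nonneg_left (exp_neg_normOne_step ht _ i) (Real.exp_pos _).le
  · rw [ENNReal.ofReal_mul (Real.exp_pos _).le]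
    exact mul_le_mul' (one_le_cosh_pow_le t n) le_rfl

/-- Probability of leaving the ball of radius `r` around `y` within `n` steps. -/
lemma pathProb_visits_compl_ball_le (hd : 0 < d) {t : ℝ} (ht : 0 ≤ t) (r : ℝ) (y v : Fin d → ℤ)
    (n : ℕ) :
    pathProb (latticeStep d) n v (visits {w | r < (normOne (w - y) : ℝ)}) ≤
      ENNReal.ofReal (Real.exp (n * t ^ 2 / 2) *
        (2 ^ d * Real.exp (t * (normOne (v - y) - r)))) := by
  set u : (Fin d → ℤ) → ℝ := fun w =>
    2 ^ d * Real.exp (-(t * r)) * ∏ j, Real.cosh (t * (w - y) j) with hu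
  refine (pathProb_visits_le (tsum_latticeStep) (u := fun w => ENNReal.ofReal (u w))
    (ρ := ENNReal.ofReal (Real.cosh t)) ?_ ?_ ?_ n v).trans ?_
  · rw [ENNReal.one_le_ofReal]; exact Real.one_le_cosh t
  · intro w hw
    rw [ENNReal.one_le_ofReal, hu]
    have h1 : Real.exp (t * normOne (w - y)) ≤ 2 ^ d * ∏ j, Real.cosh (t * (w - y) j) := by
      have : (2 : ℝ) ^ d = ∏ _j : Fin d, (2 : ℝ) := by simp
      rw [exp_mul_normOne, this, ← Finset.prod_mul_distrib]
      exact Finset.prod_le_prod (fun _ _ => (Real.exp_pos _).le) fun j _ => exp_le_two_mul_cosh t _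
    calc (1 : ℝ) ≤ Real.exp (-(t * r)) * Real.exp (t * normOne (w - y)) := by
          rw [← Real.exp_add, Real.one_le_exp_iff]
          have : t * r ≤ t * normOne (w - y) := mul_le_mul_of_nonneg_left (le_of_lt hw) ht
          linarith
      _ ≤ Real.exp (-(t * r)) * (2 ^ d * ∏ j, Real.cosh (t * (w - y) j)) := by gcongr
      _ = _ := by ring
  · intro w
    refine tsum_latticeStep_ofReal_le hd (fun _ => ?_) (Real.cosh_pos t).le w fun i => ?_
    · have : 0 ≤ ∏ j, Real.cosh (t * ((‹Fin d → ℤ› - y) j : ℤ)) :=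
        Finset.prod_nonneg fun j _ => (Real.cosh_pos _).le
      positivity
    · simp only [hu]
      rw [add_sub_right_comm, add_sub_right_comm, ← mul_add, prod_cosh_step]
      refine le_of_eq ?_
      ring
  · rw [ENNReal.ofReal_mul (Real.exp_pos _).le]
    refine mul_le_mul' (one_le_cosh_pow_le t n) (ENNReal.ofReal_le_ofReal ?_)
    rw [hu]
    calc 2 ^ d * Real.exp (-(t * r)) * ∏ j, Real.cosh (t * (v - y) j)
        ≤ 2 ^ d * Real.exp (-(t * r)) * Real.exp (t * normOne (v - y)) := by
          rw [exp_mul_normOne]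
          gcongr with j
          exact cosh_le_exp_abs ht _
      _ = _ := by
          rw [mul_assoc, ← Real.exp_add]
          congr 2
          ring

end Lattice

/-! ### Closed paths that visit a ball or cross an annulus. -/

section LoopMass

variable {d : ℕ}

/-- Total hitting probability of a ball, summed over starting points. -/
lemma tsum_pathProb_visits_ball_le (hd : 0 < d) {M : ℕ} (hM : 1 ≤ M) (y : Fin d → ℤ) (n : ℕ) :
    ∑' v, pathProb (latticeStep d) n v (visits {w | (normOne (w - y) : ℝ) ≤ M}) ≤
      ENNReal.ofReal ((n / M ^ 2 + 1) * (5 * (4 * M) ^ d)) := by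
  have hM' : (1 : ℝ) ≤ M := by exact_mod_cast hM
  have hM0 : (0 : ℝ) < M := by linarith
  set A : Set (Fin d → ℤ) := {w | (normOne (w - y) : ℝ) ≤ M} with hA
  -- With `t = 1 / M`, times up to `M²` cost a factor at most `exp (1/2)` and the radius a factor
  -- `exp 1`; the constant `5` dominates `exp (3/2)`.
  have hshort : ∀ k : ℕ, k ≤ M ^ 2 → ∑' v, pathProb (latticeStep d) k v (visits A) ≤
      ENNReal.ofReal (5 * (4 * M) ^ d) := by
    intro k hk
    have hk' : (k : ℝ) ≤ M ^ 2 := by exact_mod_cast hk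
    have h1 : ∀ v, pathProb (latticeStep d) k v (visits A) ≤
        ENNReal.ofReal 5 * ENNReal.ofReal (Real.exp (-(1 / M) * normOne (v - y))) := by
      intro v
      refine (pathProb_visits_ball_le hd (t := 1 / M) (by positivity) M y v k).trans ?_
      rw [← ENNReal.ofReal_mul (by norm_num)]
      refine ENNReal.ofReal_le_ofReal ?_
      have e1 : Real.exp (1 / M * (M - normOne (v - y))) =
          Real.exp 1 * Real.exp (-(1 / M) * normOne (v - y)) := by
        rw [← Real.exp_add]; congr 1; field_simp; ring
      rw [e1, ← mul_assoc, ← Real.exp_add]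
      refine mul_le_mul_of_nonneg_right ?_ (Real.exp_pos _).le
      have e2 : (k : ℝ) * (1 / M) ^ 2 / 2 ≤ 1 / 2 := by
        rw [div_pow, one_pow, mul_one_div]
        have : (k : ℝ) / M ^ 2 ≤ 1 := (div_le_one (by positivity)).2 hk'
        linarith
      calc Real.exp (k * (1 / M) ^ 2 / 2 + 1) ≤ Real.exp (3 / 2) :=
            Real.exp_le_exp.2 (by linarith)
        _ ≤ 5 := by
            have h3 : Real.exp (3 / 2) ^ 2 ≤ 5 ^ 2 := by
              rw [← Real.exp_nat_mul]
              have : ((2 : ℕ) : ℝ) * (3 / 2) = ((3 : ℕ) : ℝ) * 1 := by norm_num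
              rw [this, Real.exp_nat_mul]
              calc Real.exp 1 ^ 3 ≤ 2.7182818286 ^ 3 :=
                    pow_le_pow_left₀ (Real.exp_pos _).le Real.exp_one_lt_d9.le 3
                _ ≤ 5 ^ 2 := by norm_num
            exact le_of_sq_le_sq h3 (by norm_num)
    refine (ENNReal.tsum_le_tsum h1).trans ?_
    rw [ENNReal.tsum_mul_left, ENNReal.ofReal_mul (by norm_num)]
    refine mul_le_mul' le_rfl ((tsum_exp_normOne_le y (by positivity)
      ((div_le_one hM0).2 hM')).trans_eq ?_)
    congr 2
    field_simp
  -- Longer times are cut into blocks of `M²` steps and a remainder, each contributing order `M^d`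
  -- by subadditivity.
  have hblock : ∀ j k : ℕ, k ≤ M ^ 2 → ∑' v, pathProb (latticeStep d) (j * M ^ 2 + k) v (visits A) ≤
      ENNReal.ofReal ((j + 1) * (5 * (4 * M) ^ d)) := by
    intro j k hk
    induction j with
    | zero => simpa using hshort k hk
    | succ j ih =>
      rw [show (j + 1) * M ^ 2 + k = M ^ 2 + (j * M ^ 2 + k) by ring]
      refine (tsum_pathProb_visits_add_le tsum_latticeStep (latticeStep_comm hd) A _ _).trans ?_
      refine (add_le_add (hshort _ le_rfl) ih).trans_eq ?_
      rw [← ENNReal.ofReal_add (by positivity) (by positivity)]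
      congr 1
      push_cast
      ring
  have h := hblock (n / M ^ 2) (n % M ^ 2) (Nat.mod_lt _ (by positivity)).le
  rw [Nat.div_add_mod'] at h
  refine h.trans (ENNReal.ofReal_le_ofReal ?_)
  refine mul_le_mul_of_nonneg_right ?_ (by positivity)
  have : ((n / M ^ 2 : ℕ) : ℝ) ≤ n / M ^ 2 := by
    refine Nat.cast_div_le.trans_eq ?_
    push_cast
    rfl
  linarith

/-- The lists that visit both the ball of radius `s` and the complement of the ball of radius `r`
around `y`. -/
def crosses (y : Fin d → ℤ) (s r : ℝ) : Set (List (Fin d → ℤ)) :=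
  visits {w | (normOne (w - y) : ℝ) ≤ s} ∩ visits {w | r < (normOne (w - y) : ℝ)}

lemma tsum_pathProb_crosses_le (hd : 0 < d) {N k : ℕ} (hN : 1 ≤ N) (hk : k ≤ N) {s : ℝ}
    (y : Fin d → ℤ) :
    ∑' v, pathProb (latticeStep d) k v (crosses y s (3 * s)) ≤
      ENNReal.ofReal (2 ^ (d + 1) * Real.exp (-(s / (2 * √N))) * (16 * √N) ^ d) := by
  have hN' : (1 : ℝ) ≤ N := by exact_mod_cast hN
  have hN1 : (1 : ℝ) ≤ √N := Real.one_le_sqrt.2 hN'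
  have hN0 : (0 : ℝ) < √N := by linarith
  have hk' : (k : ℝ) ≤ N := by exact_mod_cast hk
  set t : ℝ := 1 / √N with ht
  have ht0 : 0 < t := by positivity
  have htk : (k : ℝ) * t ^ 2 / 2 ≤ 1 / 2 := by
    rw [ht, div_pow, one_pow, Real.sq_sqrt (by linarith), mul_one_div]
    have : (k : ℝ) / N ≤ 1 := (div_le_one (by linarith)).2 hk'
    linarith
  have hexp : Real.exp (k * t ^ 2 / 2) ≤ 2 := by
    refine (Real.exp_le_exp.2 htk).trans ?_
    have h3 : Real.exp (1 / 2) ^ 2 ≤ 2 ^ 2 := by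
      rw [← Real.exp_nat_mul]
      have : ((2 : ℕ) : ℝ) * (1 / 2) = 1 := by norm_num
      rw [this]
      exact Real.exp_one_lt_d9.le.trans (by norm_num)
    exact le_of_sq_le_sq h3 (by norm_num)
  have h1 : ∀ v, pathProb (latticeStep d) k v (crosses y s (3 * s)) ≤
      ENNReal.ofReal (2 ^ (d + 1) * Real.exp (-(s / (2 * √N)))) *
        ENNReal.ofReal (Real.exp (-(t / 4) * normOne (v - y))) := by
    intro v
    have hst : s / (2 * √N) = t * s / 2 := by rw [ht]; field_simp
    rw [← ENNReal.ofReal_mul (by positivity), hst, mul_assoc (2 ^ (d + 1) : ℝ), ← Real.exp_add]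
    -- From within `2s` the path must still climb to `3s`; from beyond, it must descend to `s`. At
    -- `2s` both exponents equal `-(t * s / 2) - (t / 4) * normOne (v - y)`, whose last term makes
    -- the sum over `v` converge.
    by_cases h : (normOne (v - y) : ℝ) ≤ 2 * s
    · refine (pathProb_mono k v Set.inter_subset_right).trans
        ((pathProb_visits_compl_ball_le hd ht0.le (3 * s) y v k).trans
          (ENNReal.ofReal_le_ofReal ?_))
      calc Real.exp (k * t ^ 2 / 2) * (2 ^ d * Real.exp (t * (normOne (v - y) - 3 * s)))
          ≤ 2 * (2 ^ d * Real.exp (-(t * s / 2) + -(t / 4) * normOne (v - y))) := by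
            gcongr
            nlinarith
        _ = _ := by ring
    · push Not at h
      refine (pathProb_mono k v Set.inter_subset_left).trans
        ((pathProb_visits_ball_le hd ht0.le s y v k).trans (ENNReal.ofReal_le_ofReal ?_))
      have h2d : (1 : ℝ) ≤ 2 ^ d := one_le_pow₀ (by norm_num)
      calc Real.exp (k * t ^ 2 / 2) * Real.exp (t * (s - normOne (v - y)))
          ≤ 2 * Real.exp (-(t * s / 2) + -(t / 4) * normOne (v - y)) := by
            gcongr
            nlinarith
        _ ≤ 2 ^ d * (2 * Real.exp (-(t * s / 2) + -(t / 4) * normOne (v - y))) :=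
            le_mul_of_one_le_left (by positivity) h2d
        _ = _ := by ring
  refine (ENNReal.tsum_le_tsum h1).trans ?_
  rw [ENNReal.tsum_mul_left, ENNReal.ofReal_mul (p := 2 ^ (d + 1) * _) (by positivity)]
  refine mul_le_mul' le_rfl ((tsum_exp_normOne_le y (t := t / 4) (by positivity) ?_).trans_eq ?_)
  · have : t ≤ 1 := (div_le_one hN0).2 hN1
    linarith
  · congr 2
    rw [ht]
    field_simp
    norm_num

/-- Rounding down loses at most another factor two: `N ≤ 4a` even for odd `N ≥ 2`, so `√N ≤ 2√a`. -/
lemma heat_half_le (C : ℝ) (hC : 0 < C) (h : ∀ n : ℕ, 1 ≤ n → ∀ x y : Fin d → ℤ,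
    heat (latticeStep d) n x y ≤ ENNReal.ofReal ((C / √n) ^ d)) {N a : ℕ} (hN : 2 ≤ N)
    (ha : N / 2 ≤ a) (x y : Fin d → ℤ) :
    heat (latticeStep d) a x y ≤ ENNReal.ofReal ((2 * C / √N) ^ d) := by
  have ha1 : 1 ≤ a := by omega
  refine (h a ha1 x y).trans (ENNReal.ofReal_le_ofReal ?_)
  have hN0 : (0 : ℝ) < √N := Real.sqrt_pos.2 (by exact_mod_cast (by omega : 0 < N))
  have ha0 : (0 : ℝ) < √a := Real.sqrt_pos.2 (by exact_mod_cast (by omega : 0 < a))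
  refine pow_le_pow_left₀ (by positivity) ?_ d
  rw [div_le_div_iff₀ ha0 hN0]
  have : √N ≤ 2 * √a := by
    rw [Real.sqrt_le_left (by positivity), mul_pow, Real.sq_sqrt (by positivity)]
    have : N ≤ 4 * a := by omega
    calc (N : ℝ) ≤ ((4 * a : ℕ) : ℝ) := by exact_mod_cast this
      _ = 2 ^ 2 * a := by push_cast; ring
  nlinarith

/-- The mass of the closed paths of length `N` that visit a ball. -/
lemma exists_closedSum_visits_le (hd : 3 ≤ d) : ∃ C : ℝ, 0 < C ∧ ∀ (M N : ℕ), 1 ≤ M → 2 ≤ N →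
    M ^ 2 ≤ N → ∀ y : Fin d → ℤ,
    closedSum (latticeStep d) N (visits {w | (normOne (w - y) : ℝ) ≤ M}) ≤
      ENNReal.ofReal (C * (M / √N)) := by
  have hd0 : 0 < d := by omega
  obtain ⟨C, hC, hheat⟩ := exists_heat_le hd0
  refine ⟨(2 * C) ^ d * (20 * 4 ^ d), by positivity, fun M N hM hN hMN y => ?_⟩
  have hM0 : (0 : ℝ) < M := by exact_mod_cast hM
  have hN0 : (0 : ℝ) < N := by exact_mod_cast (by omega : 0 < N)
  have hsN : (0 : ℝ) < √N := Real.sqrt_pos.2 hN0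
  have hMN' : (M : ℝ) ^ 2 ≤ N := by exact_mod_cast hMN
  have hsplit : N = N / 2 + (N - N / 2) := by omega
  have hsum : ∀ a : ℕ, a ≤ N → ∑' v, pathProb (latticeStep d) a v
      (visits {w | (normOne (w - y) : ℝ) ≤ M}) ≤
      ENNReal.ofReal (2 * (N / M ^ 2) * (5 * (4 * M) ^ d)) := by
    intro a ha
    refine (tsum_pathProb_visits_ball_le hd0 hM y a).trans (ENNReal.ofReal_le_ofReal ?_)
    refine mul_le_mul_of_nonneg_right ?_ (by positivity)
    have h1 : (a : ℝ) / M ^ 2 ≤ N / M ^ 2 := by gcongr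
    have h2 : 1 ≤ (N : ℝ) / M ^ 2 := (one_le_div (by positivity)).2 hMN'
    linarith
  have h := closedSum_le (q := latticeStep d) (E := visits {w | (normOne (w - y) : ℝ) ≤ M})
    (F := visits {w | (normOne (w - y) : ℝ) ≤ M}) (a := N / 2) (b := N - N / 2) ?_
    (heat_half_le C hC hheat hN le_rfl) (heat_half_le C hC hheat hN (by omega))
  · rw [← hsplit] at h
    refine h.trans ((mul_le_mul' le_rfl (add_le_add (hsum _ (by omega)) (hsum _ (by omega)))).trans ?_)
    rw [← ENNReal.ofReal_add (by positivity) (by positivity), ← ENNReal.ofReal_mul (by positivity)]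
    refine ENNReal.ofReal_le_ofReal ?_
    set x : ℝ := M / √N with hx
    have hx1 : x ≤ 1 := by
      rw [hx, div_le_one hsN]
      exact Real.le_sqrt_of_sq_le hMN'
    have hx0 : 0 < x := by positivity
    have hxx : (N : ℝ) / M ^ 2 = 1 / x ^ 2 := by
      rw [hx, div_pow, Real.sq_sqrt hN0.le, one_div_div]
    have e : (2 * C / √N) ^ d * (2 * (N / M ^ 2) * (5 * (4 * M) ^ d) +
        2 * (N / M ^ 2) * (5 * (4 * M) ^ d)) = (2 * C) ^ d * (20 * 4 ^ d) * (x ^ d / x ^ 2) := by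
      rw [hxx, hx, div_pow, div_pow, mul_pow 4 (M : ℝ)]
      ring
    rw [e]
    refine mul_le_mul_of_nonneg_left ?_ (by positivity)
    -- The dimension enters here: with `x = M / √N ≤ 1`, the bound `x ^ (d - 2) ≤ x` needs `d ≥ 3`.
    rw [div_le_iff₀ (by positivity), ← pow_succ']
    exact pow_le_pow_of_le_one hx0.le hx1 hd
  · rintro v s t - ⟨w, hw, hwA⟩
    rw [← List.cons_append, List.mem_append] at hw
    rcases hw with hw | hw
    · exact Or.inl ⟨w, hw, hwA⟩
    · exact Or.inr ⟨w, List.mem_cons_of_mem _ hw, hwA⟩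

lemma getLastD_mem_cons {V : Type*} (s : List V) (v : V) : s.getLastD v ∈ v :: s := by
  induction s generalizing v with
  | nil => simp
  | cons a s ih => rw [List.getLastD_cons]; exact List.mem_cons_of_mem _ (ih a)

/-- The mass of the short closed paths that cross a wide annulus. -/
lemma exists_closedSum_crosses_le (hd : 0 < d) : ∃ C : ℝ, 0 < C ∧ ∀ (M N : ℕ), 1 ≤ M → 2 ≤ N →
    ∀ y : Fin d → ℤ,
    closedSum (latticeStep d) N (crosses y M (9 * M)) ≤ ENNReal.ofReal (C * (N / M ^ 2)) := by
  obtain ⟨C, hC, hheat⟩ := exists_heat_le hd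
  refine ⟨(2 * C) ^ d * (4 * 2 ^ (d + 1) * 16 ^ d) * 8, by positivity, fun M N hM hN y => ?_⟩
  have hM0 : (0 : ℝ) < M := by exact_mod_cast hM
  have hN0 : (0 : ℝ) < N := by exact_mod_cast (by omega : 0 < N)
  have hsN : (0 : ℝ) < √N := Real.sqrt_pos.2 hN0
  have hsplit : N = N / 2 + (N - N / 2) := by omega
  set B : ℝ := 2 ^ (d + 1) * Real.exp (-(M / (2 * √N))) * (16 * √N) ^ d with hB
  have hB0 : 0 < B := by positivity
  set F : Set (List (Fin d → ℤ)) := crosses y M (3 * M) ∪ crosses y (3 * M) (3 * (3 * M)) with hF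
  have hsum : ∀ a : ℕ, a ≤ N → ∑' v, pathProb (latticeStep d) a v F ≤ ENNReal.ofReal (2 * B) := by
    intro a ha
    refine (ENNReal.tsum_le_tsum fun v => pathProb_union_le a v _ _).trans ?_
    rw [ENNReal.tsum_add, two_mul, ENNReal.ofReal_add hB0.le hB0.le]
    refine add_le_add (tsum_pathProb_crosses_le hd (by omega) ha y) ?_
    refine (tsum_pathProb_crosses_le hd (by omega) ha y).trans (ENNReal.ofReal_le_ofReal ?_)
    rw [hB]
    gcongr
    linarith
  have h := closedSum_le (q := latticeStep d) (E := crosses y M (9 * M))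
    (F := F) (a := N / 2) (b := N - N / 2) ?_
    (heat_half_le C hC hheat hN le_rfl) (heat_half_le C hC hheat hN (by omega))
  · rw [← hsplit] at h
    refine h.trans ((mul_le_mul' le_rfl (add_le_add (hsum _ (by omega)) (hsum _ (by omega)))).trans ?_)
    rw [← ENNReal.ofReal_add (by positivity) (by positivity), ← ENNReal.ofReal_mul (by positivity)]
    refine ENNReal.ofReal_le_ofReal ?_
    -- A quadratic gain suffices: `exp (-a) ≤ 2 / a²` gives `N / M²`, and after division by `N` the
    -- sum over `N < M²` is bounded.
    have hexp : Real.exp (-(M / (2 * √N))) ≤ 8 * (N / M ^ 2) := by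
      have h1 : (M / (2 * √N)) ^ 2 / 2 ≤ Real.exp (M / (2 * √N)) := by
        have := Real.quadratic_le_exp_of_nonneg (x := M / (2 * √N)) (by positivity)
        have h0 : 0 < (M : ℝ) / (2 * √N) := by positivity
        linarith
      rw [Real.exp_neg, inv_le_comm₀ (Real.exp_pos _) (by positivity)]
      refine le_trans (le_of_eq ?_) h1
      rw [div_pow, mul_pow, Real.sq_sqrt hN0.le]
      field_simp
      norm_num
    have e : (2 * C / √N) ^ d * (2 * B + 2 * B) =
        (2 * C) ^ d * (4 * 2 ^ (d + 1) * 16 ^ d) * Real.exp (-(M / (2 * √N))) := by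
      rw [hB, div_pow, mul_pow 16 √N]
      field_simp
      ring
    rw [e]
    calc _ ≤ (2 * C) ^ d * (4 * 2 ^ (d + 1) * 16 ^ d) * (8 * (N / M ^ 2)) := by gcongr
      _ = _ := by ring
  · rintro v s t hlast ⟨⟨w, hw, hwA⟩, w', hw', hwA'⟩
    rw [← List.cons_append, List.mem_append] at hw hw'
    have hv2 : v ∈ s.getLastD v :: t := by
      have := getLastD_mem_cons t (s.getLastD v)
      rwa [← getLastD_append, hlast] at this
    have hv1 : v ∈ v :: s := List.mem_cons_self
    have hm : ∀ u ∈ t, u ∈ s.getLastD v :: t := fun u hu => List.mem_cons_of_mem _ hu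
    have h9 : (3 : ℝ) * (3 * M) = 9 * M := by ring
    -- The path is closed, so its root `v` lies in both halves. If `v` is within `3M`, the half
    -- reaching beyond `9M` crosses from `3M` to `9M`; otherwise the half meeting the `M`-ball
    -- crosses from `M` to `3M`.
    by_cases hv : (normOne (v - y) : ℝ) ≤ 3 * M
    · rw [← h9] at hwA'
      rcases hw' with hw' | hw'
      · exact Or.inl (Or.inr ⟨⟨v, hv1, hv⟩, w', hw', hwA'⟩)
      · exact Or.inr (Or.inr ⟨⟨v, hv2, hv⟩, w', hm _ hw', hwA'⟩)
    · push Not at hv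
      rcases hw with hw | hw
      · exact Or.inl (Or.inl ⟨⟨w, hw, hwA⟩, v, hv1, hv⟩)
      · exact Or.inr (Or.inl ⟨⟨w, hm _ hw, hwA⟩, v, hv2, hv⟩)

end LoopMass

/-! ### From sums over cycles to closed path sums. -/

section ListSum

variable {V : Type*} {q : V → V → ℝ≥0∞}

open Classical in
/-- Bounding the mass of a set of loops by closed path sums of given lengths. -/
lemma tsum_cycleWeight_le {L : Set (List V)} (E : ℕ → Set (List V)) (hL : [] ∉ L)
    (hE : ∀ v t, v :: t ∈ L → v :: (t ++ [v]) ∈ E (t.length + 1)) :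
    ∑' l : List V, (l.length : ℝ≥0∞)⁻¹ * (if l ∈ L then cycleWeight q l else 0) ≤
      ∑' N : ℕ, (N : ℝ≥0∞)⁻¹ * closedSum q N (E N) := by
  let F : V → List V → ℝ≥0∞ := fun v s => (s.length : ℝ≥0∞)⁻¹ *
    ({l : List V | l.getLastD v = v}.indicator 1 s * (E s.length).indicator 1 (v :: s))
  rw [tsum_list_eq, if_neg hL, mul_zero, zero_add]
  have h1 : ∀ v, ∑' t : List V, ((v :: t).length : ℝ≥0∞)⁻¹ *
      (if v :: t ∈ L then cycleWeight q (v :: t) else 0) ≤ ∑' s, pathWeight q v s * F v s := by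
    intro v
    have hinj : Function.Injective (fun t : List V => t ++ [v]) := List.append_left_injective [v]
    refine le_trans (ENNReal.tsum_le_tsum fun t => ?_)
      (ENNReal.tsum_comp_le_tsum_of_injective hinj fun s => pathWeight q v s * F v s)
    by_cases h : v :: t ∈ L
    · have h2 : t ++ [v] ∈ {l : List V | l.getLastD v = v} := by
        change (t ++ [v]).getLastD v = v
        rw [getLastD_append]; rfl
      have h3 : v :: (t ++ [v]) ∈ E (t ++ [v]).length := by simpa using hE v t h
      simp only [F]
      rw [if_pos h, cycleWeight_cons, Set.indicator_of_mem h2, Set.indicator_of_mem h3, mul_comm]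
      simp
    · rw [if_neg h, mul_zero]
      exact zero_le
  refine (ENNReal.tsum_le_tsum h1).trans ?_
  simp_rw [tsum_pathWeight_mul]
  rw [ENNReal.tsum_comm]
  refine ENNReal.tsum_le_tsum fun N => ?_
  rw [closedSum, ← ENNReal.tsum_mul_left]
  refine ENNReal.tsum_le_tsum fun v => ?_
  rw [mul_comm, ← pathSum_mul_right, pathSum_eq_tsum, pathSum_eq_tsum]
  refine ENNReal.tsum_le_tsum fun s => ?_
  split_ifs with h
  · simp only [F, h]
    rw [mul_comm ((N : ℝ≥0∞)⁻¹)]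
  · exact le_rfl

lemma closedSum_empty (N : ℕ) : closedSum q N ∅ = 0 := by
  rw [closedSum, ENNReal.tsum_eq_zero]
  intro v
  rw [pathSum_eq_tsum, ENNReal.tsum_eq_zero]
  intro s
  simp

end ListSum

/-! ### The scale-invariant bound on the mass of big loops. -/

section LoopMass

/-- Telescoping, with `4` instead of the optimal order-two constant to absorb the crude comparison
`√(m+1) ≤ 1.5 * √m`. -/
lemma sum_inv_mul_sqrt_le (K n : ℕ) (hK : 1 ≤ K) :
    ∑ j ∈ Finset.range n, 1 / (((K + j : ℕ) : ℝ) * √(K + j : ℕ)) ≤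
      4 / √K - 4 / √(K + n : ℕ) := by
  induction n with
  | zero => simp
  | succ n ih =>
    rw [Finset.sum_range_succ]
    have hm : 1 ≤ K + n := by omega
    have key : ∀ m : ℕ, 1 ≤ m → 1 / ((m : ℝ) * √m) ≤ 4 / √m - 4 / √(m + 1 : ℕ) := by
      intro m hm
      have hm' : (1 : ℝ) ≤ m := by exact_mod_cast hm
      set a := √(m : ℝ) with ha
      set b := √((m + 1 : ℕ) : ℝ) with hb
      have ha0 : 0 < a := Real.sqrt_pos.2 (by linarith)
      have hb0 : 0 < b := Real.sqrt_pos.2 (by positivity)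
      have ha2 : a ^ 2 = m := Real.sq_sqrt (by linarith)
      have hb2 : b ^ 2 = m + 1 := by rw [hb, Real.sq_sqrt (by positivity)]; push_cast; rfl
      have hab : a ≤ b := Real.sqrt_le_sqrt (by push_cast; linarith)
      have hb15 : b ≤ 1.5 * a := by
        refine le_of_sq_le_sq ?_ (by positivity)
        nlinarith
      rw [← ha2, div_sub_div _ _ ha0.ne' hb0.ne', div_le_div_iff₀ (by positivity) (by positivity)]
      have h1 : (b - a) * (b + a) = 1 := by nlinarith
      have h3 : b * (b + a) ≤ 4 * a ^ 2 := by nlinarith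
      have h4 : b ≤ 4 * a ^ 2 * (b - a) := by
        have : b * (b + a) * (b - a) ≤ 4 * a ^ 2 * (b - a) :=
          mul_le_mul_of_nonneg_right h3 (by linarith)
        nlinarith
      nlinarith
    have := key (K + n) hm
    have e : K + (n + 1) = K + n + 1 := by ring
    rw [e]
    linarith

variable {d : ℕ}

/-- The loops that visit the ball of radius `M` around `y`, and are either of length at least
`M ^ 2` or visit the complement of the ball of radius `9 * M`. -/
def bigLoops (y : Fin d → ℤ) (M : ℕ) : Set (DiscreteLoop (Fin d → ℤ)) :=
  {ℓ | (∃ w ∈ ℓ.1, normOne (w - y) ≤ M) ∧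
    (M ^ 2 ≤ ℓ.1.length ∨ ∃ w ∈ ℓ.1, 9 * (M : ℤ) < normOne (w - y))}

lemma killedStep_zero : killedStep (latticeGraph d) 0 = latticeStep d := by
  funext a b
  simp [killedStep, latticeStep]

/-- The mass of the big loops is bounded uniformly in the scale. -/
lemma exists_loopMeasure_bigLoops_le (hd : 3 ≤ d) : ∃ C : ℝ, 0 < C ∧ ∀ M : ℕ, 1 ≤ M →
    ∀ y : Fin d → ℤ, loopMeasure (latticeGraph d) 0 (bigLoops y M) ≤ ENNReal.ofReal C := by
  classical
  obtain ⟨C₁, hC₁, h₁⟩ := exists_closedSum_visits_le hd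
  obtain ⟨C₂, hC₂, h₂⟩ := exists_closedSum_crosses_le (d := d) (by omega)
  refine ⟨C₂ + C₁ * 4, by positivity, fun M hM y => ?_⟩
  have hM0 : (0 : ℝ) < M := by exact_mod_cast hM
  -- A big loop of length below `M²` must cross the annulus; for longer ones visiting the ball is
  -- the only constraint used. The two ranges of `N` give `∑ 1 / M²` and `M * ∑ N ^ (-3/2)`, both of
  -- order one.
  let E : ℕ → Set (List (Fin d → ℤ)) := fun N => if N < 2 then ∅ else
    if M ^ 2 ≤ N then visits {w | (normOne (w - y) : ℝ) ≤ M} else crosses y M (9 * M)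
  rw [loopMeasure_eq_tsum_list (by norm_num), killedStep_zero]
  refine (tsum_cycleWeight_le E ?_ ?_).trans ?_
  · rintro ⟨⟨h, -⟩, -⟩
    simp at h
  · rintro v t ⟨⟨hlen, hch⟩, ⟨w, hw, hwM⟩, hbig⟩
    have hlen' : ¬ t.length + 1 < 2 := not_lt.2 hlen
    have hw' : w ∈ v :: (t ++ [v]) := by
      rw [← List.cons_append]
      exact List.mem_append_left _ (Cycle.mem_coe_iff.1 hw)
    have hvis : v :: (t ++ [v]) ∈ visits {w | (normOne (w - y) : ℝ) ≤ M} :=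
      ⟨w, hw', by exact_mod_cast hwM⟩
    simp only [E, if_neg hlen']
    split_ifs with h
    · exact hvis
    · rcases hbig with hbig | ⟨u, hu, huM⟩
      · exact absurd hbig h
      · refine ⟨hvis, u, ?_, by exact_mod_cast huM⟩
        rw [← List.cons_append]
        exact List.mem_append_left _ (Cycle.mem_coe_iff.1 hu)
  · have hsplit : ∀ N : ℕ, (N : ℝ≥0∞)⁻¹ * closedSum (latticeStep d) N (E N) ≤
        (if N < M ^ 2 then ENNReal.ofReal (C₂ / M ^ 2) else 0) +
        (if M ^ 2 ≤ N then ENNReal.ofReal (C₁ * M * (1 / (N * √N))) else 0) := by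
      intro N
      by_cases hN : N < 2
      · simp only [E, if_pos hN, closedSum_empty, mul_zero]
        exact zero_le
      have hN0 : (0 : ℝ) < N := by exact_mod_cast (by omega : 0 < N)
      have hsN : (0 : ℝ) < √N := Real.sqrt_pos.2 hN0
      have hinv : (N : ℝ≥0∞)⁻¹ = ENNReal.ofReal ((N : ℝ)⁻¹) := by
        rw [ENNReal.ofReal_inv_of_pos hN0, ENNReal.ofReal_natCast]
      by_cases h : M ^ 2 ≤ N
      · simp only [E, if_neg hN, if_pos h, if_neg (not_lt.2 h), zero_add]
        refine (mul_le_mul' le_rfl (h₁ M N hM (by omega) h y)).trans ?_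
        rw [hinv, ← ENNReal.ofReal_mul (by positivity)]
        refine ENNReal.ofReal_le_ofReal (le_of_eq ?_)
        field_simp
      · simp only [E, if_neg hN, if_neg h, if_pos (not_le.1 h), add_zero]
        refine (mul_le_mul' le_rfl (h₂ M N hM (by omega) y)).trans ?_
        rw [hinv, ← ENNReal.ofReal_mul (by positivity)]
        refine ENNReal.ofReal_le_ofReal (le_of_eq ?_)
        field_simp
    refine (ENNReal.tsum_le_tsum hsplit).trans ?_
    rw [ENNReal.tsum_add, ENNReal.ofReal_add hC₂.le (by positivity)]
    refine add_le_add ?_ ?_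
    · rw [tsum_eq_sum (s := Finset.range (M ^ 2)) fun N hN => if_neg (by simpa using hN)]
      rw [Finset.sum_congr rfl fun N hN => if_pos (Finset.mem_range.1 hN), Finset.sum_const,
        Finset.card_range, nsmul_eq_mul, ← ENNReal.ofReal_natCast,
        ← ENNReal.ofReal_mul (by positivity)]
      refine ENNReal.ofReal_le_ofReal (le_of_eq ?_)
      push_cast
      field_simp
    · have hshift : ∑' N : ℕ, (if M ^ 2 ≤ N then ENNReal.ofReal (C₁ * M * (1 / (N * √N))) else 0) =
          ∑' j : ℕ, ENNReal.ofReal (C₁ * M * (1 / (((M ^ 2 + j : ℕ) : ℝ) * √(M ^ 2 + j : ℕ)))) := by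
        rw [← (add_right_injective (M ^ 2)).tsum_eq]
        · simp
        · intro N hN
          have : M ^ 2 ≤ N := by
            by_contra h
            simp [h] at hN
          exact ⟨N - M ^ 2, by simp; omega⟩
      rw [hshift]
      refine ENNReal.tsum_le_of_sum_range_le fun n => ?_
      rw [← ENNReal.ofReal_sum_of_nonneg fun _ _ => by positivity, ← Finset.mul_sum]
      refine ENNReal.ofReal_le_ofReal ?_
      have h := sum_inv_mul_sqrt_le (M ^ 2) n (Nat.one_le_pow _ _ hM)
      have h3 : 0 ≤ 4 / √((M ^ 2 + n : ℕ) : ℝ) := by positivity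
      have h4 : √((M ^ 2 : ℕ) : ℝ) = M := by
        push_cast
        exact Real.sqrt_sq hM0.le
      rw [h4] at h
      calc C₁ * M * ∑ j ∈ Finset.range n, 1 / (((M ^ 2 + j : ℕ) : ℝ) * √(M ^ 2 + j : ℕ))
          ≤ C₁ * M * (4 / M) := by
            gcongr
            linarith
        _ = C₁ * 4 := by field_simp

end LoopMass

/-! ### Measurability of connection events, and insensitivity to finitely many loops. -/

section Events

variable {V : Type*} {G : SimpleGraph V}

lemma openGraph_mono {N N' : DiscreteLoop V → ℕ} (h : N ≤ N') : openGraph G N ≤ openGraph G N' :=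
  fun _ _ ⟨h1, ℓ, h2, h3⟩ => ⟨h1, ℓ, h2.trans_le (h ℓ), h3⟩

lemma indicator_loops_le (S : Set (DiscreteLoop V)) (N : DiscreteLoop V → ℕ) : S.indicator N ≤ N :=
  Set.indicator_le_self S N

lemma DiscreteLoop.Traverses.left_mem {ℓ : DiscreteLoop V} {x y : V} (h : ℓ.Traverses x y) :
    x ∈ ℓ.1 := by
  obtain ⟨t, h | h⟩ := h <;> rw [h] <;> simp

lemma measurableSet_adj [Countable V] (x y : V) :
    MeasurableSet {N : DiscreteLoop V → ℕ | (openGraph G N).Adj x y} := by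
  have : {N : DiscreteLoop V → ℕ | (openGraph G N).Adj x y} =
      ⋃ (ℓ : DiscreteLoop V) (_ : G.Adj x y ∧ ℓ.Traverses x y), {N | 0 < N ℓ} := by
    ext N
    simp only [Set.mem_ofPred_eq, Set.mem_iUnion, exists_prop]
    constructor
    · rintro ⟨h1, ℓ, h2, h3⟩
      exact ⟨ℓ, ⟨h1, h3⟩, h2⟩
    · rintro ⟨ℓ, ⟨h1, h3⟩, h2⟩
      exact ⟨h1, ℓ, h2, h3⟩
  rw [this]
  exact MeasurableSet.iUnion fun ℓ => MeasurableSet.iUnion fun _ =>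
    measurableSet_lt measurable_const (measurable_pi_apply ℓ)

/-- Presents reachability as a countable union over vertex lists, for measurability. -/
lemma reachable_iff_exists_list {H : SimpleGraph V} {x y : V} :
    H.Reachable x y ↔ ∃ l : List V, List.IsChain H.Adj (x :: l) ∧ l.getLastD x = y := by
  constructor
  · rintro ⟨p⟩
    induction p with
    | nil => exact ⟨[], by simp, rfl⟩
    | @cons u v w h p ih =>
      obtain ⟨l, h1, h2⟩ := ih
      exact ⟨v :: l, List.isChain_cons_cons.2 ⟨h, h1⟩, by rw [List.getLastD_cons, h2]⟩
  · rintro ⟨l, h1, h2⟩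
    induction l generalizing x with
    | nil => rw [← h2]; rfl
    | cons a l ih =>
      rw [List.isChain_cons_cons] at h1
      exact h1.1.reachable.trans (ih h1.2 (by rwa [List.getLastD_cons] at h2))

lemma measurableSet_reachable [Countable V] (x y : V) :
    MeasurableSet {N : DiscreteLoop V → ℕ | (openGraph G N).Reachable x y} := by
  have hchain : ∀ (l : List V) (x : V),
      MeasurableSet {N : DiscreteLoop V → ℕ | List.IsChain (openGraph G N).Adj (x :: l)} := by
    intro l
    induction l with
    | nil => intro x; simp
    | cons a l ih =>
      intro x
      simp only [List.isChain_cons_cons]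
      exact (measurableSet_adj x a).inter (ih a)
  have : {N : DiscreteLoop V → ℕ | (openGraph G N).Reachable x y} =
      ⋃ (l : List V) (_ : l.getLastD x = y), {N | List.IsChain (openGraph G N).Adj (x :: l)} := by
    ext N
    simp only [Set.mem_ofPred_eq, Set.mem_iUnion, exists_prop, reachable_iff_exists_list,
      and_comm]
  rw [this]
  exact MeasurableSet.iUnion fun l => MeasurableSet.iUnion fun _ => hchain l x

/-- The event that there is an infinite open cluster. -/
def infiniteClusterEvent (G : SimpleGraph V) : Set (DiscreteLoop V → ℕ) :=
  {N | ∃ x, (openCluster G N x).Infinite}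

lemma measurableSet_infiniteClusterEvent [Countable V] :
    MeasurableSet (infiniteClusterEvent G) := by
  have : infiniteClusterEvent G = ⋃ x : V, ⋂ F : Finset V, ⋃ (y : V) (_ : y ∉ F),
      {N : DiscreteLoop V → ℕ | (openGraph G N).Reachable x y} := by
    ext N
    simp only [infiniteClusterEvent, Set.mem_ofPred_eq, Set.mem_iUnion, Set.mem_iInter, exists_prop]
    refine exists_congr fun x => ?_
    constructor
    · intro h F
      obtain ⟨y, hy, hyF⟩ := h.exists_notMem_finset F
      exact ⟨y, hyF, hy⟩
    · intro h hfin
      obtain ⟨y, hy, hxy⟩ := h hfin.toFinset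
      exact hy (hfin.mem_toFinset.2 hxy)
  rw [this]
  exact MeasurableSet.iUnion fun x => MeasurableSet.iInter fun F => MeasurableSet.iUnion fun y =>
    MeasurableSet.iUnion fun _ => measurableSet_reachable x y

/-- Removing finitely many loops does not change the existence of an infinite cluster. -/
lemma indicator_compl_mem_infiniteClusterEvent (N : DiscreteLoop V → ℕ)
    {F : Set (DiscreteLoop V)} (hF : F.Finite) :
    Fᶜ.indicator N ∈ infiniteClusterEvent G ↔ N ∈ infiniteClusterEvent G := by
  constructor
  · rintro ⟨x, hx⟩
    exact ⟨x, hx.mono fun y hy => SimpleGraph.Reachable.mono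
      (openGraph_mono (indicator_loops_le _ _)) hy⟩
  · rintro ⟨x, hx⟩
    by_contra hcon
    have hfin : ∀ z, (openCluster G (Fᶜ.indicator N) z).Finite := by
      intro z
      by_contra h
      exact hcon ⟨z, h⟩
    -- Every vertex of the original cluster lies in the thinned cluster of `x` or of a vertex on a
    -- removed loop. There are finitely many such vertices, and all thinned clusters are assumed
    -- finite.
    let U : Set V := ⋃ ℓ ∈ F, {v | v ∈ ℓ.1}
    have hU : U.Finite := by
      refine hF.biUnion fun ℓ _ => ?_
      obtain ⟨⟨l⟩, hl⟩ := ℓ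
      exact l.finite_toSet
    refine hx (((hfin x).union (hU.biUnion fun u _ => hfin u)).subset ?_)
    intro y hy
    have hy : (openGraph G N).Reachable x y := hy
    obtain ⟨p⟩ := hy.symm
    induction p with
    | nil => exact Or.inl (SimpleGraph.Reachable.refl _)
    | @cons u v w h p ih =>
      obtain ⟨h1, ℓ, h2, h3⟩ := h
      by_cases hℓ : ℓ ∈ F
      · exact Or.inr (Set.mem_biUnion (Set.mem_biUnion hℓ h3.left_mem)
          (SimpleGraph.Reachable.refl _))
      · have hadj : (openGraph G (Fᶜ.indicator N)).Adj v u := by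
          refine SimpleGraph.Adj.symm ⟨h1, ℓ, ?_, h3⟩
          rwa [Set.indicator_of_mem (show ℓ ∈ Fᶜ from hℓ)]
        rcases ih hx p.reachable.symm p.reachable.symm with h | h
        · exact Or.inl (SimpleGraph.Reachable.trans h hadj.reachable)
        · obtain ⟨z, hz, hzv⟩ := Set.mem_iUnion₂.1 h
          exact Or.inr (Set.mem_biUnion hz (SimpleGraph.Reachable.trans hzv hadj.reachable))

end Events

/-! ### Independence over disjoint sets of loops, and the zero-one law. -/

section Independence

variable {V : Type*} {G : SimpleGraph V} [G.LocallyFinite]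

/-- The σ-algebra generated by the multiplicity of the loop `ℓ`. -/
abbrev loopSigma (ℓ : DiscreteLoop V) : MeasurableSpace (DiscreteLoop V → ℕ) :=
  MeasurableSpace.comap (fun N => N ℓ) inferInstance

lemma loopSigma_le (ℓ : DiscreteLoop V) : loopSigma ℓ ≤ MeasurableSpace.pi :=
  (measurable_pi_apply ℓ).comap_le

lemma iIndep_loopSigma (α : ℝ≥0) (κ : ℝ) :
    iIndep (loopSigma (V := V)) (loopEnsemble G α κ) := by
  have := iIndepFun_infinitePi (P := fun ℓ : DiscreteLoop V =>
    poissonMeasure (α * (loopMeasure G κ {ℓ}).toNNReal)) (X := fun _ n => n)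
    (fun _ => measurable_id)
  exact this

lemma measurableSet_indicator {A : Set (DiscreteLoop V → ℕ)} (hA : MeasurableSet A)
    (S : Set (DiscreteLoop V)) :
    MeasurableSet[⨆ ℓ ∈ S, loopSigma ℓ] {N | S.indicator N ∈ A} := by
  have : Measurable[⨆ ℓ ∈ S, loopSigma ℓ] (fun N : DiscreteLoop V → ℕ => S.indicator N) := by
    refine @measurable_pi_lambda _ _ _ (⨆ ℓ ∈ S, loopSigma ℓ) _ _ fun ℓ => ?_
    by_cases h : ℓ ∈ S
    · have e : (fun N : DiscreteLoop V → ℕ => S.indicator N ℓ) = fun N => N ℓ := by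
        funext N
        exact Set.indicator_of_mem h N
      rw [e]
      exact (comap_measurable (fun N : DiscreteLoop V → ℕ => N ℓ)).mono
        (le_iSup₂ (f := fun ℓ (_ : ℓ ∈ S) => loopSigma ℓ) ℓ h) le_rfl
    · have e : (fun N : DiscreteLoop V → ℕ => S.indicator N ℓ) = fun _ => 0 := by
        funext N
        exact Set.indicator_of_notMem h N
      rw [e]
      exact measurable_const
  exact this hA

/-- Events depending on disjoint sets of loops are independent. -/
lemma loopEnsemble_inter_eq_mul (α : ℝ≥0) (κ : ℝ) {S T : Set (DiscreteLoop V)} (hST : Disjoint S T)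
    {A B : Set (DiscreteLoop V → ℕ)} (hA : MeasurableSet A) (hB : MeasurableSet B) :
    loopEnsemble G α κ ({N | S.indicator N ∈ A} ∩ {N | T.indicator N ∈ B}) =
      loopEnsemble G α κ {N | S.indicator N ∈ A} * loopEnsemble G α κ {N | T.indicator N ∈ B} :=
  (Indep_iff _ _ _).1 (indep_iSup_of_disjoint loopSigma_le (iIndep_loopSigma α κ) hST) _ _
    (measurableSet_indicator hA S) (measurableSet_indicator hB T)

/-- Kolmogorov's zero-one law over the independent loop multiplicities: by finite insensitivity the
event belongs to the tail σ-algebra. No translation invariance is needed. -/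
lemma loopEnsemble_infiniteClusterEvent_zero_or_one [Countable V] (α : ℝ≥0) (κ : ℝ) :
    loopEnsemble G α κ (infiniteClusterEvent G) = 0 ∨
      loopEnsemble G α κ (infiniteClusterEvent G) = 1 := by
  refine measure_zero_or_one_of_measurableSet_limsup (s := loopSigma) (f := Filter.cofinite)
    (p := fun S : Set (DiscreteLoop V) => S.Finite) (ns := fun F : Finset (DiscreteLoop V) => ↑F)
    loopSigma_le (iIndep_loopSigma α κ) ?_ ?_ ?_ ?_ ?_
  · intro F hF
    exact hF.compl_mem_cofinite
  · classical
    intro F F'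
    exact ⟨F ∪ F', by simp, by simp⟩
  · intro F
    exact F.finite_toSet
  · intro ℓ
    exact ⟨{ℓ}, by simp⟩
  · rw [Filter.limsup_eq_iInf_iSup, MeasurableSpace.measurableSet_iInf]
    intro S
    rw [MeasurableSpace.measurableSet_iInf]
    intro hS
    have hfin : Sᶜ.Finite := Filter.mem_cofinite.1 hS
    have : infiniteClusterEvent G = {N | S.indicator N ∈ infiniteClusterEvent G} := by
      ext N
      have := indicator_compl_mem_infiniteClusterEvent (G := G) N hfin
      rw [compl_compl] at this
      exact this.symm
    rw [this]
    exact measurableSet_indicator measurableSet_infiniteClusterEvent S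

lemma poissonMeasure_pos_le (r : ℝ≥0) : poissonMeasure r {n | 0 < n} ≤ r := by
  have h : {n : ℕ | 0 < n} = {0}ᶜ := by
    ext n; simp [Nat.pos_iff_ne_zero]
  rw [h, prob_compl_eq_one_sub (measurableSet_singleton 0), poissonMeasure_singleton]
  simp only [pow_zero, mul_one, Nat.factorial_zero, Nat.cast_one, div_one]
  rw [← ENNReal.ofReal_one, ← ENNReal.ofReal_sub _ (Real.exp_pos _).le, ← ENNReal.ofReal_coe_nnreal]
  refine ENNReal.ofReal_le_ofReal ?_
  have := Real.add_one_le_exp (-(r : ℝ))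
  linarith

/-- The probability that some loop of `S` is present is at most its intensity. -/
lemma loopEnsemble_exists_le [Countable V] (α : ℝ≥0) (κ : ℝ) (S : Set (DiscreteLoop V)) :
    loopEnsemble G α κ {N | ∃ ℓ ∈ S, 0 < N ℓ} ≤ α * loopMeasure G κ S := by
  have h1 : {N : DiscreteLoop V → ℕ | ∃ ℓ ∈ S, 0 < N ℓ} = ⋃ ℓ : S, {N | 0 < N ℓ.1} := by
    ext N; simp
  rw [h1, loopMeasure_eq_tsum_singleton, ← ENNReal.tsum_mul_left]
  refine (measure_iUnion_le _).trans (ENNReal.tsum_le_tsum fun ℓ => ?_)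
  have h2 : loopEnsemble G α κ {N | 0 < N ℓ.1} =
      poissonMeasure (α * (loopMeasure G κ {ℓ.1}).toNNReal) {n | 0 < n} := by
    rw [← Measure.infinitePi_map_eval
      (fun ℓ : DiscreteLoop V => poissonMeasure (α * (loopMeasure G κ {ℓ}).toNNReal)) ℓ.1,
      Measure.map_apply (measurable_pi_apply _) MeasurableSet.of_discrete]
    rfl
  rw [h2]
  refine (poissonMeasure_pos_le _).trans ?_
  rw [ENNReal.coe_mul]
  exact mul_le_mul' le_rfl ENNReal.coe_toNNReal_le_self

end Independence

/-! ### The multiscale recursion and the critical parameters. -/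

section Renormalization

variable {d : ℕ}

/-- The event that an open cluster joins the ball of radius `L` around `y` to the complement of
the ball of radius `2 * L`. -/
def farConnected (y : Fin d → ℤ) (L : ℕ) : Set (DiscreteLoop (Fin d → ℤ) → ℕ) :=
  {N | ∃ a b, normOne (a - y) ≤ L ∧ 2 * (L : ℤ) < normOne (b - y) ∧
    (openGraph (latticeGraph d) N).Reachable a b}

/-- The loops contained in the ball of radius `18 * L` around `y`. -/
def localLoops (y : Fin d → ℤ) (L : ℕ) : Set (DiscreteLoop (Fin d → ℤ)) :=
  {ℓ | ∀ w ∈ ℓ.1, normOne (w - y) ≤ 18 * (L : ℤ)}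

/-- The event that the loops contained in the ball of radius `18 * L` around `y` join the ball of
radius `L` to the complement of the ball of radius `2 * L`. -/
def localConnected (y : Fin d → ℤ) (L : ℕ) : Set (DiscreteLoop (Fin d → ℤ) → ℕ) :=
  {N | (localLoops y L).indicator N ∈ farConnected y L}

/-- The event that a big loop is present. -/
def bigLoopEvent (y : Fin d → ℤ) (M : ℕ) : Set (DiscreteLoop (Fin d → ℤ) → ℕ) :=
  {N | ∃ ℓ ∈ bigLoops y M, 0 < N ℓ}

lemma measurableSet_farConnected (y : Fin d → ℤ) (L : ℕ) : MeasurableSet (farConnected y L) := by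
  have : farConnected y L = ⋃ (a : Fin d → ℤ) (b : Fin d → ℤ)
      (_ : normOne (a - y) ≤ L ∧ 2 * (L : ℤ) < normOne (b - y)),
      {N | (openGraph (latticeGraph d) N).Reachable a b} := by
    ext N
    simp only [farConnected, Set.mem_ofPred_eq, Set.mem_iUnion, exists_prop, and_assoc]
  rw [this]
  exact MeasurableSet.iUnion fun a => MeasurableSet.iUnion fun b => MeasurableSet.iUnion fun _ =>
    measurableSet_reachable a b

lemma localConnected_subset (y : Fin d → ℤ) (L : ℕ) : localConnected y L ⊆ farConnected y L := by
  rintro N ⟨a, b, ha, hb, hab⟩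
  exact ⟨a, b, ha, hb, hab.mono (openGraph_mono (indicator_loops_le _ _))⟩

/-- Follow the path until it first leaves the ball of radius `2L`. Each edge used starts in that
ball, so a loop opening it that is not local goes beyond `18L = 9 * (2L)`, and is big at scale `2L`.
-/
lemma farConnected_subset (y : Fin d → ℤ) (L : ℕ) :
    farConnected y L ⊆ localConnected y L ∪ bigLoopEvent y (2 * L) := by
  rintro N ⟨a, b, ha, hb, ⟨p⟩⟩
  by_cases hbig : N ∈ bigLoopEvent y (2 * L)
  · exact Or.inr hbig
  left
  have key : normOne (a - y) ≤ 2 * (L : ℤ) → ∃ b', 2 * (L : ℤ) < normOne (b' - y) ∧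
      (openGraph (latticeGraph d) ((localLoops y L).indicator N)).Reachable a b' := by
    clear ha
    induction p with
    | nil => intro h; exact absurd h (not_le.2 hb)
    | @cons u v w h p ih =>
      intro hu
      obtain ⟨h1, ℓ, h2, h3⟩ := h
      have hℓ : ℓ ∈ localLoops y L := by
        intro z hz
        by_contra hcon
        push Not at hcon
        refine hbig ⟨ℓ, ⟨⟨u, h3.left_mem, by push_cast; exact hu⟩, Or.inr ⟨z, hz, ?_⟩⟩, h2⟩
        push_cast
        linarith
      have hadj : (openGraph (latticeGraph d) ((localLoops y L).indicator N)).Adj u v :=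
        ⟨h1, ℓ, by rwa [Set.indicator_of_mem hℓ], h3⟩
      by_cases hv : normOne (v - y) ≤ 2 * (L : ℤ)
      · obtain ⟨b', hb', hvb⟩ := ih hb hv
        exact ⟨b', hb', hadj.reachable.trans hvb⟩
      · exact ⟨v, not_le.1 hv, hadj.reachable⟩
  have hL : (0 : ℤ) ≤ L := Int.natCast_nonneg L
  obtain ⟨b', hb', hab⟩ := key (by linarith)
  exact ⟨a, b', ha, hb', hab⟩

lemma abs_normOne_sub_le_of_adj {u v : Fin d → ℤ} (h : (latticeGraph d).Adj u v) (y : Fin d → ℤ) :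
    normOne (v - y) ≤ normOne (u - y) + 1 := by
  have h1 : normOne (v - u) = 1 := by
    rw [normOne_sub_comm]
    exact h
  have := normOne_sub_le v u y
  omega

/-- A discrete intermediate value property: a step increases the norm by at most one. -/
lemma exists_reachable_normOne_eq {H : SimpleGraph (Fin d → ℤ)} (hH : H ≤ latticeGraph d)
    (y : Fin d → ℤ) {k : ℤ} {a b : Fin d → ℤ} (ha : normOne (a - y) ≤ k) (hb : k ≤ normOne (b - y))
    (hab : H.Reachable a b) : ∃ c, H.Reachable a c ∧ normOne (c - y) = k := by
  obtain ⟨p⟩ := hab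
  induction p with
  | nil => exact ⟨_, SimpleGraph.Reachable.refl _, le_antisymm ha hb⟩
  | @cons u v w h p ih =>
    rcases ha.lt_or_eq with h' | h'
    · have := abs_normOne_sub_le_of_adj (hH h) y
      obtain ⟨c, hc, hck⟩ := ih (by omega) hb
      exact ⟨c, h.reachable.trans hc, hck⟩
    · exact ⟨u, SimpleGraph.Reachable.refl _, h'⟩

lemma finite_setOf_normOne_le (R : ℤ) : {u : Fin d → ℤ | normOne u ≤ R}.Finite := by
  refine (Set.finite_Icc (fun _ => -R) (fun _ => R)).subset fun u hu => ?_
  have h : ∀ i, |u i| ≤ R := fun i =>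
    (Finset.single_le_sum (f := fun i => |u i|) (fun j _ => abs_nonneg _) (Finset.mem_univ i)).trans
      hu
  exact ⟨fun i => (abs_le.1 (h i)).1, fun i => (abs_le.1 (h i)).2⟩

/-- The offsets, in units of the mesh, of the net used in the renormalization. -/
def netOffsets (d : ℕ) : Finset (Fin d → ℤ) :=
  (finite_setOf_normOne_le (d := d) (81 * d)).toFinset

lemma mem_netOffsets {u : Fin d → ℤ} : u ∈ netOffsets d ↔ normOne u ≤ 81 * d :=
  Set.Finite.mem_toFinset _

lemma normOne_smul (k : ℤ) (u : Fin d → ℤ) : normOne (k • u) = |k| * normOne u := by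
  simp [normOne, abs_mul, Finset.mul_sum]

/-- Every point of the ball of radius `80 * d * k` is within distance `d * k` of the net. -/
lemma exists_net_near (y c : Fin d → ℤ) {k : ℕ} (hk : 1 ≤ k)
    (hc : normOne (c - y) ≤ 80 * ((d * k : ℕ) : ℤ)) :
    ∃ u ∈ netOffsets d, normOne (c - (y + (k : ℤ) • u)) ≤ (d * k : ℕ) := by
  have hk0 : (0 : ℤ) < k := by exact_mod_cast hk
  -- Rounding down in units of `k` leaves a remainder in `[0, k)` in each coordinate, hence an `ℓ¹`
  -- error of at most `d * k`.
  let u : Fin d → ℤ := fun i => (c i - y i) / k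
  have h1 : normOne (c - (y + (k : ℤ) • u)) ≤ (d * k : ℕ) := by
    have : ∀ i, |(c - (y + (k : ℤ) • u)) i| ≤ k := by
      intro i
      have e : (c - (y + (k : ℤ) • u)) i = (c i - y i) % k := by
        simp only [Pi.sub_apply, Pi.add_apply, Pi.smul_apply, smul_eq_mul, u]
        rw [Int.emod_def]
        ring
      rw [e, abs_of_nonneg (Int.emod_nonneg _ hk0.ne')]
      exact (Int.emod_lt_of_pos _ hk0).le
    refine (Finset.sum_le_sum fun i _ => this i).trans_eq ?_
    simp
  refine ⟨u, mem_netOffsets.2 ?_, h1⟩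
  have h2 : normOne ((k : ℤ) • u) ≤ 81 * ((d * k : ℕ) : ℤ) := by
    have e : (k : ℤ) • u = (c - y) + -(c - (y + (k : ℤ) • u)) := by abel
    have := normOne_add_le (c - y) (-(c - (y + (k : ℤ) • u)))
    rw [← e, normOne_neg] at this
    linarith
  rw [normOne_smul, abs_of_pos hk0] at h2
  push_cast at h2
  refine le_of_mul_le_mul_left ?_ hk0
  linarith

/-- A connection at scale `40 * L` forces two distant local connections at scale `L`, or a big
loop. -/
lemma farConnected_step (y : Fin d → ℤ) {k : ℕ} (hk : 1 ≤ k) (hd : 1 ≤ d) :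
    farConnected y (40 * (d * k)) ⊆
      (⋃ u ∈ netOffsets d, bigLoopEvent (y + (k : ℤ) • u) (2 * (d * k))) ∪
      ⋃ u ∈ netOffsets d, ⋃ v ∈ netOffsets d,
        ⋃ (_ : 36 * ((d * k : ℕ) : ℤ) < normOne ((y + (k : ℤ) • u) - (y + (k : ℤ) • v))),
        localConnected (y + (k : ℤ) • u) (d * k) ∩ localConnected (y + (k : ℤ) • v) (d * k) := by
  rintro N ⟨a, b, ha, hb, hab⟩
  set L := d * k with hL
  have hL0 : (0 : ℤ) < (L : ℤ) := by
    have : 0 < L := Nat.mul_pos hd hk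
    exact_mod_cast this
  push_cast at ha hb
  obtain ⟨c, hac, hc⟩ := exists_reachable_normOne_eq (H := openGraph (latticeGraph d) N)
    (fun _ _ h => h.1) y (k := 80 * (L : ℤ)) (by linarith) (by linarith) hab
  obtain ⟨u, hu, hau⟩ := exists_net_near y a hk (by rw [← hL]; linarith)
  obtain ⟨v, hv, hcv⟩ := exists_net_near y c hk (by rw [← hL]; linarith)
  rw [← hL] at hau hcv
  -- The net points lie within `L` of `a` and of `c`. Each therefore has the other endpoint at
  -- distance at least `39L > 2L`, and they are at least `38L > 36L` apart, which makes the balls of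
  -- radius `18L` disjoint.
  have hca : 40 * (L : ℤ) ≤ normOne (c - a) := by
    have := normOne_sub_le c a y
    linarith
  have hfar_u : N ∈ farConnected (y + (k : ℤ) • u) L := by
    refine ⟨a, c, hau, ?_, hac⟩
    have h1 := normOne_sub_le c (y + (k : ℤ) • u) a
    have h2 := normOne_sub_comm (y + (k : ℤ) • u) a
    linarith
  have hfar_v : N ∈ farConnected (y + (k : ℤ) • v) L := by
    refine ⟨c, a, hcv, ?_, hac.symm⟩
    have h1 := normOne_sub_le a (y + (k : ℤ) • v) c
    have h2 := normOne_sub_comm (y + (k : ℤ) • v) c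
    have h3 := normOne_sub_comm a c
    linarith
  rcases farConnected_subset _ _ hfar_u with hlu | hbu
  · rcases farConnected_subset _ _ hfar_v with hlv | hbv
    · right
      simp only [Set.mem_iUnion]
      refine ⟨u, hu, v, hv, ?_, hlu, hlv⟩
      have h1 := normOne_sub_le c (y + (k : ℤ) • v) a
      have h2 := normOne_sub_le (y + (k : ℤ) • v) (y + (k : ℤ) • u) a
      have h3 := normOne_sub_comm (y + (k : ℤ) • u) a
      have h4 := normOne_sub_comm (y + (k : ℤ) • v) (y + (k : ℤ) • u)
      linarith
    · left
      simp only [Set.mem_iUnion]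
      exact ⟨v, hv, hbv⟩
  · left
    simp only [Set.mem_iUnion]
    exact ⟨u, hu, hbu⟩

lemma DiscreteLoop.nonempty {V : Type*} (ℓ : DiscreteLoop V) : ∃ w, w ∈ ℓ.1 := by
  obtain ⟨⟨l⟩, hl⟩ := ℓ
  rcases l with _ | ⟨a, l⟩
  · exact absurd (show 2 ≤ 0 from hl.1) (by norm_num)
  · exact ⟨a, List.mem_cons_self⟩

lemma disjoint_localLoops {z z' : Fin d → ℤ} {L : ℕ} (h : 36 * (L : ℤ) < normOne (z - z')) :
    Disjoint (localLoops z L) (localLoops z' L) := by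
  rw [Set.disjoint_left]
  intro ℓ h1 h2
  obtain ⟨w, hw⟩ := DiscreteLoop.nonempty ℓ
  have h3 := h1 w hw
  have h4 := h2 w hw
  have h5 := normOne_sub_le z w z'
  rw [normOne_sub_comm z w] at h5
  linarith

/-- The probability of a far connection is small uniformly over all scales, for small intensity. -/
lemma exists_farConnected_le (hd : 3 ≤ d) : ∃ α₀ : ℝ≥0, 0 < α₀ ∧ ∀ α ≤ α₀, ∀ (n : ℕ)
    (y : Fin d → ℤ),
    loopEnsemble (latticeGraph d) α 0 (farConnected y (d * 40 ^ n)) ≤ ENNReal.ofReal (1 / 2) := by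
  obtain ⟨C, hC, hbig⟩ := exists_loopMeasure_bigLoops_le hd
  set K : ℝ := ((netOffsets d).card : ℝ) with hK
  have hK1 : 1 ≤ K := by
    have : 0 < (netOffsets d).card := Finset.card_pos.2 ⟨0, mem_netOffsets.2 (by simp [normOne])⟩
    rw [hK]
    exact_mod_cast this
  -- Chosen so that `K² ε² = ε / 2`; the intensity is then taken small enough for the big loops to
  -- contribute at most the other `ε / 2`.
  set ε : ℝ := 1 / (2 * K ^ 2) with hε
  have hε0 : 0 < ε := by positivity
  have hε1 : ε ≤ 1 / 2 := by
    rw [hε]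
    apply one_div_le_one_div_of_le (by norm_num)
    nlinarith
  have hc0 : 0 < ε / (2 * K * C) := by positivity
  refine ⟨(ε / (2 * K * C)).toNNReal, Real.toNNReal_pos.2 hc0, fun α hα n y => ?_⟩
  have hα' : (α : ℝ) * C * K ≤ ε / 2 := by
    have h1 : (α : ℝ) ≤ ε / (2 * K * C) := (Real.le_toNNReal_iff_coe_le hc0.le).1 hα
    calc (α : ℝ) * C * K ≤ ε / (2 * K * C) * C * K := by gcongr
      _ = ε / 2 := by field_simp
  set P := loopEnsemble (latticeGraph d) α 0 with hP
  have hbigP : ∀ M : ℕ, 1 ≤ M → ∀ z, P (bigLoopEvent z M) ≤ ENNReal.ofReal (α * C) := by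
    intro M hM z
    refine (loopEnsemble_exists_le α 0 (bigLoops z M)).trans ?_
    rw [ENNReal.ofReal_mul α.coe_nonneg]
    refine mul_le_mul' ?_ (hbig M hM z)
    rw [ENNReal.ofReal_coe_nnreal]
  have hsum : ∀ f : (Fin d → ℤ) → Set (DiscreteLoop (Fin d → ℤ) → ℕ), ∀ c : ℝ, 0 ≤ c →
      (∀ u, P (f u) ≤ ENNReal.ofReal c) → P (⋃ u ∈ netOffsets d, f u) ≤ ENNReal.ofReal (K * c) := by
    intro f c hc hf
    refine (measure_biUnion_finset_le _ _).trans ((Finset.sum_le_sum fun u _ => hf u).trans_eq ?_)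
    rw [Finset.sum_const, nsmul_eq_mul, hK, ENNReal.ofReal_mul (by positivity),
      ENNReal.ofReal_natCast]
  suffices h : P (farConnected y (d * 40 ^ n)) ≤ ENNReal.ofReal ε from
    h.trans (ENNReal.ofReal_le_ofReal hε1)
  induction n generalizing y with
  | zero =>
    -- At the initial scale the first open edge of the connection already gives a loop through `a`,
    -- and at `M = 1` every loop through the centre is big, its length being at least `2`.
    have hsub : farConnected y (d * 40 ^ 0) ⊆ ⋃ u ∈ netOffsets d, bigLoopEvent (y + u) 1 := by
      rintro N ⟨a, b, ha, hb, ⟨p⟩⟩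
      simp only [pow_zero, mul_one] at ha hb
      have hne : a ≠ b := by
        rintro rfl
        have := normOne_nonneg (a - y)
        linarith
      cases p with
      | nil => exact absurd rfl hne
      | cons h p =>
        obtain ⟨-, ℓ, h2, h3⟩ := h
        simp only [Set.mem_iUnion]
        refine ⟨a - y, mem_netOffsets.2 (by linarith), ℓ, ⟨⟨a, h3.left_mem, ?_⟩, Or.inl ?_⟩, h2⟩
        · simp [normOne]
        · have := ℓ.2.1
          omega
    refine (measure_mono hsub).trans
      ((hsum _ _ (by positivity) fun u => hbigP 1 le_rfl _).trans (ENNReal.ofReal_le_ofReal ?_))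
    linarith
  | succ n ih =>
    have hk : 1 ≤ 40 ^ n := Nat.one_le_pow _ _ (by norm_num)
    have hL : 1 ≤ 2 * (d * 40 ^ n) := by
      have : 0 < d * 40 ^ n := by positivity
      omega
    rw [show d * 40 ^ (n + 1) = 40 * (d * 40 ^ n) by ring]
    refine (measure_mono (farConnected_step y hk (by omega))).trans
      ((measure_union_le _ _).trans ?_)
    refine (add_le_add (hsum _ _ (by positivity) fun u => hbigP _ hL _)
      (hsum _ (K * (ε * ε)) (by positivity) fun u => hsum _ (ε * ε) (by positivity)
        fun v => ?_)).trans ?_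
    · by_cases h : 36 * ((d * 40 ^ n : ℕ) : ℤ) <
          normOne ((y + ((40 ^ n : ℕ) : ℤ) • u) - (y + ((40 ^ n : ℕ) : ℤ) • v))
      · simp only [h, Set.iUnion_true]
        refine (loopEnsemble_inter_eq_mul α 0 (disjoint_localLoops h)
          (measurableSet_farConnected _ _) (measurableSet_farConnected _ _)).trans_le ?_
        rw [ENNReal.ofReal_mul hε0.le]
        exact mul_le_mul' ((measure_mono (localConnected_subset _ _)).trans (ih _))
          ((measure_mono (localConnected_subset _ _)).trans (ih _))
      · simp only [h, Set.iUnion_false, measure_empty, zero_le]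
    · rw [← ENNReal.ofReal_add (by positivity) (by positivity)]
      refine ENNReal.ofReal_le_ofReal ?_
      have e : K * (K * (ε * ε)) = ε / 2 := by
        rw [hε]; field_simp
      linarith

/-- There is no infinite open cluster for small intensity. -/
lemma exists_infiniteClusterEvent_eq_zero (hd : 3 ≤ d) : ∃ α₀ : ℝ≥0, 0 < α₀ ∧ ∀ α ≤ α₀,
    loopEnsemble (latticeGraph d) α 0 (infiniteClusterEvent (latticeGraph d)) = 0 := by
  obtain ⟨α₀, h0, hfar⟩ := exists_farConnected_le hd
  refine ⟨α₀, h0, fun α hα => ?_⟩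
  refine (loopEnsemble_infiniteClusterEvent_zero_or_one α 0).resolve_right fun h1 => ?_
  -- An infinite cluster leaves every ball, so each `A n` has probability at most `1/2`; these
  -- increasing events exhaust the infinite cluster event, whose probability therefore cannot be
  -- one.
  let A : ℕ → Set (DiscreteLoop (Fin d → ℤ) → ℕ) := fun n =>
    {N | ∃ x, normOne (x - 0) ≤ (d * 40 ^ n : ℕ) ∧ (openCluster (latticeGraph d) N x).Infinite}
  have hmono : Monotone A := by
    intro n m hnm N ⟨x, hx, hinf⟩
    refine ⟨x, hx.trans ?_, hinf⟩
    exact_mod_cast Nat.mul_le_mul le_rfl (Nat.pow_le_pow_right (by norm_num) hnm)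
  have hunion : infiniteClusterEvent (latticeGraph d) ⊆ ⋃ n, A n := by
    rintro N ⟨x, hx⟩
    refine Set.mem_iUnion.2 ⟨(normOne (x - 0)).toNat, x, ?_, hx⟩
    have h2 : (normOne (x - 0)).toNat ≤ d * 40 ^ (normOne (x - 0)).toNat :=
      (Nat.lt_pow_self (by norm_num)).le.trans (Nat.le_mul_of_pos_left _ (by omega))
    calc normOne (x - 0) = ((normOne (x - 0)).toNat : ℤ) :=
          (Int.toNat_of_nonneg (normOne_nonneg _)).symm
      _ ≤ _ := by exact_mod_cast h2
  have hA : ∀ n, A n ⊆ farConnected 0 (d * 40 ^ n) := by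
    rintro n N ⟨x, hx, hinf⟩
    obtain ⟨b, hb, hb'⟩ := hinf.exists_notMem_finite
      (finite_setOf_normOne_le (d := d) (2 * ((d * 40 ^ n : ℕ) : ℤ)))
    refine ⟨x, b, hx, ?_, hb⟩
    rw [sub_zero]
    exact not_le.1 hb'
  have h2 : loopEnsemble (latticeGraph d) α 0 (⋃ n, A n) ≤ ENNReal.ofReal (1 / 2) := by
    rw [hmono.measure_iUnion]
    exact iSup_le fun n => (measure_mono (hA n)).trans (hfar α hα n 0)
  have h3 := (measure_mono hunion).trans h2
  rw [h1] at h3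
  exact absurd h3 (not_le.2 (by rw [ENNReal.ofReal_lt_one]; norm_num))

/-- Monotonicity in `α` is not needed: percolation is excluded at every `α ≤ α₀`, so `α₀` bounds the
infimum from below. -/
lemma criticalAlpha_pos (hd : 3 ≤ d) (o : Fin d → ℤ) :
    0 < criticalAlpha (latticeGraph d) o 0 := by
  obtain ⟨α₀, h0, h⟩ := exists_infiniteClusterEvent_eq_zero hd
  refine lt_of_lt_of_le (ENNReal.coe_pos.2 h0) (le_iInf₂ fun α hα => ?_)
  rw [ENNReal.coe_le_coe]
  by_contra hcon
  refine hα.ne' (measure_mono_null (fun N hN => ?_) (h α (le_of_not_ge hcon)))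
  exact ⟨o, hN⟩

/-- For `-1 < κ < 0` the percolation probability is one, so no negative `κ` enters the infimum. -/
lemma criticalKappa_nonneg (hd : 0 < d) (o : Fin d → ℤ) {α : ℝ≥0} (hα : 0 < α) :
    0 ≤ criticalKappa (latticeGraph d) o α := by
  refine le_iInf₂ fun κ hκ => ?_
  by_contra hcon
  push Not at hcon
  have h := percolationProb_of_neg hd latticeGraph_connected hκ.1 (by exact_mod_cast hcon) hα o
  rw [hκ.2] at h
  exact zero_ne_one h

end Renormalization

end

end LoopPercolation

theorem theorem1p1 :
    (∀ d : ℕ, 3 ≤ d →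
      0 < LoopPercolation.criticalAlpha (LoopPercolation.latticeGraph d) 0 0 ∧
      ∀ α : ℝ≥0, 0 < α →
        0 ≤ LoopPercolation.criticalKappa (LoopPercolation.latticeGraph d) 0 α) ∧
    (∀ {V : Type*} (G : SimpleGraph V) [G.LocallyFinite],
      G.Connected → LoopPercolation.IsRecurrent G → ∀ α : ℝ≥0, 0 < α →
        ∀ᵐ N ∂(LoopPercolation.loopEnsemble G α 0),
          ∀ x y : V, y ∈ LoopPercolation.openCluster G N x) :=
  ⟨fun _ hd => ⟨LoopPercolation.criticalAlpha_pos hd 0,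
    fun _ hα => LoopPercolation.criticalKappa_nonneg (by omega) 0 hα⟩,
    fun _ _ hG hrec _ hα => LoopPercolation.ae_forall_mem_openCluster_of_isRecurrent hG hrec hα⟩
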